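/- Let $N\ge 2$, $\Lambda_N=\{1,\dots,N-1\}$, $T_N=\{(x,y)\in\Lambda_N^2: x\le y\}$ and $\partial T_N=\{(0,y):0\le y\le N\}\cup\{(x,N):0\le x\le N\}$. For a process $(\eta_t)_{t\ge0}$ with values in $S^{\Lambda_N}$, $S\subset\mathbb R$, write $\varrho_t(x)=\mathbb E[\eta_{tN^2}(x)]$ for $x\in\Lambda_N$, and for $F:\mathbb R^2\to\mathbb R$ let $\varphi_t=\varphi_t^F$ be the function on $T_N\cup\partial T_N$ given by $$\varphi_t(x,y)=\mathbb E\big[(\eta_{tN^2}(x)-\varrho_t(x))(\eta_{tN^2}(y)-\varrho_t(y))\big]\ (x<y\text{ in }\Lambda_N),\qquad \varphi_t(x,x)=\mathbb E\big[F(\eta_{tN^2}(x),\varrho_t(x))\big]\ (x\in\Lambda_N),\qquad \varphi_t=0\text{ on }\partial T_N .$$ For real $c>0$, $d$ and $\lambda_\pm>0$ let $\Delta^{2D}_{c,d,\lambda_-,\lambda_+}$ act on functions $f$ on $T_N\cup\partial T_N$ (extended by $f(y,x)=f(x,y)$) by $$\begin{aligned}\Delta^{2D}f(x,y)=N^2\big(&c_{x,x-1}[f(x-1,y)-f(x,y)]+c_{x,x+1}[f(x+1,y)-f(x,y)]\\&+c_{y,y-1}[f(x,y-1)-f(x,y)]+c_{y,y+1}[f(x,y+1)-f(x,y)]\\&+d\,[f(x,x)+f(x+1,x+1)-2f(x,x+1)]\,\mathbf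 1_{y=x+1}\big)\end{aligned}$$ for $(x,y)\in T_N$, where $c_{1,0}=c\lambda_-$, $c_{N-1,N}=c\lambda_+$ and all other $c_{z,z\pm1}=c$; and $\Delta^{2D}f=0$ on $\partial T_N$. For $\alpha\ge 1$ let $\mathcal L_\alpha f=0$ on $\partial T_N$ and, on $T_N$, $$\mathcal L_\alpha f(x,y)=\tfrac1\alpha\big[f(x-1,y)+f(x+1,y)+f(x,y-1)+f(x,y+1)-4f(x,y)\big]\quad (x<y),$$ $$\mathcal L_\alpha f(x,x)=\tfrac{2}{\alpha+1}\big[f(x-1,x)+f(x,x+1)-2f(x,x)\big]+\tfrac1{\alpha(\alpha+1)}\big[f(x-1,x-1)+f(x+1,x+1)-2f(x,x)\big].$$ In each of the models below let $(\eta_t)$ be the càdlàg Markov process with the given generator (understood as a solution of the martingale problem for finitely supported functions on $\mathbb N_0^{\Lambda_N}$, respectively for $C_c^\infty$ functions on $\mathbb R^{\Lambda_N}$), started from a probability measure $\mu^N$ with finite second moments. Then $\mathbb E[\eta_t(x)^2]<\infty$ for all $t\ge0$, $x\in\Lambda_N$; the operator $A$ below generates a two-dimensional continuous-time random walk on $T_N\cup\partial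 T_N$ absorbed at $\partial T_N$; the function $g$ below is bounded on $[0,T]\times T_N$ for every $T$; and for all $t\ge0$ (one-sided derivative at $t=0$) and all $(x,y)\in T_N$ $$\partial_t\varphi_t(x,y)=A\varphi_t(x,y)+g_t(x,y),\qquad(\ast)$$ except that in model 1 with $c+d=0$ (where $\varphi_t$ is not defined on the diagonal and the walk does not jump from off-diagonal points to the diagonal) $(\ast)$ is claimed only for $x<y$. 1. **Particle systems (SEP, SIP, IRW).** $c>0$, $d\in\mathbb R$; if $d<0$ then $-c/d\in\mathbb N$. State space $\mathbb N_0^{\Lambda_N}$ if $d\ge0$ and $\{0,\dots,-c/d\}^{\Lambda_N}$ if $d<0$; particles jump from $x$ to a nearest neighbour $y$ in $\Lambda_N$ at rate $\eta(x)(c+d\eta(y))$; at site $1$ particles enter at rate $\lambda_-\varrho_-(c+d\eta(1))$ and leave at rate $\lambda_-\eta(1)(c+d\varrho_-)$, and similarly at site $N-1$ with $\lambda_+,\varrho_+$; here $\lambda_\pm\in(0,1]$, $\varrho_\pm>0$, and $\varrho_\pm<-c/d$ if $d<0$. Then $F(u,r)=\frac{c}{c+d}u(u-1)-r^2$, $A=\Delta^{2D}_{c,d,\lambda_-,\lambda_+}$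 and $$g_t(x,y)=dN^2(\varrho_t(x+1)-\varrho_t(x))^2\mathbf 1_{y=x+1}.$$ 2. **Ginzburg–Landau dynamics** on $\mathbb R^{\Lambda_N}$ with $\Phi_\pm\in\mathbb R$ and generator $$\sum_{x=1}^{N-2}\{(\eta(x)-\eta(x+1))(\partial_{x+1}-\partial_x)+(\partial_{x+1}-\partial_x)^2\}+\partial_1^2+(\Phi_--\eta(1))\partial_1+\partial_{N-1}^2+(\Phi_+-\eta(N-1))\partial_{N-1}.$$ With $A=\Delta^{2D}_{1,0,1,1}$, $(\ast)$ holds both for $F(u,r)=u^2-r^2$ with $g_t(x,y)=-2N^2\mathbf 1_{y=x+1}+4N^2\mathbf 1_{y=x}$, and for $F(u,r)=u^2-r^2-1$ with $g=0$. 3. **Brownian energy process** on $[0,\infty)^{\Lambda_N}$ with $\alpha,T_\pm>0$ and generator $$\sum_{x=1}^{N-2}\{\eta(x)\eta(x+1)(\partial_x-\partial_{x+1})^2-\alpha(\eta(x)-\eta(x+1))(\partial_x-\partial_{x+1})\}+\sum_{(x,T)}\big\{(T\alpha-\tfrac12\eta(x))\partial_x+T\eta(x)\partial_x^2\big\},$$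 where the last sum is over $(x,T)=(1,T_-)$ and $(x,T)=(N-1,T_+)$. Then $F(u,r)=\frac{\alpha}{\alpha+1}u^2-r^2$, $A=\Delta^{2D}_{\alpha,1,\lambda,\lambda}$ with $\lambda=\frac1{2\alpha}$, and $$g_t(x,y)=N^2(\varrho_t(x+1)-\varrho_t(x))^2\mathbf 1_{y=x+1}.$$ 4. **Open harmonic model (interacting piles)** on $\mathbb N_0^{\Lambda_N}$, with $\alpha\in\{1,2,\dots\}$ and $\beta_\pm\in(0,1)$: for $1\le k\le\eta(x)$, a pile of $k$ particles jumps from $x\in\Lambda_N$ to each of $x\pm1$ (leaving the system if it jumps to $0$ or $N$) at rate $$h_\alpha(k,\eta(x)),\qquad h_\alpha(j,m)=\frac1j\frac{\Gamma(m+1)\Gamma(m-j+\alpha)}{\Gamma(m-j+1)\Gamma(m+\alpha)},$$ and for $k\ge1$, $k$ particles enter at $1$ at rate $\beta_-^k/k$ and at $N-1$ at rate $\beta_+^k/k$. Then $F(u,r)=\frac{\alpha}{\alpha+1}u(u-1)-r^2$, $A=N^2\mathcal L_\alpha$ and $$g_t(x,y)=\frac{N^2}{\alpha(\alpha+1)}\Big[(\varrho_t(x+1)-\varrho_t(x))^2+(\varrho_t(x-1)-\varrho_t(x))^2\Big]\mathbf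 1_{y=x},$$ where $\varrho_t(0)=\frac{\alpha\beta_-}{1-\beta_-}$ and $\varrho_t(N)=\frac{\alpha\beta_+}{1-\beta_+}$. -/

import Mathlib

open MeasureTheory ProbabilityTheory Filter Topology Set
open scoped NNReal

noncomputable section

namespace TwoPoint

/-! ### Lattice, configurations, triangle -/

/-- The bulk `Λ_N = {1, …, N - 1}`. -/
abbrev Site (N : ℕ) : Type := {x : ℕ // x ∈ Finset.Ioo 0 N}

/-- Value of a configuration at the lattice point `x` (`0` outside the bulk). -/
def val {N : ℕ} {R : Type} [Zero R] (η : Site N → R) (x : ℕ) : R :=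
  if h : x ∈ Finset.Ioo 0 N then η ⟨x, h⟩ else 0

/-- `η + k δ_x`. -/
def addAt {N : ℕ} (η : Site N → ℕ) (x k : ℕ) : Site N → ℕ :=
  fun z => if z.1 = x then η z + k else η z

/-- `η - k δ_x`. It is only used when `k ≤ η x` or when the corresponding rate is `0`. -/
def subAt {N : ℕ} (η : Site N → ℕ) (x k : ℕ) : Site N → ℕ :=
  fun z => if z.1 = x then η z - k else η z

/-- `T_N = {(x, y) ∈ Λ_N² : x ≤ y}`. -/
def triangle (N : ℕ) : Set (ℕ × ℕ) := {p | 0 < p.1 ∧ p.1 ≤ p.2 ∧ p.2 < N}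

/-- `∂T_N = {(0, y) : 0 ≤ y ≤ N} ∪ {(x, N) : 0 ≤ x ≤ N}`. -/
def triangleBoundary (N : ℕ) : Set (ℕ × ℕ) :=
  {p | (p.1 = 0 ∧ p.2 ≤ N) ∨ (p.1 ≤ N ∧ p.2 = N)}

/-- `T_N ∪ ∂T_N = {(x, y) : 0 ≤ x ≤ y ≤ N}` as a finite set. -/
def closedTriangle (N : ℕ) : Finset (ℕ × ℕ) :=
  (Finset.range (N + 1) ×ˢ Finset.range (N + 1)).filter fun p => p.1 ≤ p.2

/-! ### Markov processes through the martingale problem -/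

/-- Right-continuous with left limits. -/
def IsCadlagPath {E : Type} [TopologicalSpace E] (w : ℝ≥0 → E) : Prop :=
  ∀ t, ContinuousWithinAt w (Ici t) t ∧ ∃ l, Tendsto w (𝓝[<] t) (𝓝 l)

/-- `X` is a càdlàg Markov process with state space `K ⊆ E`, generator `L` and initial law `μ`, in
the sense of the martingale problem on the test functions `D`: for every `f ∈ D` the process
`f (X_t) - f (X_0) - ∫₀ᵗ L f (X_s) ds` is a martingale. -/
structure IsProcess {Ω : Type*} {E : Type} [mΩ : MeasurableSpace Ω] [TopologicalSpace E]
    [MeasurableSpace E] (P : Measure Ω) (ℱ : Filtration ℝ≥0 mΩ) (D : Set (E → ℝ))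
    (L : (E → ℝ) → E → ℝ) (K : Set E) (μ : Measure E) (X : ℝ≥0 → Ω → E) : Prop where
  adapted : ∀ t, Measurable[ℱ t] (X t)
  cadlag : ∀ ω, IsCadlagPath fun t => X t ω
  state : ∀ t ω, X t ω ∈ K
  initial : P.map (X 0) = μ
  martingale : ∀ f ∈ D, Martingale
    (fun (t : ℝ≥0) ω => f (X t ω) - f (X 0 ω) - ∫ s in (0 : ℝ)..t, L f (X s.toNNReal ω)) ℱ P

/-- Test functions on a countable discrete state space: finitely supported functions. -/
def finSupp (E : Type) : Set (E → ℝ) := {f | f.support.Finite}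

/-- Test functions on `ℝ^{Λ_N}`: smooth functions with compact support. -/
def smoothCompact (N : ℕ) : Set ((Site N → ℝ) → ℝ) :=
  {f | ContDiff ℝ (⊤ : ℕ∞) f ∧ HasCompactSupport f}

/-! ### The models -/

/-- Bulk rates `r_{x,y}(η) = η(x) (c + d η(y))`. -/
def bulkRate {N : ℕ} (c d : ℝ) (η : Site N → ℕ) (x y : ℕ) : ℝ :=
  ((val η x : ℕ) : ℝ) * (c + d * ((val η y : ℕ) : ℝ))

/-- Generator of the exchange with a reservoir of density `r` and strength `l`, attached to the
site `x`. -/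
def particleReservoir {N : ℕ} (c d l r : ℝ) (x : ℕ) (f : (Site N → ℕ) → ℝ) (η : Site N → ℕ) : ℝ :=
  l * r * (c + d * ((val η x : ℕ) : ℝ)) * (f (addAt η x 1) - f η)
    + l * ((val η x : ℕ) : ℝ) * (c + d * r) * (f (subAt η x 1) - f η)

/-- Generator `L_{0,N} + L_{b,N}` of the boundary-driven particle system. -/
def particleGen (N : ℕ) (c d lm lp rm rp : ℝ) (f : (Site N → ℕ) → ℝ) (η : Site N → ℕ) : ℝ :=
  (∑ x ∈ Finset.Icc 1 (N - 2),
    (bulkRate c d η x (x + 1) * (f (addAt (subAt η x 1) (x + 1) 1) - f η)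
      + bulkRate c d η (x + 1) x * (f (addAt (subAt η (x + 1) 1) x 1) - f η)))
  + particleReservoir c d lm rm 1 f η + particleReservoir c d lp rp (N - 1) f η

/-- State space of the particle system: `c + d η(x) ≥ 0` at every site, that is, `ℕ^{Λ_N}` if
`d ≥ 0` and `{0, …, -c/d}^{Λ_N}` if `d < 0`. -/
def particleStates (N : ℕ) (c d : ℝ) : Set (Site N → ℕ) := {η | ∀ x, 0 ≤ c + d * (η x : ℝ)}

/-- The unit vector `δ_x` of `ℝ^{Λ_N}`. -/
def unitVec (N : ℕ) (x : ℕ) : Site N → ℝ := fun z => if z.1 = x then 1 else 0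

/-- Directional derivative, as an operator on functions. -/
def dirDeriv {N : ℕ} (v : Site N → ℝ) (f : (Site N → ℝ) → ℝ) (z : Site N → ℝ) : ℝ := fderiv ℝ f z v

/-- Generator of the boundary-driven Ginzburg–Landau dynamics with linear interaction. -/
def glGen (N : ℕ) (a b : ℝ) (f : (Site N → ℝ) → ℝ) (z : Site N → ℝ) : ℝ :=
  (∑ x ∈ Finset.Icc 1 (N - 2),
    ((val z x - val z (x + 1)) * dirDeriv (unitVec N (x + 1) - unitVec N x) f z
      + dirDeriv (unitVec N (x + 1) - unitVec N x)
          (dirDeriv (unitVec N (x + 1) - unitVec N x) f) z))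
  + (dirDeriv (unitVec N 1) (dirDeriv (unitVec N 1) f) z
      + (a - val z 1) * dirDeriv (unitVec N 1) f z)
  + (dirDeriv (unitVec N (N - 1)) (dirDeriv (unitVec N (N - 1)) f) z
      + (b - val z (N - 1)) * dirDeriv (unitVec N (N - 1)) f z)

/-- Generator of the thermal bath of temperature `T` attached to the site `x` in the Brownian
energy process. -/
def bepReservoir {N : ℕ} (α T : ℝ) (x : ℕ) (f : (Site N → ℝ) → ℝ) (z : Site N → ℝ) : ℝ :=
  (T * α - val z x / 2) * dirDeriv (unitVec N x) f z
    + T * val z x * dirDeriv (unitVec N x) (dirDeriv (unitVec N x) f) z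

/-- Generator of the boundary-driven Brownian energy process. -/
def bepGen (N : ℕ) (α Tm Tp : ℝ) (f : (Site N → ℝ) → ℝ) (z : Site N → ℝ) : ℝ :=
  (∑ x ∈ Finset.Icc 1 (N - 2),
    (val z x * val z (x + 1) * dirDeriv (unitVec N x - unitVec N (x + 1))
          (dirDeriv (unitVec N x - unitVec N (x + 1)) f) z
      - α * (val z x - val z (x + 1)) * dirDeriv (unitVec N x - unitVec N (x + 1)) f z))
  + bepReservoir α Tm 1 f z + bepReservoir α Tp (N - 1) f z

/-- `h_α(j, m) = (1/j) Γ(m+1) Γ(m-j+α) / (Γ(m-j+1) Γ(m+α))`, used for `1 ≤ j ≤ m`. -/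
def pileRate (α j m : ℕ) : ℝ :=
  1 / (j : ℝ) * (Real.Gamma ((m : ℝ) + 1) * Real.Gamma ((m : ℝ) - j + α))
    / (Real.Gamma ((m : ℝ) - j + 1) * Real.Gamma ((m : ℝ) + α))

/-- Reservoir with parameter `β` attached to the site `x` in the harmonic model. -/
def pileReservoir {N : ℕ} (α : ℕ) (β : ℝ) (x : ℕ) (f : (Site N → ℕ) → ℝ) (η : Site N → ℕ) : ℝ :=
  (∑ k ∈ Finset.Icc 1 (val η x), pileRate α k (val η x) * (f (subAt η x k) - f η))
    + ∑' k : ℕ, β ^ (k + 1) / ((k : ℝ) + 1) * (f (addAt η x (k + 1)) - f η)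

/-- Generator of the open harmonic model (interacting piles). -/
def pileGen (N α : ℕ) (bm bp : ℝ) (f : (Site N → ℕ) → ℝ) (η : Site N → ℕ) : ℝ :=
  (∑ x ∈ Finset.Icc 1 (N - 2),
    ((∑ k ∈ Finset.Icc 1 (val η x),
        pileRate α k (val η x) * (f (addAt (subAt η x k) (x + 1) k) - f η))
      + ∑ k ∈ Finset.Icc 1 (val η (x + 1)),
          pileRate α k (val η (x + 1)) * (f (addAt (subAt η (x + 1) k) x k) - f η)))
  + pileReservoir α bm 1 f η + pileReservoir α bp (N - 1) f η

/-! ### Density profile and correlation function -/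

/-- The occupation variables of the process, as real-valued variables indexed by `ℕ`. -/
def occ {Ω : Type*} {N : ℕ} (η : ℝ≥0 → Ω → Site N → ℕ) (t : ℝ≥0) (ω : Ω) (x : ℕ) : ℝ :=
  ((val (η t ω) x : ℕ) : ℝ)

/-- The same for real-valued configurations. -/
def field {Ω : Type*} {N : ℕ} (z : ℝ≥0 → Ω → Site N → ℝ) (t : ℝ≥0) (ω : Ω) (x : ℕ) : ℝ :=
  val (z t ω) x

/-- The accelerated time `t N²`. -/
def accel (N : ℕ) (t : ℝ) : ℝ≥0 := (t * (N : ℝ) ^ 2).toNNReal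

/-- Discrete density profile `ϱ_t(x) = E[Y_{tN²}(x)]` for `x ∈ Λ_N`, with the prescribed values
`a` at `0` and `b` at `N`. -/
def density {Ω : Type*} [MeasurableSpace Ω] (P : Measure Ω) (N : ℕ) (Y : ℝ≥0 → Ω → ℕ → ℝ)
    (a b : ℝ) (t : ℝ) (x : ℕ) : ℝ :=
  if x = 0 then a else if x = N then b else ∫ ω, Y (accel N t) ω x ∂P

open Classical in
/-- Two-point correlation function on `T_N ∪ ∂T_N`: the covariance of `Y_{tN²}(x)` and `Y_{tN²}(y)`
for `x < y`, the expectation of `F (Y_{tN²}(x), E[Y_{tN²}(x)])` for `x = y`, and `0` on `∂T_N`. -/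
def corr {Ω : Type*} [MeasurableSpace Ω] (P : Measure Ω) (N : ℕ) (Y : ℝ≥0 → Ω → ℕ → ℝ)
    (F : ℝ → ℝ → ℝ) (t : ℝ) (p : ℕ × ℕ) : ℝ :=
  if p ∈ triangle N then
    if p.1 = p.2 then ∫ ω, F (Y (accel N t) ω p.1) (∫ ω', Y (accel N t) ω' p.1 ∂P) ∂P
    else ∫ ω, (Y (accel N t) ω p.1 - ∫ ω', Y (accel N t) ω' p.1 ∂P)
      * (Y (accel N t) ω p.2 - ∫ ω', Y (accel N t) ω' p.2 ∂P) ∂P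
  else 0

/-! ### Two-dimensional random walks -/

/-- Rate `c_{z,z-1}`. -/
def rateDown (c lm : ℝ) (z : ℕ) : ℝ := if z = 1 then c * lm else c

/-- Rate `c_{z,z+1}`. -/
def rateUp (N : ℕ) (c lp : ℝ) (z : ℕ) : ℝ := if z + 1 = N then c * lp else c

/-- Value at `(x, y)` of the symmetric extension of a function on `{x ≤ y}`. -/
def sym (f : ℕ × ℕ → ℝ) (x y : ℕ) : ℝ := f (min x y, max x y)

open Classical in
/-- The operator `Δ^{2D}_N` on functions on `T_N ∪ ∂T_N`, and `0` at the absorbing points. -/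
def lap2D (N : ℕ) (c d lm lp : ℝ) (f : ℕ × ℕ → ℝ) (p : ℕ × ℕ) : ℝ :=
  if p ∈ triangle N then
    (N : ℝ) ^ 2 *
      (rateDown c lm p.1 * (sym f (p.1 - 1) p.2 - f p)
        + rateUp N c lp p.1 * (sym f (p.1 + 1) p.2 - f p)
        + rateDown c lm p.2 * (sym f p.1 (p.2 - 1) - f p)
        + rateUp N c lp p.2 * (sym f p.1 (p.2 + 1) - f p)
        + if p.2 = p.1 + 1 then d * (f (p.1, p.1) + f (p.1 + 1, p.1 + 1) - 2 * f p) else 0)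
  else 0

open Classical in
/-- The operator of the two-dimensional random walk associated with the harmonic model. -/
def pileLap2D (N α : ℕ) (f : ℕ × ℕ → ℝ) (p : ℕ × ℕ) : ℝ :=
  if p ∈ triangle N then
    (N : ℝ) ^ 2 *
      if p.1 = p.2 then
        2 / ((α : ℝ) + 1) * (f (p.1 - 1, p.1) + f (p.1, p.1 + 1) - 2 * f p)
          + 1 / ((α : ℝ) * ((α : ℝ) + 1))
            * (f (p.1 - 1, p.1 - 1) + f (p.1 + 1, p.1 + 1) - 2 * f p)
      else
        1 / (α : ℝ) * (f (p.1 - 1, p.2) + f (p.1 + 1, p.2) + f (p.1, p.2 - 1) + f (p.1, p.2 + 1)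
          - 4 * f p)
  else 0

/-- `A` is the generator of a continuous-time random walk on `T_N ∪ ∂T_N`, absorbed at `∂T_N`,
that changes each coordinate by at most one at a jump; `q p p'` is the rate from `p` to `p'`. -/
def IsAbsorbedWalkGenerator (N : ℕ) (A : (ℕ × ℕ → ℝ) → ℕ × ℕ → ℝ) : Prop :=
  ∃ q : ℕ × ℕ → ℕ × ℕ → ℝ,
    (∀ p p', 0 ≤ q p p') ∧
    (∀ p ∈ triangleBoundary N, ∀ p', q p p' = 0) ∧
    (∀ p p', q p p' ≠ 0 →
      |(p'.1 : ℤ) - p.1| ≤ 1 ∧ |(p'.2 : ℤ) - p.2| ≤ 1) ∧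
    ∀ f, ∀ p ∈ closedTriangle N, A f p = ∑ p' ∈ closedTriangle N, q p p' * (f p' - f p)

/-- `∂_t φ_t = A φ_t + g_t` on `S` for all `t ≥ 0`, where `A` generates a two-dimensional random
walk absorbed at `∂T_N` and `g_t` is bounded in the space variables, uniformly for `t` in compact
intervals. -/
structure ClosedEquation (N : ℕ) (S : Set (ℕ × ℕ)) (φ : ℝ → ℕ × ℕ → ℝ)
    (A : (ℕ × ℕ → ℝ) → ℕ × ℕ → ℝ) (g : ℝ → ℕ × ℕ → ℝ) : Prop where
  generator : IsAbsorbedWalkGenerator N A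
  bounded : ∀ T : ℝ, ∃ C : ℝ, ∀ t ∈ Icc 0 T, ∀ p ∈ triangle N, |g t p| ≤ C
  evolution : ∀ p ∈ S, ∀ t : ℝ, 0 ≤ t →
    HasDerivWithinAt (fun s => φ s p) (A (φ t) p + g t p) (Ici 0) t

end TwoPoint

end

open MeasureTheory ProbabilityTheory Filter Topology Set
open scoped NNReal

noncomputable section

namespace TwoPoint

/-! ### Moments of solutions of a martingale problem -/

/-! Treat the two reservoirs as frozen sites 0 and N with prescribed densities. Every model is then
an exchange dynamics across the bonds {x, x+1}, 0 ≤ x < N, and for affine functionals u, v of the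
configuration its generator sends uv to the sum over bonds of (u ∇v + v ∇u) J + ∇u ∇v Q, with J the
current and Q the mobility (`quadGen`). In all four models J obeys Fick's law, hence is affine, and
Q is a polynomial of degree at most two. So quadratic functionals are mapped to quadratic
functionals (`quadGen_mem_quadSpan`), and the first two moments solve a closed linear system
(`IsQuadraticModel.isMomentSystem`).

What remains is algebra. Off the diagonal φ is a covariance, and the mobility of the bond {x, x+1}
enters only at y = x or y = x+1. On the diagonal φ has the form k₁ m + k₂ r - r² + k₃, where m is
the second moment and r the density. The coefficients are those for which the terms of Q that are
not functions of the density alone turn into jumps of the walk to and from the diagonal. What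
survives is a squared density gradient, or a constant for Ginzburg–Landau. This is done once for
mobilities that couple the two ends of a bond (`IsMomentSystem.closedEquation_lap2D`) and once for
mobilities that split into a sum over the two ends (`IsMomentSystem.closedEquation_pileLap2D`).

The analytic difficulty is that the martingale problem only admits finitely supported or compactly
supported test functions, whereas quadratic functionals are unbounded. A Lyapunov function V of
quadratic growth is first shown to stay integrable: its bounded truncations, minus their values at
infinity, are test functions, and Gronwall followed by Fatou gives `IsProcess.moment_bound`. Then uv
is approximated by test functions which, together with their images under the generator, are
dominated by V, and dominated convergence yields Dynkin's formula (`IsProcess.dynkin`). The uniform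
domination is the model-dependent part: `IsJumpRates.isQuadraticModel` handles jump processes and
`IsDiffusion.isQuadraticModel` handles diffusions. -/

theorem integrable_of_bound {Ω : Type*} {E : Type} [MeasurableSpace Ω] [MeasurableSpace E]
    {P : Measure Ω} [IsProbabilityMeasure P] {V : E → ℝ} (hV : Measurable V)
    {K : Set E} {B : ℝ} (hB : ∀ e ∈ K, |V e| ≤ B) {Y : Ω → E} (hY : Measurable Y)
    (hYK : ∀ ω, Y ω ∈ K) : Integrable (fun ω => V (Y ω)) P :=
  Integrable.of_bound (hV.comp hY).aestronglyMeasurable B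
    (ae_of_all _ fun ω => by simpa using hB _ (hYK ω))

section MartingaleProblem

variable {Ω : Type*} {E : Type} [mΩ : MeasurableSpace Ω] [TopologicalSpace E]
  [MeasurableSpace E] {P : Measure Ω} {ℱ : Filtration ℝ≥0 mΩ} {D : Set (E → ℝ)}
  {L : (E → ℝ) → E → ℝ} {K : Set E} {μ : Measure E} {X : ℝ≥0 → Ω → E}

theorem IsProcess.measurable (hX : IsProcess P ℱ D L K μ X) (t : ℝ≥0) : Measurable (X t) :=
  (hX.adapted t).mono (ℱ.le t) le_rfl

/-- A right-continuous adapted process is jointly measurable. -/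
theorem IsProcess.measurable_uncurry [BorelSpace E] [TopologicalSpace.PseudoMetrizableSpace E]
    (hX : IsProcess P ℱ D L K μ X) : Measurable fun p : ℝ≥0 × Ω => X p.1 p.2 := by
  -- The next point of the grid of mesh 1/(n+1) strictly to the right of s. Only countably many
  -- times occur for each n, and right-continuity at s gives the convergence.
  let d : ℕ → ℝ≥0 → ℝ≥0 := fun n s => ((⌊s * (n + 1)⌋₊ : ℝ≥0) + 1) / (n + 1)
  have hd : ∀ s, Tendsto (fun n => d n s) atTop (𝓝[≥] s) := by
    intro s
    have hlow : ∀ n, s ≤ d n s := by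
      intro n
      have h : (0 : ℝ≥0) < n + 1 := by positivity
      rw [le_div_iff₀ h]
      exact (Nat.lt_floor_add_one _).le
    have hup : ∀ n, d n s ≤ s + 1 / (n + 1) := by
      intro n
      have h : (0 : ℝ≥0) < n + 1 := by positivity
      rw [div_le_iff₀ h, add_mul, one_div, inv_mul_cancel₀ h.ne']
      gcongr
      exact Nat.floor_le (by positivity)
    refine tendsto_nhdsWithin_iff.2 ⟨?_, Eventually.of_forall hlow⟩
    refine tendsto_of_tendsto_of_tendsto_of_le_of_le tendsto_const_nhds ?_ hlow hup
    have := (tendsto_const_nhds (x := s)).add (tendsto_one_div_add_atTop_nhds_zero_nat (𝕜 := ℝ≥0))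
    simpa using this
  refine measurable_of_tendsto_metrizable (f := fun n (p : ℝ≥0 × Ω) => X (d n p.1) p.2)
    (fun n => ?_) ?_
  · have h : Measurable (fun p : ℕ × Ω => X (((p.1 : ℝ≥0) + 1) / (n + 1)) p.2) :=
      measurable_from_prod_countable_right fun k => hX.measurable ((k + 1) / (n + 1))
    have h2 : Measurable (fun p : ℝ≥0 × Ω => (⌊p.1 * ((n : ℝ≥0) + 1)⌋₊, p.2)) :=
      (Nat.measurable_floor.comp (measurable_fst.mul_const _)).prodMk measurable_snd
    have h3 := h.comp h2
    simp only [Function.comp_def] at h3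
    exact h3
  · rw [tendsto_pi_nhds]
    intro p
    exact (hX.cadlag p.2 p.1).1.tendsto.comp (hd p.1)

theorem IsProcess.measurable_comp [BorelSpace E] [TopologicalSpace.PseudoMetrizableSpace E]
    (hX : IsProcess P ℱ D L K μ X) {h : E → ℝ} (hh : Measurable h) :
    Measurable fun p : ℝ × Ω => h (X p.1.toNNReal p.2) :=
  hh.comp (hX.measurable_uncurry.comp
    ((measurable_real_toNNReal.comp measurable_fst).prodMk measurable_snd))

variable [IsProbabilityMeasure P]

/-- Dynkin's formula for a test function. -/
theorem IsProcess.integral_eq (hX : IsProcess P ℱ D L K μ X) {f : E → ℝ} (hf : f ∈ D)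
    (hfi : ∀ t, Integrable (fun ω => f (X t ω)) P) (t : ℝ≥0)
    (hL : Integrable (fun p : ℝ × Ω => L f (X p.1.toNNReal p.2))
      ((volume.restrict (Ioc 0 (t : ℝ))).prod P)) :
    ∫ ω, f (X t ω) ∂P = ∫ ω, f (X 0 ω) ∂P
      + ∫ s in (0 : ℝ)..t, ∫ ω, L f (X s.toNNReal ω) ∂P := by
  -- Equality of the expectations of the martingale at times 0 and t; at time 0 it vanishes
  -- identically.
  have h1 := (hX.martingale f hf).setIntegral_eq (zero_le : (0 : ℝ≥0) ≤ t) MeasurableSet.univ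
  have hI : Integrable (fun ω => ∫ s in (0 : ℝ)..t, L f (X s.toNNReal ω)) P := by
    simp only [intervalIntegral.integral_of_le t.coe_nonneg]
    exact hL.integral_prod_right
  have hswap : ∫ ω, (∫ s in (0 : ℝ)..t, L f (X s.toNNReal ω)) ∂P
      = ∫ s in (0 : ℝ)..t, ∫ ω, L f (X s.toNNReal ω) ∂P := by
    simp only [intervalIntegral.integral_of_le t.coe_nonneg]
    exact (integral_integral_swap hL).symm
  simp only [Measure.restrict_univ, sub_self, NNReal.coe_zero, intervalIntegral.integral_same,
    integral_zero] at h1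
  rw [integral_sub (f := fun ω => f (X t ω) - f (X 0 ω)) ((hfi t).sub (hfi 0)) hI,
    integral_sub (hfi t) (hfi 0), hswap] at h1
  linarith

/-- A sequence of bounded truncations of a Lyapunov function `V` with `L V ≤ C V`. -/
structure IsLyapunov (D : Set (E → ℝ)) (L : (E → ℝ) → E → ℝ) (K : Set E) (V : E → ℝ)
    (W : ℕ → E → ℝ) (a : ℕ → ℝ) (A C : ℝ) : Prop where
  pos : 0 < C
  mem : ∀ n, (fun e => W n e - a n) ∈ D
  meas : ∀ n, Measurable (W n)
  gen_meas : ∀ n, Measurable (L fun e => W n e - a n)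
  bounded : ∀ n, ∃ B, ∀ e ∈ K, |W n e| ≤ B
  gen_bounded : ∀ n, ∃ B, ∀ e ∈ K, |L (fun e => W n e - a n) e| ≤ B
  gen_le : ∀ n, ∀ e ∈ K, L (fun e => W n e - a n) e ≤ C * W n e
  nonneg : ∀ n, ∀ e ∈ K, 0 ≤ W n e
  le : ∀ n, ∀ e ∈ K, W n e ≤ A * V e
  lim : ∀ e ∈ K, Tendsto (fun n => W n e) atTop (𝓝 (V e))

/-- Since h need not be continuous, u cannot be differentiated. Gronwall is applied instead to the
primitive w of u, which is C¹ and satisfies w' ≤ C w + u₀. -/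
theorem le_exp_of_le_integral {u h : ℝ → ℝ} {u₀ C : ℝ} (hC : 0 < C)
    (hh : ∀ t, IntervalIntegrable h volume 0 t)
    (hu : ∀ t, 0 ≤ t → u t = u₀ + ∫ s in (0 : ℝ)..t, h s)
    (hle : ∀ t, 0 ≤ t → h t ≤ C * u t) {T : ℝ} (hT : 0 ≤ T) : u T ≤ u₀ * Real.exp (C * T) := by
  let v : ℝ → ℝ := fun t => u₀ + ∫ s in (0 : ℝ)..t, h s
  have hv : Continuous v :=
    continuous_const.add (intervalIntegral.continuous_primitive
      (fun a b => (hh a).symm.trans (hh b)) 0)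
  let w : ℝ → ℝ := fun t => ∫ s in (0 : ℝ)..t, v s
  have hw : ∀ t, HasDerivAt w (v t) t := fun t =>
    intervalIntegral.integral_hasDerivAt_right (hv.intervalIntegrable _ _)
      (hv.stronglyMeasurableAtFilter _ _) hv.continuousAt
  have hvw : ∀ t, 0 ≤ t → v t ≤ C * w t + u₀ := by
    intro t ht
    have : ∫ s in (0 : ℝ)..t, h s ≤ ∫ s in (0 : ℝ)..t, C * v s :=
      intervalIntegral.integral_mono_on ht (hh t) ((hv.const_mul C).intervalIntegrable _ _)
        fun s hs => (hle s hs.1).trans_eq (by rw [hu s hs.1])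
    rw [intervalIntegral.integral_const_mul] at this
    simp only [v, w] at this ⊢
    linarith
  have hG := le_gronwallBound_of_liminf_deriv_right_le (f := w) (f' := v) (δ := 0) (K := C)
    (ε := u₀) (a := 0) (b := T) (fun t _ => (hw t).continuousAt.continuousWithinAt)
    (fun t _ r hr => (hw t).hasDerivWithinAt.liminf_right_slope_le hr) (by simp [w])
    (fun t ht => hvw t ht.1) T ⟨hT, le_rfl⟩
  rw [gronwallBound_of_K_ne_0 hC.ne'] at hG
  have h2 := hvw T hT
  rw [hu T hT]
  simp only [sub_zero, zero_mul, zero_add] at hG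
  calc v T ≤ C * w T + u₀ := h2
    _ ≤ C * (u₀ / C * (Real.exp (C * T) - 1)) + u₀ := by gcongr
    _ = _ := by field_simp; ring

variable [BorelSpace E] [TopologicalSpace.PseudoMetrizableSpace E]

theorem IsProcess.integrable_prod_of_bound (hX : IsProcess P ℱ D L K μ X) {h : E → ℝ}
    (hm : Measurable h) {B : ℝ} (hB : ∀ e ∈ K, |h e| ≤ B) (T : ℝ) :
    Integrable (fun p : ℝ × Ω => h (X p.1.toNNReal p.2))
      ((volume.restrict (Ioc 0 T)).prod P) :=
  Integrable.of_bound (hX.measurable_comp hm).aestronglyMeasurable B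
    (ae_of_all _ fun p => by simpa using hB _ (hX.state _ _))

theorem IsProcess.stronglyMeasurable_integral (hX : IsProcess P ℱ D L K μ X) {h : E → ℝ}
    (hm : Measurable h) : StronglyMeasurable fun s : ℝ => ∫ ω, h (X s.toNNReal ω) ∂P :=
  (hX.measurable_comp hm).stronglyMeasurable.integral_prod_right'

theorem abs_integral_le_of_bound {f : Ω → ℝ} {B : ℝ} (h : ∀ ω, |f ω| ≤ B) :
    |∫ ω, f ω ∂P| ≤ B := by
  have := norm_integral_le_of_norm_le_const (μ := P) (f := f) (C := B) (ae_of_all _ h)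
  simpa using this

/-- A Lyapunov function stays integrable. -/
theorem IsProcess.moment_bound (hX : IsProcess P ℱ D L K μ X) {V : E → ℝ} {W : ℕ → E → ℝ}
    {a : ℕ → ℝ} {A C : ℝ} (hV : IsLyapunov D L K V W a A C)
    (h0 : Integrable (fun ω => V (X 0 ω)) P) (t : ℝ≥0) :
    Integrable (fun ω => V (X t ω)) P ∧
      ∫ ω, V (X t ω) ∂P ≤ A * (∫ ω, V (X 0 ω) ∂P) * Real.exp (C * t) := by
  set R := A * (∫ ω, V (X 0 ω) ∂P) * Real.exp (C * t) with hR
  have hint : ∀ n s, Integrable (fun ω => W n (X s ω)) P := fun n s => by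
    obtain ⟨B, hB⟩ := hV.bounded n
    exact integrable_of_bound (hV.meas n) hB (hX.measurable s) (hX.state s)
  have hn : ∀ n, ∫ ω, W n (X t ω) ∂P ≤ R := by
    intro n
    obtain ⟨B, hB⟩ := hV.gen_bounded n
    -- Subtracting the constant `a n` makes `W n` a test function; it cancels in Dynkin's formula,
    -- and the drift inequality then closes on the mean of `W n` itself.
    have hstep := le_exp_of_le_integral (u := fun s => ∫ ω, W n (X s.toNNReal ω) ∂P)
      (h := fun s => ∫ ω, L (fun e => W n e - a n) (X s.toNNReal ω) ∂P)
      (u₀ := ∫ ω, W n (X 0 ω) ∂P) hV.pos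
      (fun s => by
        rw [intervalIntegrable_iff]
        refine Measure.integrableOn_of_bounded (M := B) (by simp)
          (hX.stronglyMeasurable_integral (hV.gen_meas n)).aestronglyMeasurable ?_
        exact ae_of_all _ fun r => abs_integral_le_of_bound fun ω => hB _ (hX.state _ _))
      (fun s hs => by
        have := hX.integral_eq (hV.mem n) (fun r => (hint n r).sub (integrable_const _)) s.toNNReal
          (hX.integrable_prod_of_bound (hV.gen_meas n) hB _)
        rw [integral_sub (hint n _) (integrable_const _),
          integral_sub (hint n _) (integrable_const _), Real.coe_toNNReal s hs] at this
        linarith)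
      (fun s hs => by
        rw [← integral_const_mul]
        exact integral_mono (integrable_of_bound (hV.gen_meas n) hB (hX.measurable _) (hX.state _))
          ((hint n _).const_mul C) fun ω => hV.gen_le n _ (hX.state _ _))
      (T := t) t.2
    simp only [Real.toNNReal_coe] at hstep
    refine hstep.trans (mul_le_mul_of_nonneg_right ?_ (Real.exp_pos _).le)
    rw [← integral_const_mul]
    exact integral_mono (hint n 0) (h0.const_mul A) fun ω => hV.le n _ (hX.state _ _)
  have hlim : ∀ ω, Tendsto (fun n => W n (X t ω)) atTop (𝓝 (V (X t ω))) :=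
    fun ω => hV.lim _ (hX.state _ _)
  have hVm : Measurable fun ω => V (X t ω) :=
    measurable_of_tendsto_metrizable (fun n => (hV.meas n).comp (hX.measurable t))
      (tendsto_pi_nhds.2 hlim)
  have hV0 : ∀ ω, 0 ≤ V (X t ω) := fun ω =>
    ge_of_tendsto' (hlim ω) fun n => hV.nonneg n _ (hX.state _ _)
  have hR0 : 0 ≤ R := (integral_nonneg fun ω => hV.nonneg 0 _ (hX.state t ω)).trans (hn 0)
  -- Fatou's lemma transfers the bound, which is uniform in n, from the truncations to V.
  have hl : ∫⁻ ω, ENNReal.ofReal (V (X t ω)) ∂P ≤ ENNReal.ofReal R := by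
    have h1 : ∀ ω, ENNReal.ofReal (V (X t ω))
        = liminf (fun n => ENNReal.ofReal (W n (X t ω))) atTop := fun ω =>
      (((ENNReal.continuous_ofReal.tendsto _).comp (hlim ω)).liminf_eq).symm
    simp only [h1]
    refine (lintegral_liminf_le (f := fun n ω => ENNReal.ofReal (W n (X t ω))) fun n =>
      ((hV.meas n).comp (hX.measurable t)).ennreal_ofReal).trans ?_
    refine (liminf_le_liminf (v := fun _ => ENNReal.ofReal R)
      (Eventually.of_forall fun n => ?_)).trans (by simp)
    rw [← ofReal_integral_eq_lintegral_ofReal (hint n t)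
      (ae_of_all _ fun ω => hV.nonneg n _ (hX.state t ω))]
    exact ENNReal.ofReal_le_ofReal (hn n)
  have hi : Integrable (fun ω => V (X t ω)) P := by
    refine ⟨hVm.aestronglyMeasurable, ?_⟩
    rw [hasFiniteIntegral_iff_ofReal (ae_of_all _ hV0)]
    exact hl.trans_lt ENNReal.ofReal_lt_top
  refine ⟨hi, ?_⟩
  rw [← ofReal_integral_eq_lintegral_ofReal hi (ae_of_all _ hV0)] at hl
  exact (ENNReal.ofReal_le_ofReal_iff hR0).1 hl

/-- `f` is a limit of test functions whose images under `L` converge to `g`, all of them dominated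
by `V`. -/
def IsApproximable (D : Set (E → ℝ)) (L : (E → ℝ) → E → ℝ) (K : Set E) (V f g : E → ℝ) : Prop :=
  ∃ (F : ℕ → E → ℝ) (B : ℝ), 0 < B ∧ (∀ n, F n ∈ D ∧ Measurable (F n) ∧ Measurable (L (F n))) ∧
    (∀ n, ∀ e ∈ K, |F n e| ≤ B * V e ∧ |L (F n) e| ≤ B * V e) ∧
    ∀ e ∈ K, Tendsto (fun n => F n e) atTop (𝓝 (f e)) ∧
      Tendsto (fun n => L (F n) e) atTop (𝓝 (g e))

/-- Dynkin's formula for approximable functions. -/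
theorem IsProcess.dynkin (hX : IsProcess P ℱ D L K μ X) {V f g : E → ℝ} (hVm : Measurable V)
    (hV : ∀ t, Integrable (fun ω => V (X t ω)) P)
    (hVb : ∀ T : ℝ≥0, ∃ M, ∀ t ≤ T, ∫ ω, V (X t ω) ∂P ≤ M)
    (hfg : IsApproximable D L K V f g) :
    (∀ t, Integrable (fun ω => f (X t ω)) P) ∧ (∀ t, Integrable (fun ω => g (X t ω)) P) ∧
    (∀ t : ℝ≥0, ∫ ω, f (X t ω) ∂P = ∫ ω, f (X 0 ω) ∂P
      + ∫ s in (0 : ℝ)..t, ∫ ω, g (X s.toNNReal ω) ∂P) ∧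
    Continuous fun t => ∫ ω, f (X t ω) ∂P := by
  obtain ⟨F, B, hB, hF, hFB, hlim⟩ := hfg
  have hBV : ∀ t, Integrable (fun ω => B * V (X t ω)) P := fun t => (hV t).const_mul B
  have hFi : ∀ n t, Integrable (fun ω => F n (X t ω)) P := fun n t =>
    (hBV t).mono' ((hF n).2.1.comp (hX.measurable t)).aestronglyMeasurable
      (ae_of_all _ fun ω => (hFB n _ (hX.state _ _)).1)
  have hmf : ∀ t, AEStronglyMeasurable (fun ω => f (X t ω)) P := fun t =>
    (measurable_of_tendsto_metrizable (fun n => (hF n).2.1.comp (hX.measurable t))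
      (tendsto_pi_nhds.2 fun ω => (hlim _ (hX.state t ω)).1)).aestronglyMeasurable
  have hmg : ∀ t, AEStronglyMeasurable (fun ω => g (X t ω)) P := fun t =>
    (measurable_of_tendsto_metrizable (fun n => (hF n).2.2.comp (hX.measurable t))
      (tendsto_pi_nhds.2 fun ω => (hlim _ (hX.state t ω)).2)).aestronglyMeasurable
  have hgB : ∀ t ω, |g (X t ω)| ≤ B * V (X t ω) := fun t ω =>
    le_of_tendsto' ((hlim _ (hX.state t ω)).2.abs) fun n => (hFB n _ (hX.state _ _)).2
  have hlimG : ∀ s, Tendsto (fun n => ∫ ω, L (F n) (X s ω) ∂P) atTop (𝓝 (∫ ω, g (X s ω) ∂P)) :=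
    fun s => tendsto_integral_of_dominated_convergence _
      (fun n => ((hF n).2.2.comp (hX.measurable s)).aestronglyMeasurable) (hBV s)
      (fun n => ae_of_all _ fun ω => (hFB n _ (hX.state _ _)).2)
      (ae_of_all _ fun ω => (hlim _ (hX.state _ _)).2)
  -- Continuity follows from the formula itself, because the time integrand is measurable and
  -- locally bounded.
  suffices hdyn : ∀ t : ℝ≥0, ∫ ω, f (X t ω) ∂P = ∫ ω, f (X 0 ω) ∂P
      + ∫ s in (0 : ℝ)..t, ∫ ω, g (X s.toNNReal ω) ∂P by
    refine ⟨fun t => (hBV t).mono' (hmf t) (ae_of_all _ fun ω => ?_),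
      fun t => (hBV t).mono' (hmg t) (ae_of_all _ (hgB t)), hdyn, ?_⟩
    · exact le_of_tendsto' ((hlim _ (hX.state t ω)).1.abs) fun n => (hFB n _ (hX.state _ _)).1
    have hm : StronglyMeasurable fun s : ℝ => ∫ ω, g (X s.toNNReal ω) ∂P :=
      stronglyMeasurable_of_tendsto atTop
        (fun n => hX.stronglyMeasurable_integral (hF n).2.2) (tendsto_pi_nhds.2 fun s => hlimG _)
    have hint : ∀ T : ℝ, IntervalIntegrable (fun s : ℝ => ∫ ω, g (X s.toNNReal ω) ∂P)
        volume 0 T := by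
      intro T
      obtain ⟨M, hM⟩ := hVb T.toNNReal
      rw [intervalIntegrable_iff]
      refine Measure.integrableOn_of_bounded (M := B * M) (by simp) hm.aestronglyMeasurable ?_
      refine (ae_restrict_iff' measurableSet_uIoc).2 (ae_of_all _ fun s hs => ?_)
      have hsT : s.toNNReal ≤ T.toNNReal := by
        rcases le_total 0 T with hT | hT
        · rw [uIoc_of_le hT] at hs
          exact Real.toNNReal_le_toNNReal hs.2
        · rw [uIoc_of_ge hT] at hs
          simp [Real.toNNReal_of_nonpos hs.2]
      refine (abs_integral_le_integral_abs).trans ?_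
      refine (integral_mono_of_nonneg (ae_of_all _ fun _ => abs_nonneg _) (hBV _)
        (ae_of_all _ (hgB _))).trans ?_
      rw [integral_const_mul]
      exact mul_le_mul_of_nonneg_left (hM _ hsT) hB.le
    have hc := (intervalIntegral.continuous_primitive
      (fun a b => (hint a).symm.trans (hint b)) 0).comp NNReal.continuous_coe
    exact (continuous_const.add hc).congr fun t => (hdyn t).symm
  intro t
  obtain ⟨M, hM⟩ := hVb t
  have hGB : ∀ n s, s ≤ t → |∫ ω, L (F n) (X s ω) ∂P| ≤ B * M := by
    intro n s hs
    refine (abs_integral_le_integral_abs).trans ?_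
    refine (integral_mono_of_nonneg (ae_of_all _ fun _ => abs_nonneg _) (hBV s)
      (ae_of_all _ fun ω => (hFB n _ (hX.state _ _)).2)).trans ?_
    rw [integral_const_mul]
    exact mul_le_mul_of_nonneg_left (hM s hs) hB.le
  have hlimF : ∀ s, Tendsto (fun n => ∫ ω, F n (X s ω) ∂P) atTop (𝓝 (∫ ω, f (X s ω) ∂P)) :=
    fun s => tendsto_integral_of_dominated_convergence _ (fun n => (hFi n s).1) (hBV s)
      (fun n => ae_of_all _ fun ω => (hFB n _ (hX.state _ _)).1)
      (ae_of_all _ fun ω => (hlim _ (hX.state _ _)).1)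
  have hle : ∀ s ∈ Ioc (0 : ℝ) t, s.toNNReal ≤ t := fun s hs =>
    Real.toNNReal_le_iff_le_coe.2 hs.2
  have hint : Tendsto (fun n => ∫ s in (0 : ℝ)..t, ∫ ω, L (F n) (X s.toNNReal ω) ∂P) atTop
      (𝓝 (∫ s in (0 : ℝ)..t, ∫ ω, g (X s.toNNReal ω) ∂P)) := by
    refine intervalIntegral.tendsto_integral_filter_of_dominated_convergence (fun _ => B * M)
      (Eventually.of_forall fun n =>
        (hX.stronglyMeasurable_integral (hF n).2.2).aestronglyMeasurable)
      (Eventually.of_forall fun n => ae_of_all _ fun s hs => ?_) (by simp)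
      (ae_of_all _ fun s _ => hlimG _)
    rw [uIoc_of_le t.coe_nonneg] at hs
    exact hGB n _ (hle s hs)
  -- The dominating function is integrable on time × probability space, which is what Fubini needs
  -- for each approximant.
  have hVprod : Integrable (fun p : ℝ × Ω => B * V (X p.1.toNNReal p.2))
      ((volume.restrict (Ioc 0 (t : ℝ))).prod P) := by
    refine Integrable.const_mul ?_ B
    rw [integrable_prod_iff (hX.measurable_comp hVm).aestronglyMeasurable]
    refine ⟨ae_of_all _ fun s => hV s.toNNReal, ?_⟩
    have hnn : ∀ s ω, 0 ≤ V (X s ω) := fun s ω =>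
      nonneg_of_mul_nonneg_right ((abs_nonneg _).trans (hFB 0 _ (hX.state s ω)).1) hB
    refine Measure.integrableOn_of_bounded (M := M) (by simp)
      (hX.measurable_comp hVm.norm).stronglyMeasurable.integral_prod_right'.aestronglyMeasurable ?_
    refine (ae_restrict_iff' measurableSet_Ioc).2 (ae_of_all _ fun s hs => ?_)
    simp only [Real.norm_of_nonneg (hnn _ _)]
    rw [Real.norm_of_nonneg (integral_nonneg (hnn _))]
    exact hM _ (hle s hs)
  refine tendsto_nhds_unique (hlimF t) (((hlimF 0).add hint).congr fun n => ?_)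
  refine (hX.integral_eq (hF n).1 (hFi n) t (hVprod.mono'
    (hX.measurable_comp (hF n).2.2).aestronglyMeasurable
    (ae_of_all _ fun p => (hFB n _ (hX.state _ _)).2))).symm

end MartingaleProblem

/-! ### Affine functionals of a configuration -/

/-- The functional `ξ ↦ const + ∑ₓ coef x ξ x`; its coefficients vanish at `0` and `N`. -/
structure Aff (N : ℕ) where
  const : ℝ
  coef : ℕ → ℝ
  left : coef 0 = 0
  right : coef N = 0

namespace Aff

variable {N : ℕ}

def eval (u : Aff N) (ξ : Site N → ℝ) : ℝ := u.const + ∑ x : Site N, u.coef x.1 * ξ x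

/-- Increment of the coefficients across the bond `{x, x + 1}`. -/
def grad (u : Aff N) (x : ℕ) : ℝ := u.coef (x + 1) - u.coef x

def one (N : ℕ) : Aff N := ⟨1, fun _ => 0, rfl, rfl⟩

@[simp] theorem one_eval (ξ : Site N → ℝ) : (one N).eval ξ = 1 := by simp [one, eval]

@[simp] theorem one_grad (x : ℕ) : (one N).grad x = 0 := by simp [one, grad]

/-- The value at `x`, with the prescribed values `a` at `0` and `b` at `N`. -/
def prof (N : ℕ) (a b : ℝ) (x : ℕ) : Aff N where
  const := if x = 0 then a else if x = N then b else 0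
  coef y := if 0 < x ∧ x < N ∧ y = x then 1 else 0
  left := by split_ifs with h <;> first | rfl | omega
  right := by split_ifs with h <;> first | rfl | omega

theorem prof_eval (a b : ℝ) (x : ℕ) (ξ : Site N → ℝ) :
    (prof N a b x).eval ξ = if x = 0 then a else if x = N then b else val ξ x := by
  rcases Nat.eq_zero_or_pos x with rfl | h0
  · simp [prof, eval]
  by_cases hN : x = N
  · subst hN
    simp [prof, eval, h0.ne']
  simp only [prof, eval, h0.ne', hN, if_false, zero_add, h0, true_and, val, Finset.mem_Ioo]
  by_cases h : x < N
  · simp only [h, true_and, dif_pos, ite_mul, one_mul, zero_mul]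
    rw [Finset.sum_eq_single (⟨x, by simp [h, h0]⟩ : Site N)]
    · simp
    · intro y _ hy
      rw [if_neg]
      rintro rfl
      exact hy rfl
    · simp
  · simp [h]

/-- The gradient of the value at k+1 is +1 on the bond on its left and -1 on the bond on its right.
The test site k+1 thus sees current in minus current out. -/
theorem sum_prof_grad (a b : ℝ) {k : ℕ} (hk : k + 1 < N) (h : ℕ → ℝ) :
    ∑ x ∈ Finset.range N, (prof N a b (k + 1)).grad x * h x = h k - h (k + 1) := by
  simp only [grad, prof, sub_mul, Finset.sum_sub_distrib, hk, true_and, Nat.succ_pos,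
    add_left_inj, ite_mul, one_mul, zero_mul, Finset.sum_ite_eq', Finset.mem_range]
  simp [show k < N by omega]

theorem prof_grad (a b : ℝ) {k : ℕ} (hk : k + 1 < N) (x : ℕ) :
    (prof N a b (k + 1)).grad x = (if x = k then 1 else 0) - if x = k + 1 then 1 else 0 := by
  simp [grad, prof, hk]

end Aff

/-! ### Quadratic functionals and generators that act on them. -/

/-- Quadratic functionals of a configuration. -/
def quadSpan (N : ℕ) : Submodule ℝ ((Site N → ℝ) → ℝ) :=
  Submodule.span ℝ {f | ∃ u v : Aff N, f = fun ξ => u.eval ξ * v.eval ξ}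

theorem mul_mem_quadSpan {N : ℕ} (u v : Aff N) : (fun ξ => u.eval ξ * v.eval ξ) ∈ quadSpan N :=
  Submodule.subset_span ⟨u, v, rfl⟩

/-- The image of `u v` under a generator with current `J x` and mobility `Q x` on the bond
`{x, x + 1}`. -/
def quadGen {N : ℕ} (J Q : ℕ → (Site N → ℝ) → ℝ) (u v : Aff N) (ξ : Site N → ℝ) : ℝ :=
  ∑ x ∈ Finset.range N, ((u.eval ξ * v.grad x + v.eval ξ * u.grad x) * J x ξ
    + u.grad x * v.grad x * Q x ξ)

/-- Conductance of the bond `{x, x + 1}`: `l` and `r` at the two boundary bonds, `1` in the bulk. -/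
def bondWeight (N : ℕ) (l r : ℝ) (x : ℕ) : ℝ := if x = 0 then l else if x + 1 = N then r else 1

/-- Fick's law with reservoir densities `a`, `b`. -/
def fick (N : ℕ) (c l r a b : ℝ) (x : ℕ) (ξ : Site N → ℝ) : ℝ :=
  c * bondWeight N l r x * ((Aff.prof N a b x).eval ξ - (Aff.prof N a b (x + 1)).eval ξ)

/-- A Markov generator that acts on the quadratic functionals of a configuration by `quadGen`, with
a Lyapunov function `V` of quadratic growth. -/
structure IsQuadraticModel {E : Type} [MeasurableSpace E] {N : ℕ} (D : Set (E → ℝ))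
    (L : (E → ℝ) → E → ℝ) (K : Set E) (ι : E → Site N → ℝ) (V : E → ℝ)
    (J Q : ℕ → (Site N → ℝ) → ℝ) : Prop where
  lyapunov : ∃ W a A C, IsLyapunov D L K V W a A C
  approx : ∀ u v : Aff N, IsApproximable D L K V (fun e => u.eval (ι e) * v.eval (ι e))
    (fun e => quadGen J Q u v (ι e))
  meas_V : Measurable V
  meas_ι : Measurable ι
  sq_le : ∀ e ∈ K, ∀ x, ι e x ^ 2 ≤ V e
  le_sq : ∃ C, ∀ e ∈ K, V e ≤ C * (1 + ∑ x, ι e x ^ 2)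
  nonneg : ∀ e ∈ K, 0 ≤ V e

section Moments

variable {Ω : Type*} {E : Type} [mΩ : MeasurableSpace Ω] [TopologicalSpace E]
  [MeasurableSpace E] [BorelSpace E] [TopologicalSpace.PseudoMetrizableSpace E]
  {P : Measure Ω} {ℱ : Filtration ℝ≥0 mΩ} {D : Set (E → ℝ)}
  {L : (E → ℝ) → E → ℝ} {K : Set E} {μ : Measure E} {X : ℝ≥0 → Ω → E} [IsProbabilityMeasure P]
  {N : ℕ} {ι : E → Site N → ℝ} {V : E → ℝ} {J Q : ℕ → (Site N → ℝ) → ℝ}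

theorem IsQuadraticModel.integrable_V (hM : IsQuadraticModel D L K ι V J Q)
    (hX : IsProcess P ℱ D L K μ X) (hμ : ∀ x, MemLp (fun e => ι e x) 2 μ) :
    (∀ t, Integrable (fun ω => V (X t ω)) P) ∧
      ∀ T : ℝ≥0, ∃ M, ∀ t ≤ T, ∫ ω, V (X t ω) ∂P ≤ M := by
  have h0 : Integrable (fun ω => V (X 0 ω)) P := by
    obtain ⟨C, hC⟩ := hM.le_sq
    have h1 : Integrable (fun e => C * (1 + ∑ x, ι e x ^ 2)) (P.map (X 0)) := by
      rw [hX.initial]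
      have : IsProbabilityMeasure μ := hX.initial ▸
        Measure.isProbabilityMeasure_map (hX.measurable 0).aemeasurable
      exact ((integrable_const _).add (integrable_finsetSum _ fun x _ =>
        (hμ x).integrable_sq)).const_mul C
    refine (h1.comp_measurable (hX.measurable 0)).mono'
      (hM.meas_V.comp (hX.measurable 0)).aestronglyMeasurable (ae_of_all _ fun ω => ?_)
    rw [Real.norm_of_nonneg (hM.nonneg _ (hX.state _ _))]
    exact hC _ (hX.state _ _)
  obtain ⟨W, a, A, C, hW⟩ := hM.lyapunov
  refine ⟨fun t => (hX.moment_bound hW h0 t).1, fun T =>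
    ⟨|A * (∫ ω, V (X 0 ω) ∂P)| * Real.exp (C * T), fun t ht => ?_⟩⟩
  refine (hX.moment_bound hW h0 t).2.trans ?_
  have hC := hW.pos
  have : (t : ℝ) ≤ T := ht
  gcongr
  exact le_abs_self _

theorem IsQuadraticModel.memLp (hM : IsQuadraticModel D L K ι V J Q)
    (hX : IsProcess P ℱ D L K μ X) (hμ : ∀ x, MemLp (fun e => ι e x) 2 μ) (t : ℝ≥0)
    (x : Site N) : MemLp (fun ω => ι (X t ω) x) 2 P := by
  have hm : Measurable fun ω => ι (X t ω) x :=
    (measurable_pi_apply x).comp (hM.meas_ι.comp (hX.measurable t))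
  rw [memLp_two_iff_integrable_sq hm.aestronglyMeasurable]
  refine ((hM.integrable_V hX hμ).1 t).mono' (hm.pow_const 2).aestronglyMeasurable
    (ae_of_all _ fun ω => ?_)
  rw [Real.norm_of_nonneg (sq_nonneg _)]
  exact hM.sq_le _ (hX.state _ _) x

/-- Continuity in time of quadratic moments upgrades the integrated Dynkin formula to a derivative
at every time, once the generator is known to preserve quadratic functionals. -/
theorem IsQuadraticModel.integrable_and_continuous (hM : IsQuadraticModel D L K ι V J Q)
    (hX : IsProcess P ℱ D L K μ X) (hμ : ∀ x, MemLp (fun e => ι e x) 2 μ)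
    {f : (Site N → ℝ) → ℝ} (hf : f ∈ quadSpan N) :
    (∀ t, Integrable (fun ω => f (ι (X t ω))) P) ∧
      Continuous fun t => ∫ ω, f (ι (X t ω)) ∂P := by
  obtain ⟨h1, h2⟩ := hM.integrable_V hX hμ
  induction hf using Submodule.span_induction with
  | mem f hf =>
    obtain ⟨u, v, rfl⟩ := hf
    have := hX.dynkin hM.meas_V h1 h2 (hM.approx u v)
    exact ⟨this.1, this.2.2.2⟩
  | zero => simpa using continuous_const
  | add f g _ _ hf hg =>
    refine ⟨fun t => (hf.1 t).add (hg.1 t), ?_⟩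
    simp only [Pi.add_apply]
    simp_rw [fun t => integral_add (hf.1 t) (hg.1 t)]
    exact hf.2.add hg.2
  | smul c f _ hf =>
    refine ⟨fun t => (hf.1 t).const_mul c, ?_⟩
    simp only [Pi.smul_apply, smul_eq_mul, integral_const_mul]
    exact hf.2.const_mul c

theorem accel_coe {t : ℝ} (ht : 0 ≤ t) : (accel N t : ℝ) = t * (N : ℝ) ^ 2 :=
  Real.coe_toNNReal _ (by positivity)

theorem continuous_accel : Continuous (accel N) :=
  continuous_real_toNNReal.comp (continuous_id.mul continuous_const)

/-- Evolution of quadratic moments. -/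
theorem IsQuadraticModel.hasDerivWithinAt (hM : IsQuadraticModel D L K ι V J Q)
    (hX : IsProcess P ℱ D L K μ X) (hμ : ∀ x, MemLp (fun e => ι e x) 2 μ) (u v : Aff N)
    (hG : quadGen J Q u v ∈ quadSpan N) {t : ℝ} (ht : 0 ≤ t) :
    HasDerivWithinAt
      (fun s => ∫ ω, u.eval (ι (X (accel N s) ω)) * v.eval (ι (X (accel N s) ω)) ∂P)
      ((N : ℝ) ^ 2 * ∫ ω, quadGen J Q u v (ι (X (accel N t) ω)) ∂P) (Ici 0) t := by
  obtain ⟨h1, h2⟩ := hM.integrable_V hX hμ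
  have hd := (hX.dynkin hM.meas_V h1 h2 (hM.approx u v)).2.2.1
  have hc : Continuous fun s : ℝ => ∫ ω, quadGen J Q u v (ι (X s.toNNReal ω)) ∂P :=
    (hM.integrable_and_continuous hX hμ hG).2.comp continuous_real_toNNReal
  have hF := intervalIntegral.integral_hasDerivAt_right (a := 0) (b := t * (N : ℝ) ^ 2)
    (hc.intervalIntegrable _ _) (hc.stronglyMeasurableAtFilter _ _) hc.continuousAt
  have hs : HasDerivAt (fun s : ℝ => s * (N : ℝ) ^ 2) ((N : ℝ) ^ 2) t := by
    simpa using (hasDerivAt_id t).mul_const ((N : ℝ) ^ 2)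
  have h3 := ((hF.comp t hs).const_add
    (∫ ω, u.eval (ι (X 0 ω)) * v.eval (ι (X 0 ω)) ∂P)).hasDerivWithinAt (s := Ici 0)
  rw [mul_comm] at h3
  -- The two functions agree only for s ≥ 0, since `accel` sends negative times to 0; hence the
  -- one-sided derivative at time 0.
  refine h3.congr (fun s hs => ?_) ?_
  · rw [hd (accel N s), accel_coe hs]; rfl
  · rw [hd (accel N t), accel_coe ht]; rfl

end Moments

/-! ### Evolution of the correlation function -/

/-- `f` is integrable with mean `c`. -/
structure HasMean {Ω : Type*} [MeasurableSpace Ω] (P : Measure Ω) (f : Ω → ℝ) (c : ℝ) : Prop where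
  integrable : Integrable f P
  eq : ∫ ω, f ω ∂P = c

namespace HasMean

variable {Ω : Type*} [MeasurableSpace Ω] {P : Measure Ω} {f g : Ω → ℝ} {c d : ℝ}

theorem of_integrable (hf : Integrable f P) : HasMean P f (∫ ω, f ω ∂P) := ⟨hf, rfl⟩

theorem add (hf : HasMean P f c) (hg : HasMean P g d) : HasMean P (fun ω => f ω + g ω) (c + d) :=
  ⟨hf.1.add hg.1, by rw [integral_add hf.1 hg.1, hf.2, hg.2]⟩

theorem sub (hf : HasMean P f c) (hg : HasMean P g d) : HasMean P (fun ω => f ω - g ω) (c - d) :=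
  ⟨hf.1.sub hg.1, by rw [integral_sub hf.1 hg.1, hf.2, hg.2]⟩

theorem const_mul (a : ℝ) (hf : HasMean P f c) : HasMean P (fun ω => a * f ω) (a * c) :=
  ⟨hf.1.const_mul a, by rw [integral_const_mul, hf.2]⟩

theorem const [IsProbabilityMeasure P] (a : ℝ) : HasMean P (fun _ => a) a :=
  ⟨integrable_const a, by simp⟩

end HasMean

/-! ### Action of the generator on occupation variables and their products. -/

section QuadGen

variable {N : ℕ} {J Q : ℕ → (Site N → ℝ) → ℝ}

/-- Discrete continuity equation: a constant has no gradient, so the mobility drops out. -/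
theorem quadGen_prof_one (a b : ℝ) {k : ℕ} (hk : k + 1 < N) (ξ : Site N → ℝ) :
    quadGen J Q (Aff.prof N a b (k + 1)) (Aff.one N) ξ = J k ξ - J (k + 1) ξ := by
  rw [← Aff.sum_prof_grad a b hk fun x => J x ξ]
  simp [quadGen]

/-- The mobility of a bond counts with the product of the two gradients on it: +1 on both adjacent
bonds when the sites coincide, -1 on the common bond when they are neighbours, and 0 otherwise. -/
theorem quadGen_prof_prof (a b : ℝ) {k j : ℕ} (hkj : k ≤ j) (hj : j + 1 < N) (ξ : Site N → ℝ) :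
    quadGen J Q (Aff.prof N a b (k + 1)) (Aff.prof N a b (j + 1)) ξ
      = (Aff.prof N a b (k + 1)).eval ξ * (J j ξ - J (j + 1) ξ)
        + (Aff.prof N a b (j + 1)).eval ξ * (J k ξ - J (k + 1) ξ)
        + (if j = k then Q k ξ + Q (k + 1) ξ else if j = k + 1 then -Q j ξ else 0) := by
  have hk : k + 1 < N := by omega
  rw [← Aff.sum_prof_grad a b hk fun x => J x ξ, ← Aff.sum_prof_grad a b hj fun x => J x ξ]
  have h3 : (if j = k then Q k ξ + Q (k + 1) ξ else if j = k + 1 then -Q j ξ else 0)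
      = ∑ x ∈ Finset.range N, (Aff.prof N a b (k + 1)).grad x *
        ((Aff.prof N a b (j + 1)).grad x * Q x ξ) := by
    rw [Aff.sum_prof_grad a b hk, Aff.prof_grad a b hj, Aff.prof_grad a b hj]
    rcases hkj.eq_or_lt with rfl | hlt
    · simp
    · rcases (Nat.succ_le_iff.2 hlt).eq_or_lt with rfl | hlt2
      · simp [show k ≠ k + 1 + 1 by omega]
      · have h1 : j ≠ k := by omega
        have h2 : j ≠ k + 1 := by omega
        have h3 : k ≠ j := by omega
        have h4 : k ≠ j + 1 := by omega
        have h5 : k + 1 ≠ j := by omega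
        simp [h1, h2, h3, h4, h5]
  rw [h3, Finset.mul_sum, Finset.mul_sum, ← Finset.sum_add_distrib, ← Finset.sum_add_distrib]
  refine Finset.sum_congr rfl fun x _ => ?_
  ring

/-- Closure of the moment hierarchy: the current is affine, so an affine functional times the
current is quadratic, and the mobility is quadratic by assumption. -/
theorem quadGen_mem_quadSpan {c l r a b : ℝ} (hQ : ∀ x < N, Q x ∈ quadSpan N) (u v : Aff N) :
    quadGen (fick N c l r a b) Q u v ∈ quadSpan N := by
  have h : quadGen (fick N c l r a b) Q u v = ∑ x ∈ Finset.range N,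
      ((v.grad x * (c * bondWeight N l r x)) •
          ((fun ξ => u.eval ξ * (Aff.prof N a b x).eval ξ)
            - fun ξ => u.eval ξ * (Aff.prof N a b (x + 1)).eval ξ)
        + (u.grad x * (c * bondWeight N l r x)) •
          ((fun ξ => v.eval ξ * (Aff.prof N a b x).eval ξ)
            - fun ξ => v.eval ξ * (Aff.prof N a b (x + 1)).eval ξ)
        + (u.grad x * v.grad x) • Q x) := by
    ext ξ
    simp only [quadGen, fick, Finset.sum_apply, Pi.add_apply, Pi.smul_apply, Pi.sub_apply,
      smul_eq_mul]
    refine Finset.sum_congr rfl fun x _ => ?_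
    ring
  rw [h]
  refine Submodule.sum_mem _ fun x hx => ?_
  refine Submodule.add_mem _ (Submodule.add_mem _ ?_ ?_) ?_
  · exact Submodule.smul_mem _ _
      (Submodule.sub_mem _ (mul_mem_quadSpan _ _) (mul_mem_quadSpan _ _))
  · exact Submodule.smul_mem _ _
      (Submodule.sub_mem _ (mul_mem_quadSpan _ _) (mul_mem_quadSpan _ _))
  · exact Submodule.smul_mem _ _ (hQ x (Finset.mem_range.1 hx))

end QuadGen

/-- First and second moments `r`, `m` of the profile that evolve by Fick's law with conductances
`c w`, mobilities `q`, and a correlation function `φ` expressed through them; the diagonal of `φ` is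
`k₁ m + k₂ r - r² + k₃`. -/
structure IsMomentSystem (N : ℕ) (c : ℝ) (w : ℕ → ℝ) (k₁ k₂ k₃ : ℝ) (r : ℝ → ℕ → ℝ)
    (m : ℝ → ℕ → ℕ → ℝ) (q : ℝ → ℕ → ℝ) (φ : ℝ → ℕ × ℕ → ℝ) : Prop where
  first : ∀ k, k + 1 < N → ∀ t, 0 ≤ t → HasDerivWithinAt (fun s => r s (k + 1))
    ((N : ℝ) ^ 2 * (c * w k * (r t k - r t (k + 1))
      - c * w (k + 1) * (r t (k + 1) - r t (k + 2)))) (Ici 0) t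
  second : ∀ k j, k ≤ j → j + 1 < N → ∀ t, 0 ≤ t →
    HasDerivWithinAt (fun s => m s (k + 1) (j + 1))
      ((N : ℝ) ^ 2 * (c * w j * (m t (k + 1) j - m t (k + 1) (j + 1))
        - c * w (j + 1) * (m t (k + 1) (j + 1) - m t (k + 1) (j + 2))
        + (c * w k * (m t k (j + 1) - m t (k + 1) (j + 1))
        - c * w (k + 1) * (m t (k + 1) (j + 1) - m t (k + 2) (j + 1)))
        + if j = k then q t k + q t (k + 1) else if j = k + 1 then -q t j else 0)) (Ici 0) t
  cont : ∀ x, Continuous fun t => r t x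
  symm : ∀ t x y, m t x y = m t y x
  left : ∀ t, φ t (0, 0) = 0
  right : ∀ t, φ t (N, N) = 0
  off_diag : ∀ t x y, x < y → y ≤ N → φ t (x, y) = m t x y - r t x * r t y
  diag : ∀ t x, 0 < x → x < N → φ t (x, x) = k₁ * m t x x + k₂ * r t x - r t x ^ 2 + k₃

section Corr

variable {Ω : Type*} {E : Type} [mΩ : MeasurableSpace Ω] [TopologicalSpace E]
  [MeasurableSpace E] [BorelSpace E] [TopologicalSpace.PseudoMetrizableSpace E]
  {P : Measure Ω} {ℱ : Filtration ℝ≥0 mΩ} {D : Set (E → ℝ)}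
  {L : (E → ℝ) → E → ℝ} {K : Set E} {μ : Measure E} {X : ℝ≥0 → Ω → E} [IsProbabilityMeasure P]
  {N : ℕ} {ι : E → Site N → ℝ} {V : E → ℝ} {J Q : ℕ → (Site N → ℝ) → ℝ} {c l r a b : ℝ}

theorem val_eq_prof {x : ℕ} (hx : 0 < x) (hxN : x < N) (ξ : Site N → ℝ) :
    val ξ x = (Aff.prof N a b x).eval ξ := by
  rw [Aff.prof_eval, if_neg hx.ne', if_neg hxN.ne]

theorem IsQuadraticModel.hasMean (hM : IsQuadraticModel D L K ι V J Q)
    (hX : IsProcess P ℱ D L K μ X) (hμ : ∀ x, MemLp (fun e => ι e x) 2 μ)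
    {f : (Site N → ℝ) → ℝ} (hf : f ∈ quadSpan N) (t : ℝ≥0) :
    HasMean P (fun ω => f (ι (X t ω))) (∫ ω, f (ι (X t ω)) ∂P) :=
  .of_integrable ((hM.integrable_and_continuous hX hμ hf).1 t)

theorem IsQuadraticModel.hasMean_prof (hM : IsQuadraticModel D L K ι V J Q)
    (hX : IsProcess P ℱ D L K μ X) (hμ : ∀ x, MemLp (fun e => ι e x) 2 μ)
    {Y : ℝ≥0 → Ω → ℕ → ℝ} (hY : ∀ t ω x, Y t ω x = val (ι (X t ω)) x) (a b t : ℝ) (x : ℕ) :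
    HasMean P (fun ω => (Aff.prof N a b x).eval (ι (X (accel N t) ω)))
      (density P N Y a b t x) := by
  have h1 := (hM.hasMean hX hμ (mul_mem_quadSpan (.prof N a b x) (.one N)) (accel N t)).integrable
  simp only [Aff.one_eval, mul_one] at h1
  refine ⟨h1, ?_⟩
  simp only [density, Aff.prof_eval, hY]
  split_ifs <;> simp

/-- Passage from the process to a deterministic system. Encoding the reservoirs as constant profiles
at 0 and N makes the same formulas valid at the boundary bonds: the covariance with a constant is 0,
which agrees with the value prescribed for φ on the boundary. -/
theorem IsQuadraticModel.isMomentSystem (hN : 2 ≤ N)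
    (hM : IsQuadraticModel D L K ι V (fick N c l r a b) Q)
    (hX : IsProcess P ℱ D L K μ X) (hμ : ∀ x, MemLp (fun e => ι e x) 2 μ)
    (hQ : ∀ x < N, Q x ∈ quadSpan N) {Y : ℝ≥0 → Ω → ℕ → ℝ}
    (hY : ∀ t ω x, Y t ω x = val (ι (X t ω)) x) {F : ℝ → ℝ → ℝ} {k₁ k₂ k₃ : ℝ}
    (hF : ∀ u ρ, F u ρ = k₁ * u ^ 2 + k₂ * u - ρ ^ 2 + k₃) :
    IsMomentSystem N c (bondWeight N l r) k₁ k₂ k₃ (density P N Y a b)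
      (fun t x y => ∫ ω, (Aff.prof N a b x).eval (ι (X (accel N t) ω))
        * (Aff.prof N a b y).eval (ι (X (accel N t) ω)) ∂P)
      (fun t x => ∫ ω, Q x (ι (X (accel N t) ω)) ∂P) (corr P N Y F) := by
  set p := Aff.prof N a b with hp
  have hm : ∀ t x y, HasMean P (fun ω => (p x).eval (ι (X (accel N t) ω))
      * (p y).eval (ι (X (accel N t) ω))) (∫ ω, (p x).eval (ι (X (accel N t) ω))
        * (p y).eval (ι (X (accel N t) ω)) ∂P) := fun t x y =>
    hM.hasMean hX hμ (mul_mem_quadSpan (p x) (p y)) _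
  have hr : ∀ t x, HasMean P (fun ω => (p x).eval (ι (X (accel N t) ω)))
      (density P N Y a b t x) := fun t x => hM.hasMean_prof hX hμ hY a b t x
  have hq : ∀ t, ∀ x < N, HasMean P (fun ω => Q x (ι (X (accel N t) ω)))
      (∫ ω, Q x (ι (X (accel N t) ω)) ∂P) := fun t x hx => hM.hasMean hX hμ (hQ x hx) _
  have hYp : ∀ t ω x, 0 < x → x < N → Y t ω x = (p x).eval (ι (X t ω)) := fun t ω x h1 h2 => by
    rw [hY, val_eq_prof h1 h2]
  refine ⟨fun k hk t ht => ?_, fun k j hkj hj t ht => ?_, fun x => ?_, fun t x y => ?_, fun t => ?_,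
    fun t => ?_, fun t x y hxy hyN => ?_, fun t x hx hxN => ?_⟩
  · have h := hM.hasDerivWithinAt hX hμ (p (k + 1)) (.one N) (quadGen_mem_quadSpan hQ _ _) ht
    have hg : ∀ ξ, quadGen (fick N c l r a b) Q (p (k + 1)) (.one N) ξ = _ :=
      quadGen_prof_one a b hk
    simp only [Aff.one_eval, mul_one, (hr _ _).eq, hg] at h
    convert h using 2
    exact ((((hr t k).sub (hr t (k + 1))).const_mul (c * bondWeight N l r k)).sub
      (((hr t (k + 1)).sub (hr t (k + 2))).const_mul (c * bondWeight N l r (k + 1)))).eq.symm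
  -- The expectation of the generator is expanded linearly; both sides differ only by the
  -- arrangement of the products.
  · have h := hM.hasDerivWithinAt hX hμ (p (k + 1)) (p (j + 1)) (quadGen_mem_quadSpan hQ _ _) ht
    simp only [hp, quadGen_prof_prof a b hkj hj] at h
    convert h using 2
    have h1 : HasMean P (fun ω => if j = k then Q k (ι (X (accel N t) ω))
        + Q (k + 1) (ι (X (accel N t) ω)) else if j = k + 1 then -Q j (ι (X (accel N t) ω)) else 0)
        (if j = k then (∫ ω, Q k (ι (X (accel N t) ω)) ∂P) + ∫ ω, Q (k + 1) (ι (X (accel N t) ω)) ∂P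
          else if j = k + 1 then -∫ ω, Q j (ι (X (accel N t) ω)) ∂P else 0) := by
      split_ifs
      · exact (hq t k (by omega)).add (hq t (k + 1) (by omega))
      · simpa using (hq t j (by omega)).const_mul (-1)
      · exact .const 0
    refine (HasMean.eq ?_).symm
    convert! (((((hm t (k + 1) j).sub (hm t (k + 1) (j + 1))).const_mul
      (c * bondWeight N l r j)).sub
        (((hm t (k + 1) (j + 1)).sub (hm t (k + 1) (j + 2))).const_mul
          (c * bondWeight N l r (j + 1)))).add
      ((((hm t k (j + 1)).sub (hm t (k + 1) (j + 1))).const_mul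
      (c * bondWeight N l r k)).sub
        (((hm t (k + 1) (j + 1)).sub (hm t (k + 2) (j + 1))).const_mul
          (c * bondWeight N l r (k + 1))))).add h1 using 2 with ω
    simp only [fick]
    ring
  · have h1 := (hM.integrable_and_continuous hX hμ
      (mul_mem_quadSpan (p x) (.one N))).2.comp (continuous_accel (N := N))
    simp only [Aff.one_eval, mul_one, Function.comp_def, (hr _ x).eq] at h1
    exact h1
  · simp only [mul_comm]
  · simp [corr, triangle]
  · simp [corr, triangle]
  · unfold corr
    by_cases h0 : 0 < x
    · by_cases hy : y < N
      · have hT : (x, y) ∈ triangle N := ⟨h0, hxy.le, hy⟩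
        have e1 := fun ω => hYp (accel N t) ω x h0 (hxy.trans hy)
        have e2 := fun ω => hYp (accel N t) ω y (h0.trans hxy) hy
        simp only [if_pos hT, if_neg hxy.ne, e1, e2, (hr t x).eq, (hr t y).eq]
        -- Expansion of the centred product into moments, term by term so that integrability is
        -- carried along.
        have := ((((hm t x y).sub ((hr t y).const_mul (density P N Y a b t x))).sub
          ((hr t x).const_mul (density P N Y a b t y))).add
            (.const (density P N Y a b t x * density P N Y a b t y))).eq
        convert! this using 1
        · congr 1 with ω
          ring
        · ring
      · obtain rfl : y = N := by omega
        have : (x, y) ∉ triangle y := fun h => lt_irrefl _ h.2.2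
        rw [if_neg this]
        have h1 : ∀ ω, (p y).eval (ι (X (accel y t) ω)) = b := fun ω => by
          rw [hp, Aff.prof_eval, if_neg (by omega), if_pos rfl]
        have h2 : density P y Y a b t y = b := by
          rw [density, if_neg (by omega), if_pos rfl]
        simp only [h1, h2, integral_mul_const, (hr t x).eq, sub_self]
    · obtain rfl : x = 0 := by omega
      have : (0, y) ∉ triangle N := fun h => lt_irrefl _ h.1
      rw [if_neg this]
      have h1 : ∀ ω, (p 0).eval (ι (X (accel N t) ω)) = a := fun ω => by
        rw [hp, Aff.prof_eval, if_pos rfl]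
      have h2 : density P N Y a b t 0 = a := by rw [density, if_pos rfl]
      simp only [h1, h2, integral_const_mul, (hr t y).eq, sub_self]
  · unfold corr
    have hT : (x, x) ∈ triangle N := ⟨hx, le_rfl, hxN⟩
    have e1 := fun ω => hYp (accel N t) ω x hx hxN
    simp only [if_pos hT, if_true, e1, (hr t x).eq, hF]
    have := (((((hm t x x).const_mul k₁).add ((hr t x).const_mul k₂)).sub
      (.const (density P N Y a b t x ^ 2))).add (.const k₃)).eq
    convert! this using 3 with ω
    rw [sq]

end Corr

/-! ### Random walks on the triangle and closed equations -/

/-- Four targets suffice for both walks, but they may coincide (on the diagonal two of them do for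
`lap2D`), so the rate to a point is the sum over all indices that lead to it. -/
theorem isAbsorbedWalkGenerator_of_neighbours {N : ℕ} {A : (ℕ × ℕ → ℝ) → ℕ × ℕ → ℝ}
    (n : Fin 4 → ℕ × ℕ → ℕ × ℕ) (w : Fin 4 → ℕ × ℕ → ℝ)
    (hw : ∀ p ∈ triangle N, ∀ i, 0 ≤ w i p)
    (hn : ∀ p ∈ triangle N, ∀ i, n i p ∈ closedTriangle N ∧
      |((n i p).1 : ℤ) - p.1| ≤ 1 ∧ |((n i p).2 : ℤ) - p.2| ≤ 1)
    (hA : ∀ f, ∀ p ∈ triangle N, A f p = ∑ i, w i p * (f (n i p) - f p))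
    (hA0 : ∀ f, ∀ p ∉ triangle N, A f p = 0) : IsAbsorbedWalkGenerator N A := by
  classical
  refine ⟨fun p p' => if p ∈ triangle N then ∑ i, if n i p = p' then w i p else 0 else 0,
    fun p p' => ?_, fun p hp p' => ?_, fun p p' h => ?_, fun f p _ => ?_⟩
  · dsimp only
    split_ifs with h
    · refine Finset.sum_nonneg fun i _ => ?_
      split_ifs
      exacts [hw p h i, le_rfl]
    · exact le_rfl
  · refine if_neg ?_
    rintro ⟨h1, h2, h3⟩
    rcases hp with h | h <;> omega
  · have hp : p ∈ triangle N := by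
      by_contra hp
      exact h (if_neg hp)
    dsimp only at h
    rw [if_pos hp] at h
    obtain ⟨i, -, hi⟩ := Finset.exists_ne_zero_of_sum_ne_zero h
    have : n i p = p' := by
      by_contra h'
      exact hi (if_neg h')
    exact this ▸ (hn p hp i).2
  · by_cases hp : p ∈ triangle N
    · simp only [hA f p hp, if_pos hp, Finset.sum_mul]
      rw [Finset.sum_comm]
      refine Finset.sum_congr rfl fun i _ => ?_
      simp only [ite_mul, zero_mul]
      rw [Finset.sum_ite_eq, if_pos (hn p hp i).1]
    · simp [hA0 f p hp, hp]

theorem mem_closedTriangle {N : ℕ} {p : ℕ × ℕ} : p ∈ closedTriangle N ↔ p.1 ≤ p.2 ∧ p.2 ≤ N := by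
  simp only [closedTriangle, Finset.mem_filter, Finset.mem_product, Finset.mem_range]
  omega

/-- The term with d acts only at y = x+1, where the inward moves lead to (x+1, x+1) and (x, x). Both
use the bulk bond, so their rates become c + d, which explains the sign condition. -/
theorem lap2D_isAbsorbedWalkGenerator {N : ℕ} {c d lm lp : ℝ} (hc : 0 < c) (hcd : 0 ≤ c + d)
    (hlm : 0 ≤ lm) (hlp : 0 ≤ lp) : IsAbsorbedWalkGenerator N (lap2D N c d lm lp) := by
  have hD : ∀ z, 0 ≤ rateDown c lm z := fun z => by
    unfold rateDown; split_ifs <;> positivity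
  have hU : ∀ z, 0 ≤ rateUp N c lp z := fun z => by
    unfold rateUp; split_ifs <;> positivity
  refine isAbsorbedWalkGenerator_of_neighbours
    ![fun p => (p.1 - 1, p.2), fun p => (min (p.1 + 1) p.2, max (p.1 + 1) p.2),
      fun p => (min p.1 (p.2 - 1), max p.1 (p.2 - 1)), fun p => (p.1, p.2 + 1)]
    ![fun p => (N : ℝ) ^ 2 * rateDown c lm p.1,
      fun p => (N : ℝ) ^ 2 * (rateUp N c lp p.1 + if p.2 = p.1 + 1 then d else 0),
      fun p => (N : ℝ) ^ 2 * (rateDown c lm p.2 + if p.2 = p.1 + 1 then d else 0),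
      fun p => (N : ℝ) ^ 2 * rateUp N c lp p.2] ?_ ?_ ?_ ?_
  · rintro ⟨x, y⟩ ⟨h1, h2, h3⟩ i
    dsimp only at h1 h2 h3
    have hd1 : 0 ≤ rateUp N c lp x + if y = x + 1 then d else 0 := by
      split_ifs with h
      · rw [rateUp, if_neg (by omega)]; exact hcd
      · simpa using hU x
    have hd2 : 0 ≤ rateDown c lm y + if y = x + 1 then d else 0 := by
      split_ifs with h
      · rw [rateDown, if_neg (by omega)]; exact hcd
      · simpa using hD y
    fin_cases i
    · exact mul_nonneg (by positivity) (hD x)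
    · exact mul_nonneg (by positivity) hd1
    · exact mul_nonneg (by positivity) hd2
    · exact mul_nonneg (by positivity) (hU y)
  · rintro ⟨x, y⟩ ⟨h1, h2, h3⟩ i
    dsimp only at h1 h2 h3
    simp only [mem_closedTriangle, abs_le]
    fin_cases i <;> simp <;> omega
  · rintro f ⟨x, y⟩ hp
    obtain ⟨h1, h2, h3⟩ := id hp
    dsimp only at h1 h2 h3
    simp only [lap2D, if_pos hp, Fin.sum_univ_four, sym, Matrix.cons_val]
    have e1 : min (x - 1) y = x - 1 := by omega
    have e2 : max (x - 1) y = y := by omega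
    have e3 : min x (y + 1) = x := by omega
    have e4 : max x (y + 1) = y + 1 := by omega
    rw [e1, e2, e3, e4]
    split_ifs with h
    · subst h
      simp only [min_self, max_self, Nat.add_sub_cancel]
      ring
    · ring
  · intro f p hp
    simp [lap2D, hp]

/-- On the diagonal the two middle indices are reused for the simultaneous jumps of both
coordinates; the outer two are the single jumps, which are equal in pairs by symmetry. -/
theorem pileLap2D_isAbsorbedWalkGenerator {N α : ℕ} :
    IsAbsorbedWalkGenerator N (pileLap2D N α) := by
  refine isAbsorbedWalkGenerator_of_neighbours
    ![fun p => (p.1 - 1, p.2),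
      fun p => if p.1 = p.2 then (p.1 - 1, p.2 - 1) else (p.1 + 1, p.2),
      fun p => if p.1 = p.2 then (p.1 + 1, p.2 + 1) else (p.1, p.2 - 1),
      fun p => (p.1, p.2 + 1)]
    ![fun p => (N : ℝ) ^ 2 * if p.1 = p.2 then 2 / ((α : ℝ) + 1) else 1 / (α : ℝ),
      fun p => (N : ℝ) ^ 2 *
        if p.1 = p.2 then 1 / ((α : ℝ) * ((α : ℝ) + 1)) else 1 / (α : ℝ),
      fun p => (N : ℝ) ^ 2 *
        if p.1 = p.2 then 1 / ((α : ℝ) * ((α : ℝ) + 1)) else 1 / (α : ℝ),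
      fun p => (N : ℝ) ^ 2 * if p.1 = p.2 then 2 / ((α : ℝ) + 1) else 1 / (α : ℝ)] ?_ ?_ ?_ ?_
  · rintro ⟨x, y⟩ - i
    fin_cases i <;> simp <;> split_ifs <;> positivity
  · rintro ⟨x, y⟩ ⟨h1, h2, h3⟩ i
    dsimp only at h1 h2 h3
    simp only [mem_closedTriangle, abs_le]
    by_cases h : x = y <;> fin_cases i <;> simp [h] <;> omega
  · rintro f ⟨x, y⟩ hp
    simp only [pileLap2D, if_pos hp, Fin.sum_univ_four, Matrix.cons_val]
    split_ifs with h
    · subst h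
      ring
    · ring
  · intro f p hp
    simp [pileLap2D, hp]

theorem exists_bound_on_triangle {N : ℕ} {g : ℝ → ℕ × ℕ → ℝ}
    (hg : ∀ p, Continuous fun t => g t p) (T : ℝ) :
    ∃ C : ℝ, ∀ t ∈ Icc 0 T, ∀ p ∈ triangle N, |g t p| ≤ C := by
  have hc : Continuous fun t => ∑ p ∈ closedTriangle N, |g t p| :=
    continuous_finsetSum _ fun p _ => (hg p).abs
  obtain ⟨C, hC⟩ := isCompact_Icc.exists_bound_of_continuousOn (hc.continuousOn (s := Icc 0 T))
  refine ⟨C, fun t ht p hp => ?_⟩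
  refine le_trans ?_ ((le_abs_self _).trans (hC t ht))
  exact Finset.single_le_sum (f := fun p => |g t p|) (fun _ _ => abs_nonneg _)
    (mem_closedTriangle.2 ⟨hp.2.1, hp.2.2.le⟩)

section

variable {N : ℕ} {k₁ k₂ k₃ : ℝ} {r : ℝ → ℕ → ℝ} {m : ℝ → ℕ → ℕ → ℝ}
  {q : ℝ → ℕ → ℝ} {φ : ℝ → ℕ × ℕ → ℝ}

/-- Site k+1 has bond k on its left and bond k+1 on its right. This turns rates indexed by sites
into conductances indexed by bonds. -/
theorem rateDown_eq {c lm lp : ℝ} {k : ℕ} (hk : k + 1 < N) :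
    rateDown c lm (k + 1) = c * bondWeight N lm lp k := by
  unfold rateDown bondWeight
  by_cases h : k = 0
  · simp [h]
  · simp [h, hk.ne]

theorem rateUp_eq {c lm lp : ℝ} {k : ℕ} :
    rateUp N c lp (k + 1) = c * bondWeight N lm lp (k + 1) := by
  unfold rateUp bondWeight
  simp

/-- The closed equation for mobilities `w (p₀ + q₀ (r + r') + 2 d m')`. -/
theorem IsMomentSystem.closedEquation_lap2D {c d lm lp p₀ q₀ γ γ' : ℝ} {S : Set (ℕ × ℕ)}
    (h : IsMomentSystem N c (bondWeight N lm lp) k₁ k₂ k₃ r m q φ)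
    (hc : 0 < c) (hcd : 0 ≤ c + d) (hlm : 0 ≤ lm) (hlp : 0 ≤ lp)
    (hq : ∀ t x, x < N → q t x = bondWeight N lm lp x *
      (p₀ + q₀ * (r t x + r t (x + 1)) + 2 * d * m t x (x + 1)))
    (hS : S ⊆ triangle N)
    (hdiag : ∀ x, (x, x) ∈ S → k₁ * (c + d) = c ∧ k₁ * q₀ + k₂ * c = 0 ∧
      k₁ * p₀ + 2 * c * k₃ = γ)
    (hoff : ∀ t x, 0 < x → x < N →
      c * m t x x - q₀ * r t x = (c + d) * (k₁ * m t x x + k₂ * r t x))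
    (hconst : -p₀ = 2 * (c + d) * k₃ + γ') :
    ClosedEquation N S φ (lap2D N c d lm lp) fun t p =>
      (if p.2 = p.1 + 1 then d * (N : ℝ) ^ 2 * (r t (p.1 + 1) - r t p.1) ^ 2 + γ' * (N : ℝ) ^ 2
        else 0) +
      if p.2 = p.1 then
        (N : ℝ) ^ 2 * γ * (bondWeight N lm lp (p.1 - 1) + bondWeight N lm lp p.1) else 0 := by
  refine ⟨lap2D_isAbsorbedWalkGenerator hc hcd hlm hlp, exists_bound_on_triangle fun p => ?_, ?_⟩
  · have h1 := h.cont (p.1 + 1)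
    have h2 := h.cont p.1
    split_ifs <;> fun_prop
  rintro ⟨x, y⟩ hp t ht
  obtain ⟨h1, h2, h3⟩ := hS hp
  dsimp only at h1 h2 h3
  simp only [lap2D, if_pos (hS hp)]
  obtain ⟨k, rfl⟩ : ∃ k, x = k + 1 := ⟨x - 1, by omega⟩
  obtain ⟨j, rfl⟩ : ∃ j, y = j + 1 := ⟨y - 1, by omega⟩
  have hkj : k ≤ j := by omega
  have hk : k + 1 < N := by omega
  rw [rateDown_eq (lp := lp) hk, rateDown_eq (lp := lp) h3, rateUp_eq (lm := lm),
    rateUp_eq (lm := lm)]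
  set w := bondWeight N lm lp with hw
  have hm := h.second k j hkj h3 t ht
  have hrk := h.first k hk t ht
  have hrj := h.first j h3 t ht
  simp only [sym, Nat.add_sub_cancel]
  rcases hkj.eq_or_lt with rfl | hlt
  · have hφ : ∀ s, φ s (k + 1, k + 1) = k₁ * m s (k + 1) (k + 1) + k₂ * r s (k + 1)
        - r s (k + 1) ^ 2 + k₃ := fun s => h.diag s _ h1 hk
    simp only [hφ]
    convert! (((hm.const_mul k₁).add (hrk.const_mul k₂)).sub (hrk.pow 2)).add_const k₃ using 1
    -- The three conditions match, in order, the coefficients of the neighbouring second moments, of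
    -- the densities and of the constants on each of the two adjacent bonds.
    obtain ⟨e1, e2, e3⟩ := hdiag _ hp
    simp only [show min k (k + 1) = k by omega, show max k (k + 1) = k + 1 by omega,
      show min (k + 1) k = k by omega, show max (k + 1) k = k + 1 by omega,
      show min (k + 1 + 1) (k + 1) = k + 1 by omega, show max (k + 1 + 1) (k + 1) = k + 2 by omega,
      show min (k + 1) (k + 1 + 1) = k + 1 by omega, show max (k + 1) (k + 1 + 1) = k + 2 by omega,
      h.off_diag t k (k + 1) (by omega) (by omega),
      h.off_diag t (k + 1) (k + 2) (by omega) (by omega), hq t k (by omega), hq t (k + 1) (by omega),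
      h.symm t k (k + 1), h.symm t (k + 2) (k + 1)]
    simp
    linear_combination -(N : ℝ) ^ 2 * (w k * (2 * m t (k + 1) k * e1
      + (r t k + r t (k + 1)) * e2 + e3) + w (k + 1) * (2 * m t (k + 1) (k + 2) * e1
      + (r t (k + 2) + r t (k + 1)) * e2 + e3))
  have hφ : ∀ s, φ s (k + 1, j + 1) = m s (k + 1) (j + 1) - r s (k + 1) * r s (j + 1) :=
    fun s => h.off_diag s _ _ (by omega) (by omega)
  simp only [hφ]
  convert! hm.sub (hrk.mul hrj) using 1
  rcases (Nat.succ_le_iff.2 hlt).eq_or_lt with rfl | hlt2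
  · have e1 := hoff t (k + 1) h1 hk
    have e2 := hoff t (k + 2) (by omega) h3
    -- The common bond joins two bulk sites.
    have hw1 : w (k + 1) = 1 := by
      rw [hw, bondWeight, if_neg (by omega), if_neg (by omega)]
    simp only [Nat.succ_eq_add_one, show k + 1 + 1 = k + 2 by omega,
      show k + 2 + 1 = k + 3 by omega,
      show min k (k + 2) = k by omega, show max k (k + 2) = k + 2 by omega, min_self, max_self,
      show min (k + 1) (k + 3) = k + 1 by omega, show max (k + 1) (k + 3) = k + 3 by omega,
      h.off_diag t k (k + 2) (by omega) (by omega),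
      h.off_diag t (k + 1) (k + 3) (by omega) (by omega), h.diag t (k + 1) h1 hk,
      h.diag t (k + 2) (by omega) h3, hq t (k + 1) (by omega), hw1]
    simp
    linear_combination -(N : ℝ) ^ 2 * (e1 + e2 + hconst)
  -- At distance at least two no mobility appears, and the covariance solves the product of two
  -- one-dimensional discrete heat equations.
  · simp only [show min k (j + 1) = k by omega, show max k (j + 1) = j + 1 by omega,
      show min (k + 1 + 1) (j + 1) = k + 2 by omega, show max (k + 1 + 1) (j + 1) = j + 1 by omega,
      show min (k + 1) j = k + 1 by omega, show max (k + 1) j = j by omega,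
      show min (k + 1) (j + 1 + 1) = k + 1 by omega, show max (k + 1) (j + 1 + 1) = j + 2 by omega,
      h.off_diag t k (j + 1) (by omega) (by omega), h.off_diag t (k + 2) (j + 1) (by omega) h3.le,
      h.off_diag t (k + 1) j (by omega) (by omega), h.off_diag t (k + 1) (j + 2) (by omega) h3]
    have e1 : j ≠ k := by omega
    have e2 : j ≠ k + 1 := by omega
    simp [e1, e2]
    ring

/-- The closed equation of the harmonic model, with mobilities `σ x + σ (x + 1)`. -/
theorem IsMomentSystem.closedEquation_pileLap2D {α : ℕ} (hα : 1 ≤ α)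
    (h : IsMomentSystem N (1 / α) (bondWeight N 1 1) ((α : ℝ) / (α + 1)) (-((α : ℝ) / (α + 1))) 0
      r m q φ) {σ : ℝ → ℕ → ℝ} (hq : ∀ t x, x < N → q t x = σ t x + σ t (x + 1))
    (hσ : ∀ t x, 0 < x → x < N →
      σ t x = (m t x x + α * r t x) / ((α : ℝ) * (α + 1)))
    (hσ0 : ∀ t, σ t 0 = r t 0 * (r t 0 + α) / (α : ℝ) ^ 2)
    (hσN : ∀ t, σ t N = r t N * (r t N + α) / (α : ℝ) ^ 2) :
    ClosedEquation N (triangle N) φ (pileLap2D N α) fun t p => if p.2 = p.1 then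
      (N : ℝ) ^ 2 / ((α : ℝ) * (α + 1)) * ((r t (p.1 + 1) - r t p.1) ^ 2
        + (r t (p.1 - 1) - r t p.1) ^ 2) else 0 := by
  refine ⟨pileLap2D_isAbsorbedWalkGenerator, exists_bound_on_triangle fun p => ?_, ?_⟩
  · have h1 := h.cont (p.1 + 1)
    have h2 := h.cont p.1
    have h3 := h.cont (p.1 - 1)
    split_ifs <;> fun_prop
  have hα' : (α : ℝ) ≠ 0 := by positivity
  have hα1 : (α : ℝ) + 1 ≠ 0 := by positivity
  have hw : ∀ x, bondWeight N 1 1 x = 1 := fun x => by simp [bondWeight]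
  -- With the reservoir values of σ the same formula returns 0 at the corners (0, 0) and (N, N), so
  -- the diagonal jumps to the boundary need no separate treatment.
  have hφ0 : ∀ t x, x ≤ N → φ t (x, x) = (α : ℝ) ^ 2 * σ t x - α * r t x - r t x ^ 2 := by
    intro t x hx
    rcases Nat.eq_zero_or_pos x with rfl | h0
    · rw [h.left, hσ0]
      field_simp
      ring
    · rcases hx.eq_or_lt with rfl | hxN
      · rw [h.right, hσN]
        field_simp
        ring
      · rw [h.diag t x h0 hxN, hσ t x h0 hxN]
        field_simp
        ring
  rintro ⟨x, y⟩ hp t ht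
  obtain ⟨h1, h2, h3⟩ := id hp
  dsimp only at h1 h2 h3
  simp only [pileLap2D, if_pos hp]
  obtain ⟨k, rfl⟩ : ∃ k, x = k + 1 := ⟨x - 1, by omega⟩
  obtain ⟨j, rfl⟩ : ∃ j, y = j + 1 := ⟨y - 1, by omega⟩
  have hkj : k ≤ j := by omega
  have hk : k + 1 < N := by omega
  have hm := h.second k j hkj h3 t ht
  have hrk := h.first k hk t ht
  have hrj := h.first j h3 t ht
  simp only [hw] at hm hrk hrj
  simp only [Nat.add_sub_cancel, show k + 1 + 1 = k + 2 by omega, show j + 1 + 1 = j + 2 by omega]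
  rcases hkj.eq_or_lt with rfl | hlt
  · have hφ : ∀ s, φ s (k + 1, k + 1) = (α : ℝ) / (α + 1) * m s (k + 1) (k + 1)
        + -((α : ℝ) / (α + 1)) * r s (k + 1) - r s (k + 1) ^ 2 + 0 := fun s => h.diag s _ h1 hk
    simp only [hφ]
    convert! (((hm.const_mul _).add (hrk.const_mul _)).sub (hrk.pow 2)).add_const 0 using 1
    simp only [h.off_diag t k (k + 1) (by omega) (by omega), hφ0 t k (by omega),
      hφ0 t (k + 2) (by omega),
      h.off_diag t (k + 1) (k + 2) (by omega) (by omega), hq t k (by omega), hq t (k + 1) (by omega),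
      h.symm t k (k + 1), h.symm t (k + 2) (k + 1), hσ t (k + 1) (by omega) hk, if_true]
    field_simp
    ring
  have hφ : ∀ s, φ s (k + 1, j + 1) = m s (k + 1) (j + 1) - r s (k + 1) * r s (j + 1) :=
    fun s => h.off_diag s _ _ (by omega) (by omega)
  simp only [hφ]
  convert! hm.sub (hrk.mul hrj) using 1
  have e0 : j ≠ k := by omega
  rcases (Nat.succ_le_iff.2 hlt).eq_or_lt with rfl | hlt2
  · simp only [Nat.succ_eq_add_one, show k + 1 + 1 = k + 2 by omega,
      show k + 1 + 2 = k + 3 by omega,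
      h.off_diag t k (k + 2) (by omega) (by omega),
      h.off_diag t (k + 1) (k + 3) (by omega) (by omega), h.diag t (k + 1) h1 hk,
      h.diag t (k + 2) (by omega) h3, hq t (k + 1) (by omega), hσ t (k + 1) (by omega) hk,
      hσ t (k + 2) (by omega) h3]
    simp
    field_simp
    ring
  · simp only [h.off_diag t k (j + 1) (by omega) (by omega),
      h.off_diag t (k + 2) (j + 1) (by omega) h3.le,
      h.off_diag t (k + 1) j (by omega) (by omega), h.off_diag t (k + 1) (j + 2) (by omega) h3]
    have e2 : j ≠ k + 1 := by omega
    have e3 : k ≠ j := by omega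
    simp [e0, e2, e3]
    ring

end

/-! ### Jump processes -/

section Jump

variable {N : ℕ}

/-- A particle configuration as a real-valued configuration. -/
def toR (η : Site N → ℕ) : Site N → ℝ := fun x => η x

theorem val_toR (η : Site N → ℕ) (x : ℕ) : val (toR η) x = ((val η x : ℕ) : ℝ) := by
  unfold val toR
  split_ifs <;> simp

/-- Transfer of `k` particles from `y` to `z`; outside the bulk they leave or enter the system. -/
def move (η : Site N → ℕ) (y z k : ℕ) : Site N → ℕ := addAt (subAt η y k) z k

/-- Total number of particles. -/
def mass (η : Site N → ℕ) : ℝ := ∑ x, (η x : ℝ)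

theorem mass_nonneg (η : Site N → ℕ) : 0 ≤ mass η := Finset.sum_nonneg fun _ _ => Nat.cast_nonneg _

theorem val_le_mass (η : Site N → ℕ) (x : ℕ) : ((val η x : ℕ) : ℝ) ≤ mass η := by
  unfold val
  split_ifs with h
  · exact Finset.single_le_sum (f := fun x => (η x : ℝ)) (fun _ _ => Nat.cast_nonneg _)
      (Finset.mem_univ _)
  · simpa using mass_nonneg η

/-- The total mass as an affine functional. -/
def massAff (N : ℕ) : Aff N where
  const := 0
  coef x := if 0 < x ∧ x < N then 1 else 0
  left := by simp
  right := by simp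

theorem massAff_eval (η : Site N → ℕ) : (massAff N).eval (toR η) = mass η := by
  simp only [massAff, Aff.eval, toR, mass, zero_add]
  refine Finset.sum_congr rfl fun x _ => ?_
  have := Finset.mem_Ioo.1 x.2
  rw [if_pos this, one_mul]

theorem Aff.sum_coef_ite (u : Aff N) {z : ℕ} (hz : z ≤ N) :
    ∑ s : Site N, u.coef s.1 * (if s.1 = z then 1 else 0) = u.coef z := by
  by_cases h : z ∈ Finset.Ioo 0 N
  · rw [Finset.sum_eq_single (⟨z, h⟩ : Site N)]
    · simp
    · intro b _ hb
      rw [if_neg, mul_zero]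
      rintro rfl
      exact hb rfl
    · simp
  · have h0 : u.coef z = 0 := by
      rw [Finset.mem_Ioo] at h
      rcases Nat.eq_zero_or_pos z with rfl | h1
      · exact u.left
      · obtain rfl : z = N := by omega
        exact u.right
    rw [h0]
    refine Finset.sum_eq_zero fun s _ => ?_
    rw [if_neg, mul_zero]
    rintro rfl
    exact h s.2

/-- Coefficients vanish at 0 and N, so creation and annihilation at the boundary obey the same
formula as bulk jumps. The bound on k excludes truncated subtraction at a bulk site. -/
theorem Aff.eval_move (u : Aff N) {η : Site N → ℕ} {y z k : ℕ} (hy : y ≤ N) (hz : z ≤ N)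
    (hyz : y ≠ z) (hk : 0 < y → y < N → k ≤ val η y) :
    u.eval (toR (move η y z k)) = u.eval (toR η) + k * (u.coef z - u.coef y) := by
  have h : ∀ s : Site N, toR (move η y z k) s
      = toR η s + k * ((if s.1 = z then 1 else 0) - if s.1 = y then 1 else 0) := by
    intro s
    simp only [toR, move, addAt, subAt]
    by_cases h1 : s.1 = y
    · have h2 : s.1 ≠ z := h1 ▸ hyz
      have hs := Finset.mem_Ioo.1 s.2
      have := hk (h1 ▸ hs.1) (h1 ▸ hs.2)
      have hv : val η y = η s := by
        subst h1
        simp only [val]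
        rw [dif_pos s.2]
      rw [hv] at this
      simp only [h1, hyz, if_true, if_false]
      rw [Nat.cast_sub this]
      ring
    · by_cases h2 : s.1 = z
      · simp [h2, hyz.symm]
      · simp [h1, h2]
  unfold Aff.eval
  rw [← u.sum_coef_ite hz, ← u.sum_coef_ite hy, ← Finset.sum_sub_distrib, Finset.mul_sum, add_assoc,
    ← Finset.sum_add_distrib]
  congr 1
  refine Finset.sum_congr rfl fun s _ => ?_
  rw [h]
  ring

theorem mass_move {η : Site N → ℕ} {y z k : ℕ} (hy : y ≤ N) (hz : z ≤ N)
    (hyz : y ≠ z) (hk : 0 < y → y < N → k ≤ val η y) :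
    mass (move η y z k) = mass η + k * ((massAff N).coef z - (massAff N).coef y) := by
  rw [← massAff_eval, ← massAff_eval, (massAff N).eval_move hy hz hyz hk]

theorem abs_massAff_coef_sub_le (y z : ℕ) : |(massAff N).coef z - (massAff N).coef y| ≤ 1 := by
  simp only [massAff]
  split_ifs <;> simp

theorem Aff.exists_bound (u : Aff N) : ∃ A, 0 < A ∧
    (∀ ξ : Site N → ℝ, |u.eval ξ| ≤ A * (1 + ∑ x, |ξ x|)) ∧
    ∀ y z, y ≤ N → z ≤ N → |u.coef z - u.coef y| ≤ A := by
  set S := ∑ x ∈ Finset.range (N + 1), |u.coef x| with hS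
  have hle : ∀ x ≤ N, |u.coef x| ≤ S := fun x hx =>
    Finset.single_le_sum (f := fun x => |u.coef x|) (fun _ _ => abs_nonneg _)
      (Finset.mem_range.2 (by omega))
  have hS0 : 0 ≤ S := (abs_nonneg _).trans (hle 0 (Nat.zero_le _))
  refine ⟨1 + |u.const| + 2 * S, by positivity, fun ξ => ?_, fun y z hy hz => ?_⟩
  · have h1 : |∑ x : Site N, u.coef x * ξ x| ≤ S * ∑ x, |ξ x| := by
      rw [Finset.mul_sum]
      refine (Finset.abs_sum_le_sum_abs _ _).trans (Finset.sum_le_sum fun x _ => ?_)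
      rw [abs_mul]
      exact mul_le_mul_of_nonneg_right (hle _ (Finset.mem_Ioo.1 x.2).2.le) (abs_nonneg _)
    have h2 : 0 ≤ ∑ x, |ξ x| := Finset.sum_nonneg fun _ _ => abs_nonneg _
    have h3 := abs_add_le u.const (∑ x : Site N, u.coef x * ξ x)
    unfold Aff.eval
    nlinarith [mul_nonneg hS0 h2, mul_nonneg (abs_nonneg u.const) h2, abs_nonneg u.const]
  · have := abs_sub (u.coef z) (u.coef y)
    linarith [hle y hy, hle z hz, abs_nonneg u.const]

theorem sum_abs_toR (η : Site N → ℕ) : ∑ x, |toR η x| = mass η := by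
  simp [toR, mass]

theorem finite_mass_lt (s : ℝ) : {η : Site N → ℕ | mass η < s}.Finite := by
  refine (Set.finite_Icc (0 : Site N → ℕ) fun _ => ⌈s⌉₊).subset fun η hη => ?_
  refine ⟨fun x => Nat.zero_le _, fun x => ?_⟩
  have h1 : (η x : ℝ) ≤ mass η := Finset.single_le_sum (f := fun x => (η x : ℝ))
    (fun _ _ => Nat.cast_nonneg _) (Finset.mem_univ _)
  have h2 : (η x : ℝ) < s := h1.trans_lt hη
  exact_mod_cast (h2.le.trans (Nat.le_ceil s))

/-! ### Truncations in the total mass. -/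

/-- Piecewise linear cutoff: `1` up to `n + 1` and `0` from `2 (n + 1)` on. -/
def cutoff (n : ℕ) (s : ℝ) : ℝ := max 0 (min 1 (2 - s / (n + 1)))

theorem cutoff_nonneg (n : ℕ) (s : ℝ) : 0 ≤ cutoff n s := le_max_left _ _

theorem cutoff_le_one (n : ℕ) (s : ℝ) : cutoff n s ≤ 1 := max_le zero_le_one (min_le_left _ _)

theorem cutoff_eq_zero {n : ℕ} {s : ℝ} (h : 2 * (n + 1) ≤ s) : cutoff n s = 0 := by
  refine max_eq_left ((min_le_right _ _).trans ?_)
  rw [sub_nonpos, le_div_iff₀ (by positivity)]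
  exact h

theorem cutoff_eq_one {n : ℕ} {s : ℝ} (h : s ≤ n + 1) : cutoff n s = 1 := by
  have : (1 : ℝ) ≤ 2 - s / (n + 1) := by
    have : s / (n + 1) ≤ 1 := by rw [div_le_one (by positivity)]; exact h
    linarith
  rw [cutoff, min_eq_left this, max_eq_right zero_le_one]

/-- The slope is 1/(n+1), and the cutoff moves only if the smaller argument is below 2(n+1), where
the weight 1 + s is at most 3(n+1). The two factors compensate uniformly in n. -/
theorem abs_cutoff_sub_mul_le {n : ℕ} {s t : ℝ} (hs : 0 ≤ s) (hst : s ≤ t) :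
    |cutoff n t - cutoff n s| * (1 + s) ≤ 3 * (t - s) := by
  have hn : (0 : ℝ) < n + 1 := by positivity
  by_cases h : 2 * ((n : ℝ) + 1) ≤ s
  · rw [cutoff_eq_zero h, cutoff_eq_zero (h.trans hst)]
    simpa using hst
  · have h1 : |cutoff n t - cutoff n s| ≤ (t - s) / (n + 1) := by
      unfold cutoff
      refine (abs_max_sub_max_le_max _ _ _ _).trans ?_
      refine max_le (by rw [sub_self, abs_zero]; exact div_nonneg (by linarith) hn.le) ?_
      refine (abs_min_sub_min_le_max _ _ _ _).trans ?_
      refine max_le (by rw [sub_self, abs_zero]; exact div_nonneg (by linarith) hn.le) ?_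
      rw [show 2 - t / ((n : ℝ) + 1) - (2 - s / (n + 1)) = -((t - s) / (n + 1)) by ring, abs_neg,
        abs_of_nonneg (div_nonneg (by linarith) hn.le)]
    have h2 : 1 + s ≤ 3 * (n + 1) := by
      have : (0 : ℝ) ≤ n := Nat.cast_nonneg n
      linarith
    calc |cutoff n t - cutoff n s| * (1 + s) ≤ (t - s) / (n + 1) * (3 * (n + 1)) := by gcongr
      _ = 3 * (t - s) := by field_simp

/-- Lipschitz bound, uniform in `n`, for a truncated product. -/
theorem abs_cutoff_mul_sub_le {n : ℕ} {A M M' a a' b b' j : ℝ} (hM : 0 ≤ M) (hM' : 0 ≤ M')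
    (hA : 0 ≤ A) (hj : |M' - M| ≤ j) (ha : |a| ≤ A * (1 + M)) (hb : |b| ≤ A * (1 + M))
    (ha' : |a'| ≤ A * (1 + M')) (hb' : |b'| ≤ A * (1 + M')) (haa : |a' - a| ≤ A * j)
    (hbb : |b' - b| ≤ A * j) :
    |cutoff n M' * (a' * b') - cutoff n M * (a * b)| ≤ 5 * A ^ 2 * (j * (1 + M + j)) := by
  have hj0 : 0 ≤ j := (abs_nonneg _).trans hj
  have hMj : M' ≤ M + j := by linarith [(abs_le.1 hj).2]
  have hab : |a' * b' - a * b| ≤ 2 * A ^ 2 * (j * (1 + M + j)) := by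
    rw [show a' * b' - a * b = a' * (b' - b) + (a' - a) * b by ring]
    refine (abs_add_le _ _).trans ?_
    rw [abs_mul, abs_mul]
    have h1 : |a'| * |b' - b| ≤ A * (1 + M') * (A * j) := by gcongr
    have h2 : |a' - a| * |b| ≤ A * j * (A * (1 + M)) := by gcongr
    have h3 : A * (1 + M') * (A * j) ≤ A * (1 + M + j) * (A * j) := by
      gcongr A * ?_ * (A * j)
      linarith
    have h4 : A * j * (A * (1 + M)) ≤ A * j * (A * (1 + M + j)) := by
      exact mul_le_mul_of_nonneg_left (mul_le_mul_of_nonneg_left (by linarith) hA)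
        (mul_nonneg hA hj0)
    linarith
  -- The product rule is split so that the increment of the cutoff multiplies the product at the
  -- smaller mass, where the weighted bound applies; large jumps rule out a bound at the larger one.
  rcases le_total M M' with h | h
  · rw [show cutoff n M' * (a' * b') - cutoff n M * (a * b)
      = cutoff n M' * (a' * b' - a * b) + (cutoff n M' - cutoff n M) * (a * b) by ring]
    refine (abs_add_le _ _).trans ?_
    rw [abs_mul, abs_mul, abs_of_nonneg (cutoff_nonneg _ _)]
    have h1 : cutoff n M' * |a' * b' - a * b| ≤ 1 * (2 * A ^ 2 * (j * (1 + M + j))) := by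
      gcongr
      exact cutoff_le_one _ _
    have h2 : |cutoff n M' - cutoff n M| * |a * b|
        ≤ |cutoff n M' - cutoff n M| * (A * (1 + M) * (A * (1 + M))) := by
      rw [abs_mul]; gcongr
    have h3 := abs_cutoff_sub_mul_le (n := n) hM h
    have h4 : |cutoff n M' - cutoff n M| * (1 + M) * (A ^ 2 * (1 + M))
        ≤ 3 * j * (A ^ 2 * (1 + M + j)) :=
      mul_le_mul (by linarith [le_abs_self (M' - M)])
        (mul_le_mul_of_nonneg_left (by linarith) (sq_nonneg A)) (by positivity) (by positivity)
    linear_combination h1 + h2 + h4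
  · rw [show cutoff n M' * (a' * b') - cutoff n M * (a * b)
      = cutoff n M * (a' * b' - a * b) + (cutoff n M' - cutoff n M) * (a' * b') by ring]
    refine (abs_add_le _ _).trans ?_
    rw [abs_mul, abs_mul, abs_of_nonneg (cutoff_nonneg _ _)]
    have h1 : cutoff n M * |a' * b' - a * b| ≤ 1 * (2 * A ^ 2 * (j * (1 + M + j))) := by
      gcongr
      exact cutoff_le_one _ _
    have h2 : |cutoff n M' - cutoff n M| * |a' * b'|
        ≤ |cutoff n M' - cutoff n M| * (A * (1 + M') * (A * (1 + M'))) := by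
      rw [abs_mul]; gcongr
    have h3 := abs_cutoff_sub_mul_le (n := n) hM' h
    rw [abs_sub_comm] at h3
    have h5 : M - M' ≤ j := by linarith [(abs_le.1 hj).1]
    have h4 : |cutoff n M' - cutoff n M| * (1 + M') * (A ^ 2 * (1 + M'))
        ≤ 3 * j * (A ^ 2 * (1 + M + j)) :=
      mul_le_mul (by linarith) (mul_le_mul_of_nonneg_left (by linarith) (sq_nonneg A))
        (by positivity) (by positivity)
    linear_combination h1 + h2 + h4

/-- Truncated quadratic Lyapunov function. -/
def truncSq (n : ℕ) (s : ℝ) : ℝ := (1 + min s n) ^ 2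

/-- From M > 2n the truncation changes only if the mass falls below n, which takes a jump of size
more than M/2: the jump pays for the weight 1 + M. This decay offsets the linear growth of the
boundary rates, including those of large piles. -/
theorem abs_truncSq_sub_le {n : ℕ} {M M' j : ℝ} (hM : 0 ≤ M) (hM' : 0 ≤ M')
    (hj : |M' - M| ≤ j) (hj1 : 1 ≤ j) :
    |truncSq n M' - truncSq n M| * (1 + M) ≤ (2 * n + 2) * (3 * n + 1) * j := by
  have hn : (0 : ℝ) ≤ n := Nat.cast_nonneg n
  have h0 : |min M' (n : ℝ) - min M n| * (1 + M) ≤ (3 * n + 1) * j := by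
    have h1 : |min M' (n : ℝ) - min M n| ≤ j := by
      refine (abs_min_sub_min_le_max _ _ _ _).trans ?_
      rw [sub_self, abs_zero]
      exact max_le hj ((abs_nonneg _).trans hj)
    rcases le_or_gt M (2 * n) with h | h
    · have : |min M' (n : ℝ) - min M n| * (1 + M) ≤ j * (3 * n + 1) :=
        mul_le_mul h1 (by linarith) (by linarith) (by linarith)
      linarith
    · have hMn : min M (n : ℝ) = n := min_eq_right (by linarith)
      rcases le_or_gt (n : ℝ) M' with h' | h'
      · rw [hMn, min_eq_right h', sub_self, abs_zero, zero_mul]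
        nlinarith
      · rw [hMn, min_eq_left h'.le, abs_of_neg (by linarith)]
        have h3 := (abs_le.1 hj).1
        have h4 : -(M' - n) * (1 + M) ≤ n * (1 + 2 * j) := by
          gcongr
          · linarith
          · linarith
        nlinarith
  have h2 : truncSq n M' - truncSq n M
      = (2 + min M' (n : ℝ) + min M n) * (min M' (n : ℝ) - min M n) := by
    unfold truncSq; ring
  have h3 : (0 : ℝ) ≤ min M' n := le_min hM' hn
  have h4 : (0 : ℝ) ≤ min M n := le_min hM hn
  rw [h2, abs_mul, abs_of_nonneg (by linarith), mul_assoc, mul_assoc]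
  exact mul_le_mul (by linarith [min_le_right M' (n : ℝ), min_le_right M (n : ℝ)]) h0
    (by positivity) (by positivity)

/-- For M ≥ n the truncation sits at its maximum and can only decrease. The upper bound therefore
stays proportional to the truncation itself, as the drift condition requires. -/
theorem truncSq_sub_le {n : ℕ} {M M' j : ℝ} (hM' : 0 ≤ M') (hj : M' - M ≤ j) :
    truncSq n M' - truncSq n M ≤ if M < n then 2 * (1 + M) * j + j ^ 2 else 0 := by
  have h0 : (0 : ℝ) ≤ min M' n := le_min hM' (Nat.cast_nonneg n)
  unfold truncSq
  split_ifs with h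
  · rw [min_eq_left h.le]
    have : (1 + min M' (n : ℝ)) ^ 2 ≤ (1 + M + j) ^ 2 :=
      pow_le_pow_left₀ (by linarith) (by linarith [min_le_left M' (n : ℝ)]) 2
    linarith
  · rw [min_eq_right (not_lt.1 h)]
    have : (1 + min M' (n : ℝ)) ^ 2 ≤ (1 + n) ^ 2 :=
      pow_le_pow_left₀ (by linarith) (by linarith [min_le_right M' (n : ℝ)]) 2
    linarith

/-! ### Transfers of random size along one bond. -/

/-- A nonnegative sequence of rates of transfers of `k + 1` particles with its first two moments. -/
structure HasMoments (ρ : ℕ → ℝ) (ρ₁ ρ₂ : ℝ) : Prop where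
  nonneg : ∀ k, 0 ≤ ρ k
  first : HasSum (fun k : ℕ => ((k : ℝ) + 1) * ρ k) ρ₁
  second : HasSum (fun k : ℕ => ((k : ℝ) + 1) ^ 2 * ρ k) ρ₂

namespace HasMoments

variable {ρ : ℕ → ℝ} {ρ₁ ρ₂ : ℝ}

theorem second_nonneg (h : HasMoments ρ ρ₁ ρ₂) : 0 ≤ ρ₂ :=
  h.second.nonneg fun k => mul_nonneg (by positivity) (h.nonneg k)

theorem hasSum_quad (h : HasMoments ρ ρ₁ ρ₂) (a b p q : ℝ) :
    HasSum (fun k : ℕ => ρ k * ((a + ((k : ℝ) + 1) * p) * (b + ((k : ℝ) + 1) * q) - a * b))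
      ((a * q + b * p) * ρ₁ + p * q * ρ₂) := by
  convert! (h.first.mul_left (a * q + b * p)).add (h.second.mul_left (p * q)) using 1
  ext k
  ring

theorem summable_of_le (h : HasMoments ρ ρ₁ ρ₂) {x : ℕ → ℝ} {C C' : ℝ}
    (hx : ∀ k, ρ k ≠ 0 → |x k| ≤ C * ((k : ℝ) + 1) + C' * ((k : ℝ) + 1) ^ 2) :
    Summable (fun k => ρ k * x k) ∧ |∑' k, ρ k * x k| ≤ C * ρ₁ + C' * ρ₂ := by
  have hb : ∀ k, ‖ρ k * x k‖ ≤ C * (((k : ℝ) + 1) * ρ k) + C' * (((k : ℝ) + 1) ^ 2 * ρ k) := by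
    intro k
    rw [Real.norm_eq_abs, abs_mul, abs_of_nonneg (h.nonneg k)]
    by_cases h0 : ρ k = 0
    · simp [h0]
    · calc ρ k * |x k| ≤ ρ k * (C * ((k : ℝ) + 1) + C' * ((k : ℝ) + 1) ^ 2) :=
            mul_le_mul_of_nonneg_left (hx k h0) (h.nonneg k)
        _ = _ := by ring
  have hs := (h.first.mul_left C).add (h.second.mul_left C')
  exact ⟨Summable.of_norm_bounded hs.summable hb, tsum_of_norm_bounded hs hb⟩

theorem tsum_le (h : HasMoments ρ ρ₁ ρ₂) {x : ℕ → ℝ} {C C' : ℝ}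
    (hs : Summable fun k => ρ k * x k)
    (hx : ∀ k, ρ k ≠ 0 → x k ≤ C * ((k : ℝ) + 1) + C' * ((k : ℝ) + 1) ^ 2) :
    ∑' k, ρ k * x k ≤ C * ρ₁ + C' * ρ₂ := by
  refine hasSum_le (fun k => ?_) hs.hasSum ((h.first.mul_left C).add (h.second.mul_left C'))
  by_cases h0 : ρ k = 0
  · simp [h0]
  · calc ρ k * x k ≤ ρ k * (C * ((k : ℝ) + 1) + C' * ((k : ℝ) + 1) ^ 2) :=
          mul_le_mul_of_nonneg_left (hx k h0) (h.nonneg k)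
      _ = _ := by ring

end HasMoments

/-- Effect on `f` of the transfers of `k + 1` particles from `y` to `z` at rate `ρ k`. -/
def transfer (ρ : ℕ → ℝ) (y z : ℕ) (f : (Site N → ℕ) → ℝ) (η : Site N → ℕ) : ℝ :=
  ∑' k, ρ k * (f (move η y z (k + 1)) - f η)

/-- A truncated product of affine functionals. -/
def truncProd (u v : Aff N) (n : ℕ) (η : Site N → ℕ) : ℝ :=
  cutoff n (mass η) * (u.eval (toR η) * v.eval (toR η))

section Transfer

variable {ρ : ℕ → ℝ} {ρ₁ ρ₂ : ℝ} {y z : ℕ} {η : Site N → ℕ}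

theorem abs_mass_move_sub_le (hy : y ≤ N) (hz : z ≤ N) (hyz : y ≠ z) {k : ℕ}
    (hk : 0 < y → y < N → k ≤ val η y) : |mass (move η y z k) - mass η| ≤ k := by
  rw [mass_move hy hz hyz hk, add_sub_cancel_left, abs_mul, Nat.abs_cast]
  exact mul_le_of_le_one_right (Nat.cast_nonneg _) (abs_massAff_coef_sub_le _ _)

theorem abs_truncProd_move_sub_le {u v : Aff N} {A : ℝ} (hA : 0 ≤ A)
    (hu : ∀ ξ : Site N → ℝ, |u.eval ξ| ≤ A * (1 + ∑ x, |ξ x|))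
    (hv : ∀ ξ : Site N → ℝ, |v.eval ξ| ≤ A * (1 + ∑ x, |ξ x|))
    (hu' : |u.coef z - u.coef y| ≤ A) (hv' : |v.coef z - v.coef y| ≤ A)
    (hy : y ≤ N) (hz : z ≤ N) (hyz : y ≠ z) (n : ℕ) {k : ℕ}
    (hk : 0 < y → y < N → k ≤ val η y) :
    |truncProd u v n (move η y z k) - truncProd u v n η|
      ≤ 5 * A ^ 2 * (k * (1 + mass η + k)) := by
  refine abs_cutoff_mul_sub_le (mass_nonneg _) (mass_nonneg _) hA
    (abs_mass_move_sub_le hy hz hyz hk) ?_ ?_ ?_ ?_ ?_ ?_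
  · simpa only [sum_abs_toR] using hu (toR η)
  · simpa only [sum_abs_toR] using hv (toR η)
  · simpa only [sum_abs_toR] using hu (toR (move η y z k))
  · simpa only [sum_abs_toR] using hv (toR (move η y z k))
  · rw [u.eval_move hy hz hyz hk, add_sub_cancel_left, abs_mul, Nat.abs_cast, mul_comm A]
    gcongr
  · rw [v.eval_move hy hz hyz hk, add_sub_cancel_left, abs_mul, Nat.abs_cast, mul_comm A]
    gcongr

theorem transfer_truncProd_bound {u v : Aff N} {A : ℝ} (hA : 0 ≤ A)
    (hu : ∀ ξ : Site N → ℝ, |u.eval ξ| ≤ A * (1 + ∑ x, |ξ x|))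
    (hv : ∀ ξ : Site N → ℝ, |v.eval ξ| ≤ A * (1 + ∑ x, |ξ x|))
    (hu' : |u.coef z - u.coef y| ≤ A) (hv' : |v.coef z - v.coef y| ≤ A)
    (hy : y ≤ N) (hz : z ≤ N) (hyz : y ≠ z) (h : HasMoments ρ ρ₁ ρ₂)
    (hk : ∀ k, ρ k ≠ 0 → 0 < y → y < N → k + 1 ≤ val η y) (n : ℕ) :
    |transfer ρ y z (truncProd u v n) η| ≤ 5 * A ^ 2 * (1 + mass η) * ρ₁ + 5 * A ^ 2 * ρ₂ := by
  refine (h.summable_of_le fun k h0 => ?_).2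
  refine (abs_truncProd_move_sub_le hA hu hv hu' hv' hy hz hyz n (hk k h0)).trans_eq ?_
  push_cast
  ring

/-- Dominated convergence over the jump sizes: each jump is eventually untouched by the cutoff, and
the uniform Lipschitz bound is summable against two moments of the rates. -/
theorem transfer_truncProd_tendsto (u v : Aff N) (hy : y ≤ N) (hz : z ≤ N) (hyz : y ≠ z)
    (h : HasMoments ρ ρ₁ ρ₂) (hk : ∀ k, ρ k ≠ 0 → 0 < y → y < N → k + 1 ≤ val η y) :
    Tendsto (fun n => transfer ρ y z (truncProd u v n) η) atTop
      (𝓝 ((u.eval (toR η) * (v.coef z - v.coef y) + v.eval (toR η) * (u.coef z - u.coef y)) * ρ₁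
        + (u.coef z - u.coef y) * (v.coef z - v.coef y) * ρ₂)) := by
  obtain ⟨A₁, hA₁, hu, hu'⟩ := u.exists_bound
  obtain ⟨A₂, hA₂, hv, hv'⟩ := v.exists_bound
  rw [← (h.hasSum_quad _ _ _ _).tsum_eq]
  refine tendsto_tsum_of_dominated_convergence (bound := fun k : ℕ =>
    5 * (A₁ + A₂) ^ 2 * (1 + mass η) * (((k : ℝ) + 1) * ρ k)
      + 5 * (A₁ + A₂) ^ 2 * (((k : ℝ) + 1) ^ 2 * ρ k))
    ((h.first.mul_left _).add (h.second.mul_left _)).summable (fun k => ?_)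
    (Eventually.of_forall fun n k => ?_)
  · by_cases h0 : ρ k = 0
    · simp [h0]
    refine Tendsto.const_mul _ (tendsto_const_nhds.congr' ?_)
    filter_upwards [eventually_ge_atTop ⌈mass η + (k + 1)⌉₊] with n hn
    have hn' : mass η + (k + 1) ≤ n := (Nat.le_ceil _).trans (by exact_mod_cast hn)
    have hm := (abs_le.1 (abs_mass_move_sub_le hy hz hyz (hk k h0))).2
    push_cast at hm
    have hk0 : (0 : ℝ) ≤ k := Nat.cast_nonneg k
    rw [truncProd, truncProd, cutoff_eq_one (by linarith), cutoff_eq_one (by linarith),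
      u.eval_move hy hz hyz (hk k h0), v.eval_move hy hz hyz (hk k h0)]
    push_cast
    ring
  · rw [Real.norm_eq_abs, abs_mul, abs_of_nonneg (h.nonneg k)]
    by_cases h0 : ρ k = 0
    · simp [h0]
    have := abs_truncProd_move_sub_le (A := A₁ + A₂) (by positivity)
      (fun ξ => (hu ξ).trans (by gcongr; linarith)) (fun ξ => (hv ξ).trans (by gcongr; linarith))
      ((hu' y z hy hz).trans (by linarith)) ((hv' y z hy hz).trans (by linarith))
      hy hz hyz n (hk k h0)
    refine (mul_le_mul_of_nonneg_left this (h.nonneg k)).trans_eq ?_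
    push_cast
    ring

/-- A bulk jump preserves the mass, so the cutoff factors out and the formula is exact for every n.
-/
theorem transfer_truncProd_of_conserved (u v : Aff N) (hy : y ≤ N) (hz : z ≤ N) (hyz : y ≠ z)
    (h : HasMoments ρ ρ₁ ρ₂) (hk : ∀ k, ρ k ≠ 0 → 0 < y → y < N → k + 1 ≤ val η y)
    (hM : (massAff N).coef z = (massAff N).coef y) (n : ℕ) :
    transfer ρ y z (truncProd u v n) η = cutoff n (mass η) *
      ((u.eval (toR η) * (v.coef z - v.coef y) + v.eval (toR η) * (u.coef z - u.coef y)) * ρ₁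
        + (u.coef z - u.coef y) * (v.coef z - v.coef y) * ρ₂) := by
  rw [← (h.hasSum_quad _ _ _ _).tsum_eq, ← tsum_mul_left]
  refine tsum_congr fun k => ?_
  by_cases h0 : ρ k = 0
  · simp [h0]
  rw [truncProd, truncProd, mass_move hy hz hyz (hk k h0), hM,
    u.eval_move hy hz hyz (hk k h0), v.eval_move hy hz hyz (hk k h0)]
  push_cast
  simp only [sub_self, mul_zero, add_zero]
  ring

theorem transfer_truncSq_bound (hy : y ≤ N) (hz : z ≤ N) (hyz : y ≠ z) (h : HasMoments ρ ρ₁ ρ₂)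
    (hk : ∀ k, ρ k ≠ 0 → 0 < y → y < N → k + 1 ≤ val η y) (n : ℕ) :
    |transfer ρ y z (fun η => truncSq n (mass η)) η|
        ≤ (2 * n + 2) * (3 * n + 1) * ρ₁ / (1 + mass η) ∧
      transfer ρ y z (fun η => truncSq n (mass η)) η
        ≤ if mass η < n then 2 * (1 + mass η) * ρ₁ + ρ₂ else 0 := by
  have hM : 0 < 1 + mass η := by linarith [mass_nonneg η]
  -- The first-moment constant carries the factor 1/(1 + mass); no second-moment term is needed
  -- because jumps have size at least 1.
  have hb := h.summable_of_le (x := fun k => truncSq n (mass (move η y z (k + 1)))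
      - truncSq n (mass η)) (C := (2 * n + 2) * (3 * n + 1) / (1 + mass η)) (C' := 0)
      fun k h0 => by
    have h1 := abs_truncSq_sub_le (n := n) (j := (k : ℝ) + 1) (mass_nonneg η) (mass_nonneg _)
      (by simpa using abs_mass_move_sub_le hy hz hyz (hk k h0))
      (by linarith [(Nat.cast_nonneg k : (0 : ℝ) ≤ k)])
    rw [← le_div_iff₀ hM] at h1
    refine h1.trans_eq ?_
    ring
  refine ⟨hb.2.trans_eq (by ring), ?_⟩
  split_ifs with hlt
  · refine (h.tsum_le (C := 2 * (1 + mass η)) (C' := 1) hb.1 fun k h0 => ?_).trans_eq (by ring)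
    have := truncSq_sub_le (n := n) (j := (k : ℝ) + 1) (mass_nonneg (move η y z (k + 1)))
      (by simpa using (abs_le.1 (abs_mass_move_sub_le hy hz hyz (hk k h0))).2)
    rw [if_pos hlt] at this
    linarith
  · refine (h.tsum_le (C := 0) (C' := 0) hb.1 fun k h0 => ?_).trans_eq (by ring)
    have := truncSq_sub_le (n := n) (j := (k : ℝ) + 1) (mass_nonneg (move η y z (k + 1)))
      (by simpa using (abs_le.1 (abs_mass_move_sub_le hy hz hyz (hk k h0))).2)
    rw [if_neg hlt] at this
    linarith

theorem transfer_truncSq_of_conserved (hy : y ≤ N) (hz : z ≤ N) (hyz : y ≠ z)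
    (hk : ∀ k, ρ k ≠ 0 → 0 < y → y < N → k + 1 ≤ val η y)
    (hM : (massAff N).coef z = (massAff N).coef y) (n : ℕ) :
    transfer ρ y z (fun η => truncSq n (mass η)) η = 0 := by
  unfold transfer
  refine (tsum_congr fun k => ?_).trans tsum_zero
  by_cases h0 : ρ k = 0
  · simp [h0]
  dsimp only
  rw [mass_move hy hz hyz (hk k h0), hM]
  simp

end Transfer

/-! ### Jump processes as quadratic models. -/

/-- Rates `R x k` and `Λ x k` of transfers of `k + 1` particles from `x` to `x + 1` and back, for
`x < N`, with current `J` and mobility `Q`. -/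
structure IsJumpRates (K : Set (Site N → ℕ)) (R Λ : ℕ → ℕ → (Site N → ℕ) → ℝ)
    (J Q : ℕ → (Site N → ℝ) → ℝ) (B : ℝ) : Prop where
  pos : 0 < B
  right_le : ∀ x k η, η ∈ K → R x k η ≠ 0 → 0 < x → x < N → k + 1 ≤ val η x
  left_le : ∀ x k η, η ∈ K → Λ x k η ≠ 0 → x + 1 < N → k + 1 ≤ val η (x + 1)
  moments : ∀ x < N, ∀ η ∈ K, ∃ r₁ r₂ l₁ l₂, HasMoments (fun k => R x k η) r₁ r₂ ∧
    HasMoments (fun k => Λ x k η) l₁ l₂ ∧ J x (toR η) = r₁ - l₁ ∧ Q x (toR η) = r₂ + l₂ ∧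
    |J x (toR η)| ≤ B * (1 + mass η) ∧ Q x (toR η) ≤ B * (1 + mass η) ^ 2 ∧
    (x = 0 ∨ x + 1 = N → r₁ + l₁ ≤ B * (1 + mass η))

/-- Generator of the jump process with the given rates. -/
def jumpGen (R Λ : ℕ → ℕ → (Site N → ℕ) → ℝ) (f : (Site N → ℕ) → ℝ) (η : Site N → ℕ) : ℝ :=
  ∑ x ∈ Finset.range N, (transfer (fun k => R x k η) x (x + 1) f η
    + transfer (fun k => Λ x k η) (x + 1) x f η)

theorem massAff_coef_eq {x : ℕ} (hx : ¬(x = 0 ∨ x + 1 = N)) (hxN : x < N) :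
    (massAff N).coef (x + 1) = (massAff N).coef x := by
  simp only [massAff]
  rw [if_pos (by omega), if_pos (by omega)]

end Jump

section Jump

variable {N : ℕ} {K : Set (Site N → ℕ)} {R Λ : ℕ → ℕ → (Site N → ℕ) → ℝ}
  {J Q : ℕ → (Site N → ℝ) → ℝ} {B : ℝ} {L : ((Site N → ℕ) → ℝ) → (Site N → ℕ) → ℝ}

theorem jumpGen_sub_const (f : (Site N → ℕ) → ℝ) (a : ℝ) (η : Site N → ℕ) :
    jumpGen R Λ (fun η => f η - a) η = jumpGen R Λ f η := by
  simp only [jumpGen, transfer, sub_sub_sub_cancel_right]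

theorem truncProd_mem_finSupp (u v : Aff N) (n : ℕ) : truncProd u v n ∈ finSupp (Site N → ℕ) := by
  refine (finite_mass_lt (2 * (n + 1))).subset fun η hη => ?_
  by_contra h
  exact hη (by rw [truncProd, cutoff_eq_zero (not_lt.1 h), zero_mul])

theorem truncSq_sub_mem_finSupp (n : ℕ) :
    (fun η : Site N → ℕ => truncSq n (mass η) - (1 + (n : ℝ)) ^ 2) ∈ finSupp (Site N → ℕ) := by
  refine (finite_mass_lt n).subset fun η hη => ?_
  by_contra h
  refine hη ?_
  dsimp only
  rw [truncSq, min_eq_right (not_lt.1 h), sub_self]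

/-- Only the two boundary bonds change the mass. There, below level n, the drift is at most
2(1+M)(r₁+l₁) + r₂+l₂ ≤ 3B(1+M)², which gives the constant 3B. -/
theorem IsJumpRates.truncSq_bound (hR : IsJumpRates K R Λ J Q B) (n : ℕ) {η : Site N → ℕ}
    (hη : η ∈ K) :
    |jumpGen R Λ (fun η => truncSq n (mass η)) η| ≤ N * ((2 * n + 2) * (3 * n + 1) * B) ∧
      jumpGen R Λ (fun η => truncSq n (mass η)) η ≤ N * (3 * B * truncSq n (mass η)) := by
  have hB := hR.pos
  have hM := mass_nonneg η
  have hW : 0 ≤ truncSq n (mass η) := sq_nonneg _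
  have key : ∀ x ∈ Finset.range N,
      |transfer (fun k => R x k η) x (x + 1) (fun η => truncSq n (mass η)) η
        + transfer (fun k => Λ x k η) (x + 1) x (fun η => truncSq n (mass η)) η|
          ≤ (2 * n + 2) * (3 * n + 1) * B ∧
      transfer (fun k => R x k η) x (x + 1) (fun η => truncSq n (mass η)) η
        + transfer (fun k => Λ x k η) (x + 1) x (fun η => truncSq n (mass η)) η
          ≤ 3 * B * truncSq n (mass η) := by
    intro x hx
    have hxN := Finset.mem_range.1 hx
    obtain ⟨r₁, r₂, l₁, l₂, hr, hl, -, hQ, -, hQB, hb⟩ := hR.moments x hxN η hη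
    have hkr := fun k h0 => hR.right_le x k η hη h0
    have hkl : ∀ k, Λ x k η ≠ 0 → 0 < x + 1 → x + 1 < N → k + 1 ≤ val η (x + 1) :=
      fun k h0 _ => hR.left_le x k η hη h0
    by_cases hx' : x = 0 ∨ x + 1 = N
    · obtain ⟨h1, h2⟩ := transfer_truncSq_bound hxN.le hxN (by omega) hr hkr n
      obtain ⟨h3, h4⟩ := transfer_truncSq_bound hxN hxN.le (by omega) hl hkl n
      have hb := hb hx'
      constructor
      · refine (abs_add_le _ _).trans ((add_le_add h1 h3).trans ?_)
        rw [← add_div, ← mul_add, div_le_iff₀ (by linarith), mul_assoc _ B]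
        gcongr
      · refine (add_le_add h2 h4).trans ?_
        split_ifs with hlt
        · have hW' : truncSq n (mass η) = (1 + mass η) ^ 2 := by
            rw [truncSq, min_eq_left hlt.le]
          rw [hW']
          have := mul_le_mul_of_nonneg_left hb (by linarith : 0 ≤ 2 * (1 + mass η))
          nlinarith
        · simp only [add_zero]
          positivity
    · have hM' := massAff_coef_eq hx' hxN
      rw [transfer_truncSq_of_conserved hxN.le hxN (by omega) hkr hM',
        transfer_truncSq_of_conserved hxN hxN.le (by omega) hkl hM'.symm, add_zero, abs_zero]
      constructor <;> positivity
  constructor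
  · refine (Finset.abs_sum_le_sum_abs _ _).trans
      ((Finset.sum_le_sum fun x hx => (key x hx).1).trans_eq ?_)
    simp
  · refine (Finset.sum_le_sum fun x hx => (key x hx).2).trans_eq ?_
    simp

/-- On boundary bonds the rates have linear first moments, so the two directions may be bounded
separately. In the bulk the rates of inclusion are quadratic and such a bound would be cubic;
conservation of mass makes it possible to combine the directions first. -/
theorem IsJumpRates.truncProd_bound (hR : IsJumpRates K R Λ J Q B) (u v : Aff N) :
    ∃ C, 0 < C ∧ ∀ n, ∀ η ∈ K, |truncProd u v n η| ≤ C * (1 + mass η) ^ 2 ∧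
      |jumpGen R Λ (truncProd u v n) η| ≤ C * (1 + mass η) ^ 2 := by
  obtain ⟨A₁, hA₁, hu₀, hu₀'⟩ := u.exists_bound
  obtain ⟨A₂, hA₂, hv₀, hv₀'⟩ := v.exists_bound
  set A := A₁ + A₂ with hA
  have hB := hR.pos
  have hA0 : 0 < A := by positivity
  have hu : ∀ ξ : Site N → ℝ, |u.eval ξ| ≤ A * (1 + ∑ x, |ξ x|) :=
    fun ξ => (hu₀ ξ).trans (by gcongr; linarith)
  have hv : ∀ ξ : Site N → ℝ, |v.eval ξ| ≤ A * (1 + ∑ x, |ξ x|) :=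
    fun ξ => (hv₀ ξ).trans (by gcongr; linarith)
  have hu' : ∀ y z, y ≤ N → z ≤ N → |u.coef z - u.coef y| ≤ A :=
    fun y z hy hz => (hu₀' y z hy hz).trans (by linarith)
  have hv' : ∀ y z, y ≤ N → z ≤ N → |v.coef z - v.coef y| ≤ A :=
    fun y z hy hz => (hv₀' y z hy hz).trans (by linarith)
  refine ⟨A ^ 2 + N * (10 * A ^ 2 * B), by positivity, fun n η hη => ?_⟩
  have hM := mass_nonneg η
  have hue : |u.eval (toR η)| ≤ A * (1 + mass η) := by simpa only [sum_abs_toR] using hu (toR η)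
  have hve : |v.eval (toR η)| ≤ A * (1 + mass η) := by simpa only [sum_abs_toR] using hv (toR η)
  constructor
  · rw [truncProd, abs_mul, abs_mul, abs_of_nonneg (cutoff_nonneg _ _)]
    have h1 : cutoff n (mass η) * (|u.eval (toR η)| * |v.eval (toR η)|)
        ≤ 1 * (A * (1 + mass η) * (A * (1 + mass η))) := by
      gcongr
      exact cutoff_le_one _ _
    have h2 : 0 ≤ N * (10 * A ^ 2 * B) * (1 + mass η) ^ 2 := by positivity
    linarith
  have key : ∀ x ∈ Finset.range N, |transfer (fun k => R x k η) x (x + 1) (truncProd u v n) η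
        + transfer (fun k => Λ x k η) (x + 1) x (truncProd u v n) η|
          ≤ 10 * A ^ 2 * B * (1 + mass η) ^ 2 := by
    intro x hx
    have hxN := Finset.mem_range.1 hx
    obtain ⟨r₁, r₂, l₁, l₂, hr, hl, hJ, hQ, hJB, hQB, hb⟩ := hR.moments x hxN η hη
    have hkr := fun k h0 => hR.right_le x k η hη h0
    have hkl : ∀ k, Λ x k η ≠ 0 → 0 < x + 1 → x + 1 < N → k + 1 ≤ val η (x + 1) :=
      fun k h0 _ => hR.left_le x k η hη h0
    by_cases hx' : x = 0 ∨ x + 1 = N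
    · have h1 := transfer_truncProd_bound hA0.le hu hv (hu' x (x + 1) hxN.le hxN)
        (hv' x (x + 1) hxN.le hxN) hxN.le hxN (by omega) hr hkr n
      have h2 := transfer_truncProd_bound hA0.le hu hv (hu' (x + 1) x hxN hxN.le)
        (hv' (x + 1) x hxN hxN.le) hxN hxN.le (by omega) hl hkl n
      refine (abs_add_le _ _).trans ((add_le_add h1 h2).trans ?_)
      have h3 := mul_le_mul_of_nonneg_left (hb hx')
        (by positivity : 0 ≤ 5 * A ^ 2 * (1 + mass η))
      rw [hQ] at hQB
      have h4 := mul_le_mul_of_nonneg_left hQB (by positivity : 0 ≤ 5 * A ^ 2)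
      linarith
    · have hM' := massAff_coef_eq hx' hxN
      rw [transfer_truncProd_of_conserved u v hxN.le hxN (by omega) hr hkr hM',
        transfer_truncProd_of_conserved u v hxN hxN.le (by omega) hl hkl hM'.symm]
      have hQ0 : |Q x (toR η)| ≤ B * (1 + mass η) ^ 2 := by
        rw [abs_of_nonneg]
        · exact hQB
        · rw [hQ]
          exact add_nonneg hr.second_nonneg hl.second_nonneg
      have hu1 := hu' x (x + 1) hxN.le hxN
      have hv1 := hv' x (x + 1) hxN.le hxN
      set p := u.coef (x + 1) - u.coef x with hp
      set q := v.coef (x + 1) - v.coef x with hq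
      -- The opposite gradients of the two directions turn r₁ and l₁ into the net current r₁ - l₁,
      -- which grows only linearly.
      rw [show u.coef x - u.coef (x + 1) = -p by ring, show v.coef x - v.coef (x + 1) = -q by ring,
        ← mul_add,
        show (u.eval (toR η) * q + v.eval (toR η) * p) * r₁ + p * q * r₂
          + ((u.eval (toR η) * -q + v.eval (toR η) * -p) * l₁ + -p * -q * l₂)
          = (u.eval (toR η) * q + v.eval (toR η) * p) * J x (toR η) + p * q * Q x (toR η) by
          rw [hJ, hQ]; ring, abs_mul, abs_of_nonneg (cutoff_nonneg _ _)]
      have h1 : |(u.eval (toR η) * q + v.eval (toR η) * p) * J x (toR η) + p * q * Q x (toR η)|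
          ≤ (A * (1 + mass η) * A + A * (1 + mass η) * A) * (B * (1 + mass η))
            + A * A * (B * (1 + mass η) ^ 2) := by
        refine (abs_add_le _ _).trans (add_le_add ?_ ?_)
        · rw [abs_mul]
          refine mul_le_mul ((abs_add_le _ _).trans (add_le_add ?_ ?_)) hJB (abs_nonneg _)
            (by positivity)
          · rw [abs_mul]; gcongr
          · rw [abs_mul]; gcongr
        · rw [abs_mul, abs_mul]; gcongr
      have h2 := mul_le_mul (cutoff_le_one n (mass η)) h1 (abs_nonneg _) zero_le_one
      have h3 : 0 ≤ A ^ 2 * B * (1 + mass η) ^ 2 := by positivity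
      linarith
  have := (Finset.abs_sum_le_sum_abs _ _).trans (Finset.sum_le_sum key)
  rw [Finset.sum_const, Finset.card_range, nsmul_eq_mul] at this
  have h2 : 0 ≤ A ^ 2 * (1 + mass η) ^ 2 := by positivity
  unfold jumpGen
  linarith

theorem IsJumpRates.truncProd_tendsto (hR : IsJumpRates K R Λ J Q B) (u v : Aff N) {η : Site N → ℕ}
    (hη : η ∈ K) :
    Tendsto (fun n => jumpGen R Λ (truncProd u v n) η) atTop (𝓝 (quadGen J Q u v (toR η))) := by
  refine tendsto_finsetSum _ fun x hx => ?_
  have hxN := Finset.mem_range.1 hx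
  obtain ⟨r₁, r₂, l₁, l₂, hr, hl, hJ, hQ, -, -, -⟩ := hR.moments x hxN η hη
  have h1 := transfer_truncProd_tendsto u v hxN.le hxN (by omega) hr
    fun k h0 => hR.right_le x k η hη h0
  have h2 := transfer_truncProd_tendsto u v hxN hxN.le (by omega) hl
    fun k h0 _ => hR.left_le x k η hη h0
  convert! h1.add h2 using 2
  rw [hJ, hQ, Aff.grad, Aff.grad]
  ring

theorem IsJumpRates.isQuadraticModel (hR : IsJumpRates K R Λ J Q B)
    (hL : ∀ f ∈ finSupp (Site N → ℕ), ∀ η ∈ K, L f η = jumpGen R Λ f η) :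
    IsQuadraticModel (finSupp (Site N → ℕ)) L K toR (fun η => (1 + mass η) ^ 2) J Q := by
  have hB := hR.pos
  -- The constant (1+n)² is the plateau value of the truncation. The factor N + 1 rather than N
  -- keeps the growth constant positive without a condition on N.
  refine ⟨⟨fun n η => truncSq n (mass η), fun n => (1 + (n : ℝ)) ^ 2, 1, (N + 1) * (3 * B), ?_⟩,
    fun u v => ?_, .of_discrete, .of_discrete, fun η _ x => ?_, ⟨2 * (N + 1), fun η _ => ?_⟩,
    fun η _ => sq_nonneg _⟩
  · have hLW : ∀ n, ∀ η ∈ K, L (fun η => truncSq n (mass η) - (1 + (n : ℝ)) ^ 2) η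
        = jumpGen R Λ (fun η => truncSq n (mass η)) η := fun n η hη => by
      rw [hL _ (truncSq_sub_mem_finSupp n) η hη, jumpGen_sub_const]
    have hW : ∀ n (η : Site N → ℕ), 0 ≤ truncSq n (mass η) := fun n η => sq_nonneg _
    refine ⟨by positivity, truncSq_sub_mem_finSupp, fun _ => .of_discrete, fun _ => .of_discrete,
      fun n => ⟨(1 + (n : ℝ)) ^ 2, fun η _ => ?_⟩, fun n => ⟨N * ((2 * n + 2) * (3 * n + 1) * B), fun η hη => ?_⟩,
      fun n η hη => ?_, fun n η _ => hW n η, fun n η _ => ?_, fun η _ => ?_⟩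
    · have := le_min (mass_nonneg η) (Nat.cast_nonneg (α := ℝ) n)
      rw [abs_of_nonneg (hW n η), truncSq]
      gcongr
      exact min_le_right _ _
    · rw [hLW n η hη]
      exact (hR.truncSq_bound n hη).1
    · rw [hLW n η hη]
      refine (hR.truncSq_bound n hη).2.trans ?_
      have := mul_nonneg hB.le (hW n η)
      nlinarith
    · have := le_min (mass_nonneg η) (Nat.cast_nonneg (α := ℝ) n)
      rw [one_mul, truncSq]
      gcongr
      exact min_le_left _ _
    · refine tendsto_const_nhds.congr' ?_
      filter_upwards [eventually_ge_atTop ⌈mass η⌉₊] with n hn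
      rw [truncSq, min_eq_left ((Nat.le_ceil _).trans (by exact_mod_cast hn))]
  · obtain ⟨C, hC, hb⟩ := hR.truncProd_bound u v
    refine ⟨truncProd u v, C, hC, fun n => ⟨truncProd_mem_finSupp u v n, .of_discrete,
      .of_discrete⟩, fun n η hη => ?_, fun η hη => ⟨?_, ?_⟩⟩
    · rw [hL _ (truncProd_mem_finSupp u v n) η hη]
      exact hb n η hη
    · refine tendsto_const_nhds.congr' ?_
      filter_upwards [eventually_ge_atTop ⌈mass η⌉₊] with n hn
      have : mass η ≤ n := (Nat.le_ceil _).trans (by exact_mod_cast hn)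
      rw [truncProd, cutoff_eq_one (by linarith), one_mul]
    · simp only [hL _ (truncProd_mem_finSupp u v _) η hη]
      exact hR.truncProd_tendsto u v hη
  · have h1 : toR η x ≤ mass η := Finset.single_le_sum (f := fun x => (η x : ℝ))
      (fun _ _ => Nat.cast_nonneg _) (Finset.mem_univ _)
    have h2 : 0 ≤ toR η x := Nat.cast_nonneg _
    exact pow_le_pow_left₀ h2 (by linarith) 2
  · have h1 : mass η ^ 2 ≤ N * ∑ x, toR η x ^ 2 := by
      refine (sq_sum_le_card_mul_sum_sq (s := Finset.univ) (f := fun x => (η x : ℝ))).trans ?_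
      refine mul_le_mul_of_nonneg_right ?_ (Finset.sum_nonneg fun _ _ => sq_nonneg _)
      simp
    have h2 : 0 ≤ ∑ x, toR η x ^ 2 := Finset.sum_nonneg fun _ _ => sq_nonneg _
    have h3 : (0 : ℝ) ≤ N := Nat.cast_nonneg N
    nlinarith [sq_nonneg (1 - mass η)]

end Jump

/-! ### Exclusion, inclusion and independent walks -/

section Particles

variable {N : ℕ} {c d lm lp rm rp : ℝ}

theorem sum_range_eq_boundary_add {N : ℕ} (hN : 2 ≤ N) (f : ℕ → ℝ) :
    ∑ x ∈ Finset.range N, f x = ∑ x ∈ Finset.Icc 1 (N - 2), f x + f 0 + f (N - 1) := by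
  obtain ⟨n, rfl⟩ : ∃ n, N = n + 2 := ⟨N - 2, by omega⟩
  rw [Finset.sum_range_succ, Finset.sum_range_succ', Nat.add_sub_cancel,
    show n + 2 - 1 = n + 1 by omega, ← Finset.Ico_add_one_right_eq_Icc, Finset.sum_Ico_eq_sum_range,
    Nat.add_sub_cancel]
  simp only [add_comm 1]

theorem subAt_eq_self {η : Site N → ℕ} {x k : ℕ} (hx : x = 0 ∨ x = N) : subAt η x k = η := by
  funext z
  have := Finset.mem_Ioo.1 z.2
  exact if_neg (by omega)

theorem addAt_eq_self {η : Site N → ℕ} {x k : ℕ} (hx : x = 0 ∨ x = N) : addAt η x k = η := by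
  funext z
  have := Finset.mem_Ioo.1 z.2
  exact if_neg (by omega)

theorem transfer_single (a : ℝ) (y z : ℕ) (f : (Site N → ℕ) → ℝ) (η : Site N → ℕ) :
    transfer (fun k => if k = 0 then a else 0) y z f η = a * (f (move η y z 1) - f η) := by
  unfold transfer
  rw [tsum_eq_single 0]
  · simp
  · intro k hk
    simp [hk]

theorem hasMoments_single {a : ℝ} (ha : 0 ≤ a) :
    HasMoments (fun k => if k = 0 then a else 0) a a := by
  refine ⟨fun k => by split_ifs <;> simp [ha], ?_, ?_⟩
  · convert! hasSum_single (f := fun k : ℕ => ((k : ℝ) + 1) * if k = 0 then a else 0) 0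
      (fun k hk => by simp [hk]) using 1
    simp
  · convert! hasSum_single (f := fun k : ℕ => ((k : ℝ) + 1) ^ 2 * if k = 0 then a else 0) 0
      (fun k hk => by simp [hk]) using 1
    simp

/-- Jump rate from `x` to `x + 1`. -/
def particleRight (N : ℕ) (c d lm lp rm rp : ℝ) (x : ℕ) (η : Site N → ℕ) : ℝ :=
  if x = 0 then lm * rm * (c + d * ((val η 1 : ℕ) : ℝ))
  else if x + 1 = N then lp * ((val η x : ℕ) : ℝ) * (c + d * rp) else bulkRate c d η x (x + 1)

/-- Jump rate from `x + 1` to `x`. -/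
def particleLeft (N : ℕ) (c d lm lp rm rp : ℝ) (x : ℕ) (η : Site N → ℕ) : ℝ :=
  if x = 0 then lm * ((val η 1 : ℕ) : ℝ) * (c + d * rm)
  else if x + 1 = N then lp * rp * (c + d * ((val η x : ℕ) : ℝ)) else bulkRate c d η (x + 1) x

/-- Mobility of the bond `{x, x + 1}`. -/
def particleMobility (N : ℕ) (c d lm lp rm rp : ℝ) (x : ℕ) (ξ : Site N → ℝ) : ℝ :=
  bondWeight N lm lp x * (c * ((Aff.prof N rm rp x).eval ξ + (Aff.prof N rm rp (x + 1)).eval ξ)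
    + 2 * d * ((Aff.prof N rm rp x).eval ξ * (Aff.prof N rm rp (x + 1)).eval ξ))

theorem particleGen_eq_jumpGen (hN : 2 ≤ N) (f : (Site N → ℕ) → ℝ) (η : Site N → ℕ) :
    particleGen N c d lm lp rm rp f η
      = jumpGen (fun x k η => if k = 0 then particleRight N c d lm lp rm rp x η else 0)
          (fun x k η => if k = 0 then particleLeft N c d lm lp rm rp x η else 0) f η := by
  simp only [jumpGen, transfer_single]
  rw [sum_range_eq_boundary_add hN, particleGen]
  congr 1
  · congr 1
    · refine Finset.sum_congr rfl fun x hx => ?_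
      obtain ⟨h1, h2⟩ := Finset.mem_Icc.1 hx
      rw [particleRight, particleLeft, if_neg (by omega), if_neg (by omega), if_neg (by omega),
        if_neg (by omega)]
      rfl
    · simp [particleRight, particleLeft, particleReservoir, move, subAt_eq_self, addAt_eq_self]
  · rw [particleRight, particleLeft, if_neg (by omega), if_pos (by omega), if_neg (by omega),
      if_pos (by omega), show N - 1 + 1 = N by omega]
    simp only [particleReservoir, move]
    rw [subAt_eq_self (Or.inr rfl), addAt_eq_self (Or.inr rfl)]
    ring

theorem particle_reservoir_bounds {c d l ρ a M B : ℝ} (hc : 0 ≤ c) (hl : 0 ≤ l) (hρ : 0 ≤ ρ)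
    (ha : 0 ≤ a) (haM : a ≤ M) (hB : l * (c + c * ρ + 2 * |d| * ρ) ≤ B) :
    |c * l * (ρ - a)| ≤ B * (1 + M) ∧
      l * ρ * (c + d * a) + l * a * (c + d * ρ) ≤ B * (1 + M) := by
  have hM : 0 ≤ M := ha.trans haM
  have h1 : l * (c + c * ρ + 2 * |d| * ρ) * (1 + M) ≤ B * (1 + M) :=
    mul_le_mul_of_nonneg_right hB (by linarith)
  have hcl : 0 ≤ c * l := by positivity
  have h2 : c * l * a ≤ c * l * M := mul_le_mul_of_nonneg_left haM hcl
  have h3 : 0 ≤ c * l * ρ * M := by positivity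
  have h5 : 0 ≤ l * ρ * |d| := by positivity
  have h6 : l * ρ * (d * a) ≤ l * ρ * |d| * M := by
    rw [mul_assoc (l * ρ)]
    refine mul_le_mul_of_nonneg_left ?_ (by positivity)
    exact mul_le_mul (le_abs_self d) haM ha (abs_nonneg d)
  have h7 : 0 ≤ l * ρ * |d| * M := by positivity
  have h8 : 0 ≤ c * l * ρ := by positivity
  have h9 : 0 ≤ c * l * a := by positivity
  have h10 : 0 ≤ c * l * M := by positivity
  refine ⟨abs_le.2 ⟨?_, ?_⟩, ?_⟩ <;> linarith

theorem particle_bulk_bounds {c d a b M B : ℝ} (hc : 0 ≤ c) (ha : 0 ≤ a) (hb : 0 ≤ b)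
    (haM : a ≤ M) (hbM : b ≤ M) (hB : 2 * c + 2 * |d| ≤ B) :
    |c * 1 * (a - b)| ≤ B * (1 + M) ∧
      a * (c + d * b) + b * (c + d * a) ≤ B * (1 + M) ^ 2 := by
  have hM : 0 ≤ M := ha.trans haM
  have h1 : (2 * c + 2 * |d|) * (1 + M) ≤ B * (1 + M) :=
    mul_le_mul_of_nonneg_right hB (by linarith)
  have h1' : (2 * c + 2 * |d|) * (1 + M) ^ 2 ≤ B * (1 + M) ^ 2 :=
    mul_le_mul_of_nonneg_right hB (by positivity)
  have h2 := mul_le_mul_of_nonneg_left haM hc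
  have h3 := mul_le_mul_of_nonneg_left hbM hc
  have h4 := mul_nonneg hc ha
  have h5 := mul_nonneg hc hb
  have h6 : 0 ≤ |d| * (1 + 2 * M) := by positivity
  have h7 : 0 ≤ c * (1 + M ^ 2) := by positivity
  have h8 : d * (a * b) ≤ |d| * (M * M) :=
    mul_le_mul (le_abs_self d) (mul_le_mul haM hbM hb hM) (mul_nonneg ha hb) (abs_nonneg d)
  have h9 : 0 ≤ |d| * M := by positivity
  have h10 := mul_nonneg hc hM
  have h11 := abs_nonneg d
  refine ⟨abs_le.2 ⟨?_, ?_⟩, ?_⟩ <;> linarith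

/-- Gradient property: in η(x)(c + dη(y)) - η(y)(c + dη(x)) the products cancel, leaving Fick's law,
while the sum of the two rates is the mobility. The reservoir rates have the same shape with a
density in place of an occupation number. -/
theorem particle_isJumpRates (hN : 2 ≤ N) (hc : 0 < c) (hlm : 0 < lm) (hlp : 0 < lp)
    (hrm : 0 < rm) (hrp : 0 < rp) (hd : d < 0 → rm < -c / d ∧ rp < -c / d) :
    ∃ B, IsJumpRates (particleStates N c d)
      (fun x k η => if k = 0 then particleRight N c d lm lp rm rp x η else 0)
      (fun x k η => if k = 0 then particleLeft N c d lm lp rm rp x η else 0)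
      (fick N c lm lp rm rp) (particleMobility N c d lm lp rm rp) B := by
  have hrm' : 0 ≤ c + d * rm := by
    rcases lt_or_ge d 0 with h | h
    · have := (hd h).1
      rw [lt_div_iff_of_neg h] at this
      linarith
    · positivity
  have hrp' : 0 ≤ c + d * rp := by
    rcases lt_or_ge d 0 with h | h
    · have := (hd h).2
      rw [lt_div_iff_of_neg h] at this
      linarith
    · positivity
  have hval : ∀ η ∈ particleStates N c d, ∀ x, 0 ≤ c + d * ((val η x : ℕ) : ℝ) := by
    intro η hη x
    unfold val
    split_ifs
    · exact hη _
    · simpa using hc.le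
  refine ⟨2 * c + 2 * |d| + lm * (c + c * rm + 2 * |d| * rm) + lp * (c + c * rp + 2 * |d| * rp),
    by positivity, fun x k η hη h0 hx hxN => ?_, fun x k η hη h0 hxN => ?_,
    fun x hx η hη => ?_⟩
  · obtain rfl : k = 0 := by
      by_contra hk
      exact h0 (if_neg hk)
    rw [if_pos rfl, particleRight, if_neg hx.ne'] at h0
    by_contra hv
    have : val η x = 0 := by omega
    split_ifs at h0 <;> simp [this, bulkRate] at h0
  · obtain rfl : k = 0 := by
      by_contra hk
      exact h0 (if_neg hk)
    rw [if_pos rfl, particleLeft, if_neg hxN.ne] at h0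
    by_contra hv
    have : val η (x + 1) = 0 := by omega
    split_ifs at h0 with h1
    · subst h1
      simp [this] at h0
    · simp [this, bulkRate] at h0
  · have hR : 0 ≤ particleRight N c d lm lp rm rp x η := by
      have h1 := hval η hη 1
      have h2 := hval η hη (x + 1)
      unfold particleRight bulkRate
      split_ifs <;> positivity
    have hL : 0 ≤ particleLeft N c d lm lp rm rp x η := by
      have h1 := hval η hη x
      unfold particleLeft bulkRate
      split_ifs <;> positivity
    refine ⟨_, _, _, _, hasMoments_single hR, hasMoments_single hL, ?_⟩
    have hM := mass_nonneg η
    have hx0 : (0 : ℝ) ≤ (val η x : ℕ) := Nat.cast_nonneg _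
    have hx1 : (0 : ℝ) ≤ (val η (x + 1) : ℕ) := Nat.cast_nonneg _
    have hxM := val_le_mass η x
    have hxM1 := val_le_mass η (x + 1)
    have hm0 : 0 ≤ lm * (c + c * rm + 2 * |d| * rm) := by positivity
    have hp0 : 0 ≤ lp * (c + c * rp + 2 * |d| * rp) := by positivity
    have hc0 : 0 ≤ 2 * c + 2 * |d| := by positivity
    set B := 2 * c + 2 * |d| + lm * (c + c * rm + 2 * |d| * rm)
      + lp * (c + c * rp + 2 * |d| * rp) with hB
    have hsq : B * (1 + mass η) ≤ B * (1 + mass η) ^ 2 := by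
      refine mul_le_mul_of_nonneg_left ?_ (by linarith)
      nlinarith
    by_cases h0 : x = 0
    · subst h0
      simp only [zero_add] at hx1 hxM1
      obtain ⟨b1, b2⟩ := particle_reservoir_bounds (d := d) hc.le hlm.le hrm.le hx1 hxM1
        (by linarith : _ ≤ B)
      have e1 : 1 ≠ N := by omega
      simp only [fick, particleMobility, particleRight, particleLeft, bondWeight, Aff.prof_eval,
        val_toR, if_true, zero_add, if_neg one_ne_zero, if_neg e1]
      refine ⟨by ring, by ring, b1, le_trans (le_of_eq (by ring)) (b2.trans hsq),
        fun _ => b2⟩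
    · by_cases hxN : x + 1 = N
      · obtain ⟨b1, b2⟩ := particle_reservoir_bounds (d := d) hc.le hlp.le hrp.le hx0 hxM
          (by linarith : _ ≤ B)
        have e1 : x ≠ N := by omega
        have e2 : x + 1 ≠ 0 := by omega
        simp only [fick, particleMobility, particleRight, particleLeft, bondWeight, Aff.prof_eval,
          val_toR, if_neg h0, if_pos hxN, if_neg e1, if_neg e2]
        refine ⟨by ring, by ring, ?_, le_trans (le_of_eq (by ring)) (b2.trans hsq),
          fun _ => le_trans (le_of_eq (by ring)) b2⟩
        rw [← abs_neg, ← mul_neg, neg_sub]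
        exact b1
      · have e1 : x ≠ N := by omega
        have e2 : x + 1 ≠ 0 := by omega
        simp only [fick, particleMobility, particleRight, particleLeft, bondWeight, Aff.prof_eval,
          val_toR, if_neg h0, if_neg hxN, if_neg e1, if_neg e2, bulkRate]
        obtain ⟨b1, b2⟩ := particle_bulk_bounds (d := d) hc.le hx0 hx1 hxM hxM1
          (by linarith : _ ≤ B)
        exact ⟨by ring, by ring, b1, le_trans (le_of_eq (by ring)) b2, fun h => by omega⟩

theorem particleMobility_mem_quadSpan (x : ℕ) :
    particleMobility N c d lm lp rm rp x ∈ quadSpan N := by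
  have h : particleMobility N c d lm lp rm rp x
      = (bondWeight N lm lp x * c) • ((fun ξ => (Aff.prof N rm rp x).eval ξ * (Aff.one N).eval ξ)
          + fun ξ => (Aff.prof N rm rp (x + 1)).eval ξ * (Aff.one N).eval ξ)
        + (bondWeight N lm lp x * (2 * d)) •
          fun ξ => (Aff.prof N rm rp x).eval ξ * (Aff.prof N rm rp (x + 1)).eval ξ := by
    ext ξ
    simp only [particleMobility, Pi.add_apply, Pi.smul_apply, smul_eq_mul, Aff.one_eval]
    ring
  rw [h]
  exact Submodule.add_mem _ (Submodule.smul_mem _ _ (Submodule.add_mem _ (mul_mem_quadSpan _ _)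
    (mul_mem_quadSpan _ _))) (Submodule.smul_mem _ _ (mul_mem_quadSpan _ _))

end Particles

/-- The mobility has p₀ = 0 and q₀ = c. The conditions on the diagonal force k₁ = c/(c+d), k₂ = -k₁,
k₃ = 0, and have no solution when c + d = 0; there k₁ is 0 by the convention on division, and the
diagonal is left out. -/
theorem particle_closedEquation {N : ℕ} (hN : 2 ≤ N) {Ω : Type*} [mΩ : MeasurableSpace Ω]
    (P : Measure Ω) [IsProbabilityMeasure P] (ℱ : Filtration ℝ≥0 mΩ) (c d lm lp rm rp : ℝ)
    (hc : 0 < c) (hκ : d < 0 → ∃ κ : ℕ, c = -d * κ) (hlm : lm ∈ Ioc (0 : ℝ) 1)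
    (hlp : lp ∈ Ioc (0 : ℝ) 1) (hrm : 0 < rm) (hrp : 0 < rp)
    (hd : d < 0 → rm < -c / d ∧ rp < -c / d) (μ : Measure (Site N → ℕ))
    (η : ℝ≥0 → Ω → Site N → ℕ) (hμ : ∀ x, MemLp (fun ξ : Site N → ℕ => (ξ x : ℝ)) 2 μ)
    (hη : IsProcess P ℱ (finSupp (Site N → ℕ)) (particleGen N c d lm lp rm rp)
      (particleStates N c d) μ η) :
    (∀ t x, MemLp (fun ω => (η t ω x : ℝ)) 2 P) ∧
    ClosedEquation N {p | p ∈ triangle N ∧ (p.1 = p.2 → c + d ≠ 0)}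
      (corr P N (occ η) fun u r => c / (c + d) * (u * (u - 1)) - r ^ 2)
      (lap2D N c d lm lp)
      (fun t p => if p.2 = p.1 + 1 then
        d * (N : ℝ) ^ 2 * (density P N (occ η) rm rp t (p.1 + 1)
          - density P N (occ η) rm rp t p.1) ^ 2 else 0) := by
  obtain ⟨B, hB⟩ := particle_isJumpRates (d := d) hN hc hlm.1 hlp.1 hrm hrp hd
  have hM := hB.isQuadraticModel fun f _ ξ _ => particleGen_eq_jumpGen hN f ξ
  refine ⟨hM.memLp hη hμ, ?_⟩
  have hQ : ∀ x < N, particleMobility N c d lm lp rm rp x ∈ quadSpan N :=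
    fun x _ => particleMobility_mem_quadSpan x
  have hS := hM.isMomentSystem hN hη hμ hQ (Y := occ η) (fun t ω x => (val_toR _ _).symm)
    (F := fun u r => c / (c + d) * (u * (u - 1)) - r ^ 2) (k₁ := c / (c + d))
    (k₂ := -(c / (c + d))) (k₃ := 0) (fun u ρ => by ring)
  -- For d < 0 the maximal occupation κ is at least 1, because c > 0.
  have hcd : 0 ≤ c + d := by
    rcases lt_or_ge d 0 with h | h
    · obtain ⟨κ, hκ⟩ := hκ h
      have : 1 ≤ κ := by
        by_contra h0
        obtain rfl : κ = 0 := by omega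
        simp at hκ
        linarith
      have : (1 : ℝ) ≤ κ := by exact_mod_cast this
      nlinarith
    · linarith
  have hC := hS.closedEquation_lap2D (p₀ := 0) (q₀ := c) (d := d) (γ := 0) (γ' := 0)
    (S := {p | p ∈ triangle N ∧ (p.1 = p.2 → c + d ≠ 0)}) hc hcd hlm.1.le hlp.1.le
    (fun t x hx => ?_) (fun p hp => hp.1) (fun x hx => ?_) (fun t x hx hxN => ?_) (by ring)
  · convert! hC using 3 with t p
    simp
  · have hr := hM.hasMean_prof hη hμ (Y := occ η) (fun t ω x => (val_toR _ _).symm) rm rp t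
    have hm := hM.hasMean hη hμ (mul_mem_quadSpan (.prof N rm rp x) (.prof N rm rp (x + 1)))
      (accel N t)
    refine ((((hr x).add (hr (x + 1))).const_mul c).add (hm.const_mul (2 * d))).const_mul
      (bondWeight N lm lp x) |>.eq.trans ?_
    ring
  · have := hx.2 rfl
    refine ⟨by field_simp, by ring, by ring⟩
  -- With at most one particle per site η² = η, so the left side vanishes together with the rate c +
  -- d of the diagonal jumps.
  · by_cases h0 : c + d = 0
    · have hr := hM.hasMean_prof hη hμ (Y := occ η) (fun t ω x => (val_toR _ _).symm) rm rp t x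
      have h1 : ∀ ω, (Aff.prof N rm rp x).eval (toR (η (accel N t) ω))
          * (Aff.prof N rm rp x).eval (toR (η (accel N t) ω))
          = (Aff.prof N rm rp x).eval (toR (η (accel N t) ω)) := by
        intro ω
        have h2 := hη.state (accel N t) ω ⟨x, Finset.mem_Ioo.2 ⟨hx, hxN⟩⟩
        rw [← val_eq_prof hx hxN, val, dif_pos (Finset.mem_Ioo.2 ⟨hx, hxN⟩)]
        rw [show d = -c by linarith] at h2
        have h3 : (η (accel N t) ω ⟨x, Finset.mem_Ioo.2 ⟨hx, hxN⟩⟩ : ℝ) ≤ 1 := by nlinarith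
        have h4 : η (accel N t) ω ⟨x, Finset.mem_Ioo.2 ⟨hx, hxN⟩⟩ ≤ 1 := by exact_mod_cast h3
        simp only [toR]
        interval_cases η (accel N t) ω ⟨x, Finset.mem_Ioo.2 ⟨hx, hxN⟩⟩ <;> simp
      simp only [h1, hr.eq, h0]
      ring
    · field_simp
      ring

/-! ### The open harmonic model -/

/-- The hockey-stick identity for binomial coefficients, multiplied by a!. -/
theorem sum_factorial_ratio (a m : ℕ) :
    ∑ j ∈ Finset.range m, ((j + a).factorial : ℝ) / j.factorial
      = m * (m + a).factorial / (m.factorial * (a + 1)) := by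
  induction m with
  | zero => simp
  | succ m ih =>
    rw [Finset.sum_range_succ, ih, show m + 1 + a = (m + a) + 1 by ring, Nat.factorial_succ,
      Nat.factorial_succ]
    push_cast
    have : (m.factorial : ℝ) ≠ 0 := by positivity
    field_simp
    ring

/-- Raising m by one adds to the weighted sum exactly one plain partial sum, so the previous
identity drives the induction. -/
theorem sum_mul_factorial_ratio (a m : ℕ) :
    ∑ j ∈ Finset.range m, ((m : ℝ) - j) * (((j + a).factorial : ℝ) / j.factorial)
      = m * (m + a + 1) * (m + a).factorial / (m.factorial * ((a + 1) * (a + 2))) := by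
  induction m with
  | zero => simp
  | succ m ih =>
    have h : ∑ j ∈ Finset.range (m + 1), (((m + 1 : ℕ) : ℝ) - j)
          * (((j + a).factorial : ℝ) / j.factorial)
        = ∑ j ∈ Finset.range m, ((m : ℝ) - j) * (((j + a).factorial : ℝ) / j.factorial)
          + ∑ j ∈ Finset.range (m + 1), ((j + a).factorial : ℝ) / j.factorial := by
      rw [Finset.sum_range_succ, Finset.sum_range_succ _ m, ← add_assoc, ← Finset.sum_add_distrib]
      congr 1
      · refine Finset.sum_congr rfl fun j _ => ?_
        push_cast
        ring
      · push_cast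
        ring
    rw [h, ih, sum_factorial_ratio, show m + 1 + a = (m + a) + 1 by ring, Nat.factorial_succ,
      Nat.factorial_succ]
    push_cast
    have : (m.factorial : ℝ) ≠ 0 := by positivity
    field_simp
    ring

theorem pileRate_nonneg {α j m : ℕ} (hj : j ≤ m) : 0 ≤ pileRate α j m := by
  have h : (0 : ℝ) ≤ (m : ℝ) - j := by
    have : (j : ℝ) ≤ m := by exact_mod_cast hj
    linarith
  have := (Nat.cast_nonneg m : (0 : ℝ) ≤ m)
  have := (Nat.cast_nonneg α : (0 : ℝ) ≤ α)
  unfold pileRate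
  have h1 : 0 ≤ Real.Gamma ((m : ℝ) + 1) := Real.Gamma_nonneg_of_nonneg (by linarith)
  have h2 : 0 ≤ Real.Gamma ((m : ℝ) - j + α) := Real.Gamma_nonneg_of_nonneg (by linarith)
  have h3 : 0 ≤ Real.Gamma ((m : ℝ) - j + 1) := Real.Gamma_nonneg_of_nonneg (by linarith)
  have h4 : 0 ≤ Real.Gamma ((m : ℝ) + α) := Real.Gamma_nonneg_of_nonneg (by linarith)
  positivity

/-- The factor k+1 cancels the 1/j of the rate, and for integer α the Gamma functions are
factorials. -/
theorem succ_mul_pileRate {a k m : ℕ} (hk : k + 1 ≤ m) :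
    ((k : ℝ) + 1) * pileRate (a + 1) (k + 1) m
      = (m.factorial : ℝ) / (m + a).factorial
        * (((m - 1 - k + a).factorial : ℝ) / (m - 1 - k).factorial) := by
  obtain ⟨j, rfl⟩ : ∃ j, m = j + (k + 1) := ⟨m - (k + 1), by omega⟩
  have e : j + (k + 1) - 1 - k = j := by omega
  have h1 : Real.Gamma (((j + (k + 1) : ℕ) : ℝ) - ((k + 1 : ℕ) : ℝ) + ((a + 1 : ℕ) : ℝ))
      = (j + a).factorial := by
    rw [← Real.Gamma_nat_eq_factorial]
    congr 1
    push_cast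
    ring
  have h2 : Real.Gamma (((j + (k + 1) : ℕ) : ℝ) - ((k + 1 : ℕ) : ℝ) + 1) = j.factorial := by
    rw [← Real.Gamma_nat_eq_factorial]
    congr 1
    push_cast
    ring
  have h3 : Real.Gamma (((j + (k + 1) : ℕ) : ℝ) + ((a + 1 : ℕ) : ℝ))
      = (j + (k + 1) + a).factorial := by
    rw [← Real.Gamma_nat_eq_factorial]
    congr 1
    push_cast
    ring
  rw [pileRate, h1, h2, h3, Real.Gamma_nat_eq_factorial, e]
  have h4 : ((j + (k + 1) + a).factorial : ℝ) ≠ 0 := by positivity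
  have h5 : (j.factorial : ℝ) ≠ 0 := by positivity
  have h6 : (k : ℝ) + 1 ≠ 0 := by positivity
  push_cast
  field_simp

/-- Reversing the order of summation, from pile size to the number of particles left behind, gives
the two factorial sums. The first moment is linear in m, which is why the current obeys Fick's law.
-/
theorem hasMoments_pileRate {α : ℕ} (hα : 1 ≤ α) (m : ℕ) :
    HasMoments (fun k => if k + 1 ≤ m then pileRate α (k + 1) m else 0) ((m : ℝ) / α)
      ((m : ℝ) * (m + α) / (α * (α + 1))) := by
  obtain ⟨a, rfl⟩ : ∃ a, α = a + 1 := ⟨α - 1, by omega⟩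
  have h0 : (m.factorial : ℝ) ≠ 0 := by positivity
  have h1 : ((m + a).factorial : ℝ) ≠ 0 := by positivity
  refine ⟨fun k => ?_, ?_, ?_⟩
  · split_ifs with h
    · exact pileRate_nonneg h
    · exact le_rfl
  · have h2 := sum_factorial_ratio a m
    rw [← Finset.sum_range_reflect] at h2
    have h3 : ∑ k ∈ Finset.range m, ((k : ℝ) + 1)
        * (if k + 1 ≤ m then pileRate (a + 1) (k + 1) m else 0)
        = (m.factorial : ℝ) / (m + a).factorial * ∑ k ∈ Finset.range m,
          (((m - 1 - k + a).factorial : ℝ) / (m - 1 - k).factorial) := by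
      rw [Finset.mul_sum]
      refine Finset.sum_congr rfl fun k hk => ?_
      have hk' : k + 1 ≤ m := Finset.mem_range.1 hk
      rw [if_pos hk', succ_mul_pileRate hk']
    have h4 : (m : ℝ) / (a + 1 : ℕ) = ∑ k ∈ Finset.range m, ((k : ℝ) + 1)
        * (if k + 1 ≤ m then pileRate (a + 1) (k + 1) m else 0) := by
      rw [h3, h2]
      push_cast
      field_simp
    rw [h4]
    refine hasSum_sum_of_ne_finset_zero fun k hk => ?_
    rw [if_neg (by rw [Finset.mem_range] at hk; omega), mul_zero]
  · have h2 := sum_mul_factorial_ratio a m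
    rw [← Finset.sum_range_reflect] at h2
    have h3 : ∑ k ∈ Finset.range m, ((k : ℝ) + 1) ^ 2
        * (if k + 1 ≤ m then pileRate (a + 1) (k + 1) m else 0)
        = (m.factorial : ℝ) / (m + a).factorial * ∑ k ∈ Finset.range m,
          ((m : ℝ) - ((m - 1 - k : ℕ) : ℝ))
            * (((m - 1 - k + a).factorial : ℝ) / (m - 1 - k).factorial) := by
      rw [Finset.mul_sum]
      refine Finset.sum_congr rfl fun k hk => ?_
      have hk' : k + 1 ≤ m := Finset.mem_range.1 hk
      rw [if_pos hk', sq, mul_assoc, succ_mul_pileRate hk']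
      have h4 : ((m - 1 - k : ℕ) : ℝ) = m - (k + 1) := by
        rw [show m - 1 - k = m - (k + 1) by omega, Nat.cast_sub hk']
        push_cast
        ring
      rw [h4]
      ring
    have h4 : (m : ℝ) * (m + (a + 1 : ℕ)) / ((a + 1 : ℕ) * ((a + 1 : ℕ) + 1))
        = ∑ k ∈ Finset.range m, ((k : ℝ) + 1) ^ 2
          * (if k + 1 ≤ m then pileRate (a + 1) (k + 1) m else 0) := by
      rw [h3, h2]
      push_cast
      field_simp
      ring
    rw [h4]
    refine hasSum_sum_of_ne_finset_zero fun k hk => ?_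
    rw [if_neg (by rw [Finset.mem_range] at hk; omega), mul_zero]

/-- The entrance rates are those of a logarithmic law: one factor k+1 gives the geometric series,
two give the series of n βⁿ without its zeroth term. -/
theorem hasMoments_geometric {β : ℝ} (hβ : β ∈ Ioo (0 : ℝ) 1) :
    HasMoments (fun k : ℕ => β ^ (k + 1) / ((k : ℝ) + 1)) (β / (1 - β)) (β / (1 - β) ^ 2) := by
  have hn : ‖β‖ < 1 := by rw [Real.norm_of_nonneg hβ.1.le]; exact hβ.2
  refine ⟨fun k => ?_, ?_, ?_⟩
  · have := hβ.1
    positivity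
  · convert! (hasSum_geometric_of_norm_lt_one hn).mul_left β using 1
    ext k
    have : (k : ℝ) + 1 ≠ 0 := by positivity
    field_simp
    ring
  · have h := (hasSum_nat_add_iff' (f := fun n : ℕ => (n : ℝ) * β ^ n) 1).2
      (hasSum_coe_mul_geometric_of_norm_lt_one hn)
    convert! h using 1
    · ext k
      have : (k : ℝ) + 1 ≠ 0 := by positivity
      push_cast
      field_simp
    · simp

section Piles

variable {N α : ℕ} {bm bp : ℝ}

theorem transfer_finite (ρ : ℕ → ℝ) (m y z : ℕ) (f : (Site N → ℕ) → ℝ) (η : Site N → ℕ) :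
    transfer (fun k => if k + 1 ≤ m then ρ (k + 1) else 0) y z f η
      = ∑ k ∈ Finset.Icc 1 m, ρ k * (f (move η y z k) - f η) := by
  unfold transfer
  rw [tsum_eq_sum (s := Finset.range m), ← Finset.Ico_add_one_right_eq_Icc,
    Finset.sum_Ico_eq_sum_range, Nat.add_sub_cancel]
  · refine Finset.sum_congr rfl fun k hk => ?_
    have : k + 1 ≤ m := Finset.mem_range.1 hk
    dsimp only
    rw [if_pos this, add_comm 1 k]
  · intro k hk
    dsimp only
    rw [if_neg (by rw [Finset.mem_range] at hk; omega), zero_mul]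

/-- Rate of the jumps of `k + 1` particles from `x` to `x + 1`. -/
def pileRight (α : ℕ) (bm : ℝ) (x k : ℕ) (η : Site N → ℕ) : ℝ :=
  if x = 0 then bm ^ (k + 1) / ((k : ℝ) + 1)
  else if k + 1 ≤ val η x then pileRate α (k + 1) (val η x) else 0

/-- Rate of the jumps of `k + 1` particles from `x + 1` to `x`. -/
def pileLeft (α : ℕ) (bp : ℝ) (x k : ℕ) (η : Site N → ℕ) : ℝ :=
  if x + 1 = N then bp ^ (k + 1) / ((k : ℝ) + 1)
  else if k + 1 ≤ val η (x + 1) then pileRate α (k + 1) (val η (x + 1)) else 0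

/-- Second moment of the rates of the jumps from `x` in one direction. -/
def pileIntensity (N α : ℕ) (bm bp : ℝ) (x : ℕ) (ξ : Site N → ℝ) : ℝ :=
  (Aff.prof N (α * bm / (1 - bm)) (α * bp / (1 - bp)) x).eval ξ
    * ((Aff.prof N (α * bm / (1 - bm)) (α * bp / (1 - bp)) x).eval ξ + α)
    / if x = 0 ∨ x = N then (α : ℝ) ^ 2 else (α : ℝ) * (α + 1)

theorem pileGen_eq_jumpGen (hN : 2 ≤ N) (f : (Site N → ℕ) → ℝ) (η : Site N → ℕ) :
    pileGen N α bm bp f η = jumpGen (pileRight α bm) (pileLeft α bp) f η := by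
  unfold jumpGen
  rw [sum_range_eq_boundary_add hN, pileGen]
  congr 1
  · congr 1
    · refine Finset.sum_congr rfl fun x hx => ?_
      obtain ⟨h1, h2⟩ := Finset.mem_Icc.1 hx
      simp only [pileRight, pileLeft, if_neg (show x ≠ 0 by omega),
        if_neg (show x + 1 ≠ N by omega)]
      rw [transfer_finite (fun k => pileRate α k (val η x)),
        transfer_finite (fun k => pileRate α k (val η (x + 1)))]
      rfl
    · simp only [pileRight, pileLeft, if_true, zero_add, if_neg (show 1 ≠ N by omega)]
      rw [transfer_finite (fun k => pileRate α k (val η 1)), pileReservoir, add_comm]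
      simp only [transfer, move]
      simp only [addAt_eq_self (Or.inl rfl), subAt_eq_self (Or.inl rfl)]
  · simp only [pileRight, pileLeft, if_neg (show N - 1 ≠ 0 by omega),
      if_pos (show N - 1 + 1 = N by omega)]
    rw [transfer_finite (fun k => pileRate α k (val η (N - 1))), pileReservoir,
      show N - 1 + 1 = N by omega]
    simp only [transfer, move, addAt_eq_self (Or.inr rfl), subAt_eq_self (Or.inr rfl)]

theorem pileIntensity_bulk_bounds {a M A : ℝ} (hA : 1 ≤ A) (ha : 0 ≤ a) (haM : a ≤ M) :
    a / A ≤ 1 + M ∧ a * (a + A) / (A * (A + 1)) ≤ (1 + M) ^ 2 := by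
  have hM : 0 ≤ M := ha.trans haM
  constructor
  · rw [div_le_iff₀ (by linarith)]
    nlinarith
  · rw [div_le_iff₀ (by positivity)]
    have h1 : a + A ≤ A * (1 + M) := by nlinarith
    have h2 : a * (a + A) ≤ (1 + M) * (A * (1 + M)) :=
      mul_le_mul (by linarith) h1 (by linarith) (by linarith)
    have h3 : 0 ≤ A ^ 2 * (1 + M) ^ 2 := by positivity
    linarith

/-- Each rate depends on the departure site only, so the mobility of a bond is a sum of two one-site
intensities. All moments are bounded directly by powers of 1 + mass. -/
theorem pile_isJumpRates (hN : 2 ≤ N) (hα : 1 ≤ α) (hbm : bm ∈ Ioo (0 : ℝ) 1)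
    (hbp : bp ∈ Ioo (0 : ℝ) 1) :
    ∃ B, IsJumpRates (N := N) univ (pileRight α bm) (pileLeft α bp)
      (fick N (1 / α) 1 1 (α * bm / (1 - bm)) (α * bp / (1 - bp)))
      (fun x ξ => pileIntensity N α bm bp x ξ + pileIntensity N α bm bp (x + 1) ξ) B := by
  have hm0 := hbm.1
  have hp0 := hbp.1
  have hm1 : 0 < 1 - bm := sub_pos.2 hbm.2
  have hp1 : 0 < 1 - bp := sub_pos.2 hbp.2
  have hα0 : (0 : ℝ) < α := by exact_mod_cast hα
  have hα1 : (1 : ℝ) ≤ α := by exact_mod_cast hα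
  -- In terms of the reservoir density ρ the second moment of the entrance rates is ρ(ρ+α)/α². The
  -- denominator differs from the bulk one, α(α+1), because the reservoir does not fluctuate.
  have em : (α * bm / (1 - bm)) * (α * bm / (1 - bm) + α) / (α : ℝ) ^ 2 = bm / (1 - bm) ^ 2 := by
    field_simp
    ring
  have ep : (α * bp / (1 - bp)) * (α * bp / (1 - bp) + α) / (α : ℝ) ^ 2 = bp / (1 - bp) ^ 2 := by
    field_simp
    ring
  refine ⟨2 + bm / (1 - bm) + bp / (1 - bp) + bm / (1 - bm) ^ 2 + bp / (1 - bp) ^ 2,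
    by positivity, fun x k η _ h0 hx hxN => ?_, fun x k η _ h0 hxN => ?_, fun x hx η _ => ?_⟩
  · by_contra h
    simp [pileRight, hx.ne', h] at h0
  · by_contra h
    simp [pileLeft, hxN.ne, h] at h0
  have hM := mass_nonneg η
  have hx0 : (0 : ℝ) ≤ (val η x : ℕ) := Nat.cast_nonneg _
  have hx1 : (0 : ℝ) ≤ (val η (x + 1) : ℕ) := Nat.cast_nonneg _
  obtain ⟨a1, a2⟩ := pileIntensity_bulk_bounds hα1 hx0 (val_le_mass η x)
  obtain ⟨b1, b2⟩ := pileIntensity_bulk_bounds hα1 hx1 (val_le_mass η (x + 1))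
  have a3 : (0 : ℝ) ≤ (val η x : ℕ) / (α : ℝ) := by positivity
  have b3 : (0 : ℝ) ≤ (val η (x + 1) : ℕ) / (α : ℝ) := by positivity
  have pm1 : 0 < bm / (1 - bm) := by positivity
  have pp1 : 0 < bp / (1 - bp) := by positivity
  have pm2 : 0 < bm / (1 - bm) ^ 2 := by positivity
  have pp2 : 0 < bp / (1 - bp) ^ 2 := by positivity
  set B := 2 + bm / (1 - bm) + bp / (1 - bp) + bm / (1 - bm) ^ 2 + bp / (1 - bp) ^ 2 with hB
  have hlin : ∀ s, s ≤ B - 1 → 0 ≤ s → s + (1 + mass η) ≤ B * (1 + mass η) := by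
    intro s hs h0
    nlinarith
  have hsq : ∀ s, s ≤ B - 1 → 0 ≤ s → s + (1 + mass η) ^ 2 ≤ B * (1 + mass η) ^ 2 := by
    intro s hs h0
    have : 1 ≤ (1 + mass η) ^ 2 := by nlinarith
    nlinarith
  have hw : ∀ x, bondWeight N 1 1 x = 1 := fun x => by simp [bondWeight]
  by_cases h0 : x = 0
  · subst h0
    have e1 : 1 ≠ N := by omega
    simp only [fick, hw, pileIntensity, Aff.prof_eval, val_toR, pileRight, pileLeft, zero_add,
      if_true, true_or, one_ne_zero, e1, or_self, if_false,
      em] at b1 b2 b3 ⊢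
    refine ⟨_, _, _, _, hasMoments_geometric hbm, hasMoments_pileRate hα _, ?_, rfl, ?_, ?_,
      fun _ => ?_⟩
    · field_simp
    · rw [show 1 / (α : ℝ) * 1 * (α * bm / (1 - bm) - ((val η 1 : ℕ) : ℝ))
        = bm / (1 - bm) - ((val η 1 : ℕ) : ℝ) / α by field_simp]
      have := hlin (bm / (1 - bm)) (by linarith) pm1.le
      rw [abs_le]
      constructor <;> linarith
    · have := hsq (bm / (1 - bm) ^ 2) (by linarith) pm2.le
      linarith
    · have := hlin (bm / (1 - bm)) (by linarith) pm1.le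
      linarith
  by_cases hxN : x + 1 = N
  · have e1 : x ≠ N := by omega
    have hN0 : N ≠ 0 := by omega
    simp only [fick, hw, pileIntensity, Aff.prof_eval, val_toR, pileRight, pileLeft, h0, e1,
      hN0, or_self, or_true, if_false, if_true, hxN, ep]
    refine ⟨_, _, _, _, hasMoments_pileRate hα _, hasMoments_geometric hbp, ?_, rfl, ?_, ?_,
      fun _ => ?_⟩
    · field_simp
    · rw [show 1 / (α : ℝ) * 1 * (((val η x : ℕ) : ℝ) - α * bp / (1 - bp))
        = ((val η x : ℕ) : ℝ) / α - bp / (1 - bp) by field_simp]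
      have := hlin (bp / (1 - bp)) (by linarith) pp1.le
      rw [abs_le]
      constructor <;> linarith
    · have := hsq (bp / (1 - bp) ^ 2) (by linarith) pp2.le
      linarith
    · have := hlin (bp / (1 - bp)) (by linarith) pp1.le
      linarith
  · have e1 : x ≠ N := by omega
    have e2 : x + 1 ≠ 0 := by omega
    simp only [fick, hw, pileIntensity, Aff.prof_eval, val_toR, pileRight, pileLeft, h0,
      e1, e2, hxN, or_self, if_false]
    refine ⟨_, _, _, _, hasMoments_pileRate hα _, hasMoments_pileRate hα _, ?_, rfl, ?_, ?_,
      fun h => h.elim⟩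
    · ring
    · rw [show 1 / (α : ℝ) * 1 * (((val η x : ℕ) : ℝ) - ((val η (x + 1) : ℕ) : ℝ))
        = ((val η x : ℕ) : ℝ) / α - ((val η (x + 1) : ℕ) : ℝ) / α by field_simp]
      have := hlin 0 (by linarith) le_rfl
      rw [abs_le]
      constructor <;> linarith
    · have : 2 * (1 + mass η) ^ 2 ≤ B * (1 + mass η) ^ 2 :=
        mul_le_mul_of_nonneg_right (by linarith) (by positivity)
      linarith

theorem pileIntensity_mem_quadSpan (x : ℕ) : pileIntensity N α bm bp x ∈ quadSpan N := by
  set p := Aff.prof N (α * bm / (1 - bm)) (α * bp / (1 - bp)) x with hp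
  have h : pileIntensity N α bm bp x
      = (if x = 0 ∨ x = N then (α : ℝ) ^ 2 else (α : ℝ) * (α + 1))⁻¹ •
        ((fun ξ => p.eval ξ * p.eval ξ) + (α : ℝ) • fun ξ => p.eval ξ * (Aff.one N).eval ξ) := by
    ext ξ
    simp only [pileIntensity, Pi.add_apply, Pi.smul_apply, smul_eq_mul, Aff.one_eval, ← hp]
    ring
  rw [h]
  exact Submodule.smul_mem _ _ (Submodule.add_mem _ (mul_mem_quadSpan _ _)
    (Submodule.smul_mem _ _ (mul_mem_quadSpan _ _)))

end Piles

theorem pile_closedEquation {N : ℕ} (hN : 2 ≤ N) {Ω : Type*} [mΩ : MeasurableSpace Ω]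
    (P : Measure Ω) [IsProbabilityMeasure P] (ℱ : Filtration ℝ≥0 mΩ) (α : ℕ) (bm bp : ℝ)
    (hα : 1 ≤ α) (hbm : bm ∈ Ioo (0 : ℝ) 1) (hbp : bp ∈ Ioo (0 : ℝ) 1)
    (μ : Measure (Site N → ℕ)) (η : ℝ≥0 → Ω → Site N → ℕ)
    (hμ : ∀ x, MemLp (fun ξ : Site N → ℕ => (ξ x : ℝ)) 2 μ)
    (hη : IsProcess P ℱ (finSupp (Site N → ℕ)) (pileGen N α bm bp) univ μ η) :
    (∀ t x, MemLp (fun ω => (η t ω x : ℝ)) 2 P) ∧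
    ClosedEquation N (triangle N)
      (corr P N (occ η) fun u r => (α : ℝ) / (α + 1) * (u * (u - 1)) - r ^ 2)
      (pileLap2D N α)
      (fun t p => if p.2 = p.1 then
        (N : ℝ) ^ 2 / ((α : ℝ) * (α + 1)) *
          ((density P N (occ η) (α * bm / (1 - bm)) (α * bp / (1 - bp)) t (p.1 + 1)
              - density P N (occ η) (α * bm / (1 - bm)) (α * bp / (1 - bp)) t p.1) ^ 2
            + (density P N (occ η) (α * bm / (1 - bm)) (α * bp / (1 - bp)) t (p.1 - 1)
              - density P N (occ η) (α * bm / (1 - bm)) (α * bp / (1 - bp)) t p.1) ^ 2)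
        else 0) := by
  obtain ⟨B, hB⟩ := pile_isJumpRates (N := N) hN hα hbm hbp
  have hM := hB.isQuadraticModel fun f _ ξ _ => pileGen_eq_jumpGen hN f ξ
  refine ⟨hM.memLp hη hμ, ?_⟩
  have hS := hM.isMomentSystem hN hη hμ
    (fun x _ => Submodule.add_mem _ (pileIntensity_mem_quadSpan x)
      (pileIntensity_mem_quadSpan (x + 1))) (Y := occ η) (fun t ω x => (val_toR _ _).symm)
    (F := fun u r => (α : ℝ) / (α + 1) * (u * (u - 1)) - r ^ 2) (k₁ := (α : ℝ) / (α + 1))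
    (k₂ := -((α : ℝ) / (α + 1))) (k₃ := 0) (fun u ρ => by ring)
  have hr := fun t x => hM.hasMean_prof hη hμ (Y := occ η) (fun t ω x => (val_toR _ _).symm)
    (α * bm / (1 - bm)) (α * bp / (1 - bp)) t x
  refine hS.closedEquation_pileLap2D hα
    (σ := fun t x => ∫ ω, pileIntensity N α bm bp x (toR (η (accel N t) ω)) ∂P)
    (fun t x _ => ?_) (fun t x hx hxN => ?_) (fun t => ?_) (fun t => ?_)
  · exact ((hM.hasMean hη hμ (pileIntensity_mem_quadSpan x) _).add
      (hM.hasMean hη hμ (pileIntensity_mem_quadSpan (x + 1)) _)).eq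
  · have hm := hM.hasMean hη hμ (mul_mem_quadSpan (.prof N (α * bm / (1 - bm))
      (α * bp / (1 - bp)) x) (.prof N (α * bm / (1 - bm)) (α * bp / (1 - bp)) x)) (accel N t)
    have h := ((hm.add ((hr t x).const_mul α)).const_mul ((α : ℝ) * (α + 1))⁻¹).eq
    rw [div_eq_inv_mul, ← h]
    congr 1 with ω
    rw [pileIntensity, if_neg (by omega)]
    ring
  · have e1 : 0 = 0 ∨ 0 = N := Or.inl rfl
    simp [pileIntensity, density, Aff.prof_eval]
  · have e1 : N ≠ 0 := by omega
    simp [pileIntensity, density, Aff.prof_eval, e1]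

/-! ### Diffusions -/

section Diffusion

variable {N : ℕ}

/-- `f` is differentiable with derivative `f'` in the direction `v`. -/
structure HasDirDeriv (v : Site N → ℝ) (f f' : (Site N → ℝ) → ℝ) : Prop where
  diff : Differentiable ℝ f
  eq : ∀ z, fderiv ℝ f z v = f' z

namespace HasDirDeriv

variable {v : Site N → ℝ} {f f' g g' : (Site N → ℝ) → ℝ}

theorem dirDeriv_eq (h : HasDirDeriv v f f') : dirDeriv v f = f' := funext h.eq

theorem const (c : ℝ) : HasDirDeriv v (fun _ => c) fun _ => 0 :=
  ⟨differentiable_const c, fun z => by simp⟩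

theorem add (hf : HasDirDeriv v f f') (hg : HasDirDeriv v g g') :
    HasDirDeriv v (fun z => f z + g z) fun z => f' z + g' z :=
  ⟨hf.diff.add hg.diff, fun z => by
    rw [fderiv_fun_add (hf.diff z) (hg.diff z), add_apply, hf.eq, hg.eq]⟩

theorem mul (hf : HasDirDeriv v f f') (hg : HasDirDeriv v g g') :
    HasDirDeriv v (fun z => f z * g z) fun z => f' z * g z + f z * g' z :=
  ⟨hf.diff.mul hg.diff, fun z => by
    rw [fderiv_fun_mul (hf.diff z) (hg.diff z)]
    simp [hf.eq, hg.eq]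
    ring⟩

theorem comp {T T' : ℝ → ℝ} (hT : ∀ s, HasDerivAt T (T' s) s) (hf : HasDirDeriv v f f') :
    HasDirDeriv v (fun z => T (f z)) fun z => T' (f z) * f' z := by
  have h : ∀ z, HasFDerivAt (fun z => T (f z)) (T' (f z) • fderiv ℝ f z) z := fun z =>
    (hT (f z)).comp_hasFDerivAt z (hf.diff z).hasFDerivAt
  exact ⟨fun z => (h z).differentiableAt, fun z => by rw [(h z).fderiv]; simp [hf.eq]⟩

end HasDirDeriv

/-- The direction `δ_{x+1} - δ_x`. -/
def bondVec (N x : ℕ) : Site N → ℝ := unitVec N (x + 1) - unitVec N x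

theorem Aff.hasDirDeriv (u : Aff N) {x : ℕ} (hx : x < N) :
    HasDirDeriv (bondVec N x) u.eval fun _ => u.grad x := by
  have h : ∀ z, HasFDerivAt u.eval (∑ s : Site N, u.coef s.1 •
      (ContinuousLinearMap.proj s : (Site N → ℝ) →L[ℝ] ℝ)) z := by
    intro z
    refine HasFDerivAt.const_add _ (HasFDerivAt.fun_sum fun s _ => ?_)
    exact (hasFDerivAt_apply s z).const_mul (u.coef s.1)
  refine ⟨fun z => (h z).differentiableAt, fun z => ?_⟩
  rw [(h z).fderiv, Aff.grad, ← u.sum_coef_ite hx.le, ← u.sum_coef_ite (z := x + 1) hx, ← Finset.sum_sub_distrib]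
  simp [bondVec, unitVec, mul_sub]

theorem Aff.contDiff (u : Aff N) : ContDiff ℝ (⊤ : ℕ∞) u.eval := by
  unfold Aff.eval
  fun_prop

/-- Second-order operator with drifts `J x` and diffusivities `σ x` along the bonds. -/
def diffGen (J σ : ℕ → (Site N → ℝ) → ℝ) (f : (Site N → ℝ) → ℝ) (z : Site N → ℝ) : ℝ :=
  ∑ x ∈ Finset.range N, (J x z * dirDeriv (bondVec N x) f z
    + σ x z * dirDeriv (bondVec N x) (dirDeriv (bondVec N x) f) z)

theorem dirDeriv_eventuallyEq {v z : Site N → ℝ} {f g : (Site N → ℝ) → ℝ} (h : f =ᶠ[𝓝 z] g) :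
    dirDeriv v f =ᶠ[𝓝 z] dirDeriv v g :=
  (h.fderiv (𝕜 := ℝ)).mono fun w hw => by simp only [dirDeriv, hw]

theorem diffGen_congr {J σ : ℕ → (Site N → ℝ) → ℝ} {z : Site N → ℝ} {f g : (Site N → ℝ) → ℝ}
    (h : f =ᶠ[𝓝 z] g) : diffGen J σ f z = diffGen J σ g z := by
  unfold diffGen
  refine Finset.sum_congr rfl fun x _ => ?_
  rw [(dirDeriv_eventuallyEq h).eq_of_nhds,
    (dirDeriv_eventuallyEq (dirDeriv_eventuallyEq h)).eq_of_nhds]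

theorem dirDeriv_contDiff {v : Site N → ℝ} {f : (Site N → ℝ) → ℝ} (hf : ContDiff ℝ (⊤ : ℕ∞) f) :
    ContDiff ℝ (⊤ : ℕ∞) (dirDeriv v f) :=
  (hf.fderiv_right (m := (⊤ : ℕ∞)) (by norm_cast)).clm_apply contDiff_const

theorem continuous_diffGen {J σ : ℕ → (Site N → ℝ) → ℝ} (hJ : ∀ x, Continuous (J x))
    (hσ : ∀ x, Continuous (σ x)) {f : (Site N → ℝ) → ℝ} (hf : ContDiff ℝ (⊤ : ℕ∞) f) :
    Continuous (diffGen J σ f) :=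
  continuous_finsetSum _ fun x _ => ((hJ x).mul (dirDeriv_contDiff hf).continuous).add
    ((hσ x).mul (dirDeriv_contDiff (dirDeriv_contDiff hf)).continuous)

/-- Leibniz rule for a truncated quadratic. Only a size function V with constant second derivative
along the bond is used. -/
theorem dirDeriv_prod {x : ℕ} (hx : x < N) (u v : Aff N) {V V' : (Site N → ℝ) → ℝ} {s : ℝ}
    (hV : HasDirDeriv (bondVec N x) V V') (hV' : HasDirDeriv (bondVec N x) V' fun _ => s)
    {T T' T'' : ℝ → ℝ} (hT : ∀ s, HasDerivAt T (T' s) s) (hT' : ∀ s, HasDerivAt T' (T'' s) s)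
    (z : Site N → ℝ) :
    dirDeriv (bondVec N x) (fun z => u.eval z * v.eval z * T (V z)) z
        = (u.eval z * v.grad x + v.eval z * u.grad x) * T (V z)
          + u.eval z * v.eval z * (T' (V z) * V' z) ∧
      dirDeriv (bondVec N x) (dirDeriv (bondVec N x) fun z => u.eval z * v.eval z * T (V z)) z
        = 2 * (u.grad x * v.grad x) * T (V z)
          + 2 * (u.eval z * v.grad x + v.eval z * u.grad x) * (T' (V z) * V' z)
          + u.eval z * v.eval z * (T'' (V z) * V' z ^ 2 + T' (V z) * s) := by
  have hu := u.hasDirDeriv hx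
  have hv := v.hasDirDeriv hx
  have h1 := (hu.mul hv).mul (hV.comp hT)
  rw [h1.dirDeriv_eq]
  have h2 := (((((HasDirDeriv.const (u.grad x)).mul hv).add (hu.mul (.const (v.grad x)))).mul
    (hV.comp hT)).add ((hu.mul hv).mul ((hV.comp hT').mul hV')))
  rw [h2.dirDeriv_eq]
  constructor <;> ring

/-! ### Smooth truncation profiles. -/

/-- A smooth function that is constant on `[2, ∞)`. -/
structure IsProfile (ψ : ℝ → ℝ) (c : ℝ) : Prop where
  smooth : ContDiff ℝ (⊤ : ℕ∞) ψ
  const : ∀ s, 2 ≤ s → ψ s = c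

theorem IsProfile.hasDerivAt {ψ : ℝ → ℝ} {c : ℝ} (h : IsProfile ψ c) (b a s : ℝ) :
    HasDerivAt (fun s => b * ψ (s / a)) (b * (deriv ψ (s / a) / a)) s ∧
      HasDerivAt (fun s => b * (deriv ψ (s / a) / a)) (b * (deriv (deriv ψ) (s / a) / a / a)) s := by
  have hc1 : ContDiff ℝ (⊤ : ℕ∞) (deriv ψ) :=
    ((contDiff_infty_iff_deriv (f := ψ)).1 h.smooth).2
  have ha : HasDerivAt (fun s : ℝ => s / a) (1 / a) s := (hasDerivAt_id s).div_const a
  have h1 : HasDerivAt ψ (deriv ψ (s / a)) (s / a) :=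
    (h.smooth.differentiable (by simp) _).hasDerivAt
  have h2 : HasDerivAt (deriv ψ) (deriv (deriv ψ) (s / a)) (s / a) :=
    (hc1.differentiable (by simp) _).hasDerivAt
  have h3 : HasDerivAt (fun s => ψ (s / a)) (deriv ψ (s / a) * (1 / a)) s := h1.comp s ha
  have h4 : HasDerivAt (fun s => deriv ψ (s / a)) (deriv (deriv ψ) (s / a) * (1 / a)) s :=
    HasDerivAt.comp (h₂ := deriv ψ) s h2 ha
  exact ⟨(h3.const_mul b).congr_deriv (by ring),
    ((h4.div_const a).const_mul b).congr_deriv (by ring)⟩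

theorem isProfile_cutoff : IsProfile (fun s => Real.smoothTransition (2 - s)) 0 :=
  ⟨Real.smoothTransition.contDiff.comp (contDiff_const.sub contDiff_id),
    fun s hs => Real.smoothTransition.zero_of_nonpos (by linarith)⟩

/-- A smooth version of `min s 2`. -/
def softMin (s : ℝ) : ℝ := 2 + (s - 2) * Real.smoothTransition (2 - s)

theorem isProfile_softMin : IsProfile softMin 2 :=
  ⟨contDiff_const.add ((contDiff_id.sub contDiff_const).mul isProfile_cutoff.smooth),
    fun s hs => by rw [softMin, Real.smoothTransition.zero_of_nonpos (by linarith)]; simp⟩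

theorem softMin_of_le {s : ℝ} (hs : s ≤ 1) : softMin s = s := by
  rw [softMin, Real.smoothTransition.one_of_one_le (by linarith)]
  ring

theorem le_softMin {s : ℝ} (hs : s ≤ 2) : s ≤ softMin s := by
  have h1 := Real.smoothTransition.le_one (2 - s)
  unfold softMin
  nlinarith

theorem softMin_le {s : ℝ} (hs : 0 ≤ s) : softMin s ≤ 2 * s ∧ softMin s ≤ 2 ∧ 0 ≤ softMin s := by
  have h0 := Real.smoothTransition.nonneg (2 - s)
  have h1 := Real.smoothTransition.le_one (2 - s)
  rcases le_or_gt s 2 with h2 | h2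
  · have h3 : softMin s ≤ 2 := by unfold softMin; nlinarith
    refine ⟨?_, h3, hs.trans (le_softMin h2)⟩
    rcases le_or_gt s 1 with h4 | h4
    · rw [softMin_of_le h4]; linarith
    · linarith
  · rw [isProfile_softMin.const s h2.le]
    exact ⟨by linarith, le_rfl, zero_le_two⟩

/-- The derivatives vanish beyond 2, and on [0, 2] softMin s dominates s. Bounding them by softMin
rather than by a constant is what later closes the Lyapunov inequality. -/
theorem IsProfile.exists_bound {ψ : ℝ → ℝ} {c : ℝ} (h : IsProfile ψ c) :
    ∃ C, 0 < C ∧ ∀ s, 0 ≤ s → |ψ s| ≤ C ∧ |deriv ψ s| * s ≤ C * softMin s ∧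
      |deriv (deriv ψ) s| * s ^ 2 ≤ C * softMin s := by
  have h0 : ∀ s, 2 < s → deriv ψ s = 0 := fun s hs => by
    have : ψ =ᶠ[𝓝 s] fun _ => c := by
      filter_upwards [lt_mem_nhds hs] with t ht using h.const t ht.le
    rw [this.deriv_eq, deriv_const]
  have h1 : ∀ s, 2 < s → deriv (deriv ψ) s = 0 := fun s hs => by
    have : deriv ψ =ᶠ[𝓝 s] fun _ => 0 := by
      filter_upwards [lt_mem_nhds hs] with t ht using h0 t ht
    rw [this.deriv_eq, deriv_const]
  have hc1 : ContDiff ℝ (⊤ : ℕ∞) (deriv ψ) :=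
    ((contDiff_infty_iff_deriv (f := ψ)).1 h.smooth).2
  have hc2 : ContDiff ℝ (⊤ : ℕ∞) (deriv (deriv ψ)) :=
    ((contDiff_infty_iff_deriv (f := deriv ψ)).1 hc1).2
  obtain ⟨C₀, hC₀⟩ := isCompact_Icc.exists_bound_of_continuousOn
    (h.smooth.continuous.continuousOn (s := Icc (0 : ℝ) 2))
  obtain ⟨C₁, hC₁⟩ := isCompact_Icc.exists_bound_of_continuousOn
    (hc1.continuous.continuousOn (s := Icc (0 : ℝ) 2))
  obtain ⟨C₂, hC₂⟩ := isCompact_Icc.exists_bound_of_continuousOn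
    (hc2.continuous.continuousOn (s := Icc (0 : ℝ) 2))
  refine ⟨1 + |C₀| + |C₁| + 2 * |C₂| + |c|, by positivity, fun s hs => ?_⟩
  have p0 := abs_nonneg C₀
  have p1 := abs_nonneg C₁
  have p2 := abs_nonneg C₂
  have p3 := abs_nonneg c
  have hm := (softMin_le hs).2.2
  rcases le_or_gt s 2 with h2 | h2
  · have e0 := (hC₀ s ⟨hs, h2⟩).trans (le_abs_self _)
    have e1 := (hC₁ s ⟨hs, h2⟩).trans (le_abs_self _)
    have e2 := (hC₂ s ⟨hs, h2⟩).trans (le_abs_self _)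
    rw [Real.norm_eq_abs] at e0 e1 e2
    have hle := le_softMin h2
    refine ⟨by linarith, ?_, ?_⟩
    · exact mul_le_mul (by linarith) hle hs (by positivity)
    · calc |deriv (deriv ψ) s| * s ^ 2 = |deriv (deriv ψ) s| * s * s := by ring
        _ ≤ |C₂| * 2 * softMin s := by gcongr
        _ ≤ _ := by gcongr; linarith
  · rw [h0 s h2, h1 s h2, h.const s h2.le, abs_zero, zero_mul, zero_mul]
    exact ⟨by linarith, by positivity, by positivity⟩

end Diffusion

/-! ### Diffusions with quadratically growing diffusivity. -/

section DiffusionModel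

variable {N : ℕ}

/-- The size of a configuration. -/
def sqSize (z : Site N → ℝ) : ℝ := 1 + ∑ x, z x ^ 2

/-- Derivative of `sqSize` in the direction of the bond `{x, x + 1}`. -/
def sqGrad (x : ℕ) (z : Site N → ℝ) : ℝ := ∑ y, 2 * bondVec N x y * z y

/-- Second derivative of `sqSize` in the direction of the bond `{x, x + 1}`. -/
def sqHess (N x : ℕ) : ℝ := ∑ y, 2 * bondVec N x y ^ 2

theorem contDiff_sqSize : ContDiff ℝ (⊤ : ℕ∞) (sqSize (N := N)) := by
  unfold sqSize
  fun_prop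

theorem one_le_sqSize (z : Site N → ℝ) : 1 ≤ sqSize z :=
  le_add_of_nonneg_right (Finset.sum_nonneg fun _ _ => sq_nonneg _)

theorem sqSize_nonneg (z : Site N → ℝ) : 0 ≤ sqSize z := zero_le_one.trans (one_le_sqSize z)

theorem sq_le_sqSize (z : Site N → ℝ) (x : Site N) : z x ^ 2 ≤ sqSize z := by
  have := Finset.single_le_sum (f := fun x => z x ^ 2) (fun x _ => sq_nonneg _)
    (Finset.mem_univ x)
  unfold sqSize
  linarith

theorem hasDirDeriv_sqSize (x : ℕ) :
    HasDirDeriv (bondVec N x) (sqSize (N := N)) (sqGrad (N := N) x) := by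
  have h : ∀ z, HasFDerivAt (sqSize (N := N)) (∑ y : Site N, (2 * z y) •
      (ContinuousLinearMap.proj y : (Site N → ℝ) →L[ℝ] ℝ)) z := by
    intro z
    refine HasFDerivAt.const_add _ (HasFDerivAt.fun_sum fun y _ => ?_)
    have := (hasFDerivAt_apply (𝕜 := ℝ) y z).pow 2
    simpa using this
  refine ⟨fun z => (h z).differentiableAt, fun z => ?_⟩
  rw [(h z).fderiv, sqGrad]
  simp [mul_right_comm]

theorem hasDirDeriv_sqGrad (x : ℕ) :
    HasDirDeriv (bondVec N x) (sqGrad (N := N) x) fun _ => sqHess N x := by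
  have h : ∀ z, HasFDerivAt (sqGrad (N := N) x) (∑ y : Site N, (2 * bondVec N x y) •
      (ContinuousLinearMap.proj y : (Site N → ℝ) →L[ℝ] ℝ)) z := fun z =>
    HasFDerivAt.fun_sum fun y _ => (hasFDerivAt_apply (𝕜 := ℝ) y z).const_mul _
  refine ⟨fun z => (h z).differentiableAt, fun z => ?_⟩
  rw [(h z).fderiv, sqHess]
  simp [mul_assoc, sq]

theorem abs_bondVec_le (x : ℕ) (y : Site N) : |bondVec N x y| ≤ 1 := by
  simp only [bondVec, unitVec, Pi.sub_apply]
  split_ifs <;> norm_num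

theorem abs_sqGrad_le (x : ℕ) (z : Site N → ℝ) :
    |sqGrad x z| ≤ 2 * Fintype.card (Site N) * √(sqSize z) := by
  refine (Finset.abs_sum_le_sum_abs _ _).trans ((Finset.sum_le_sum (g := fun _ =>
    2 * 1 * √(sqSize z)) fun y _ => ?_).trans_eq ?_)
  · rw [abs_mul, abs_mul, abs_two]
    gcongr
    · exact abs_bondVec_le x y
    · exact Real.abs_le_sqrt (sq_le_sqSize z y)
  · rw [Finset.sum_const, Finset.card_univ, nsmul_eq_mul]
    ring

theorem abs_sqHess_le (x : ℕ) : |sqHess N x| ≤ 2 * Fintype.card (Site N) := by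
  refine (Finset.abs_sum_le_sum_abs _ _).trans ((Finset.sum_le_sum (g := fun _ =>
    2 * (1 : ℝ) ^ 2) fun y _ => ?_).trans_eq ?_)
  · rw [abs_mul, abs_pow, abs_two]
    gcongr
    exact abs_bondVec_le x y
  · rw [Finset.sum_const, Finset.card_univ, nsmul_eq_mul]
    ring

/-- A diffusion on `K` with drifts of linear growth and diffusivities of quadratic growth along the
bonds. -/
structure IsDiffusion (L : ((Site N → ℝ) → ℝ) → (Site N → ℝ) → ℝ) (K : Set (Site N → ℝ))
    (J σ : ℕ → (Site N → ℝ) → ℝ) (B : ℝ) : Prop where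
  gen : ∀ f, L f = diffGen J σ f
  cont_J : ∀ x, Continuous (J x)
  cont_σ : ∀ x, Continuous (σ x)
  card_le : 2 * Fintype.card (Site N) ≤ B
  le_J : ∀ z ∈ K, ∀ x, |J x z| ≤ B * √(sqSize z)
  le_σ : ∀ z ∈ K, ∀ x, |σ x z| ≤ B * sqSize z

namespace IsDiffusion

variable {L : ((Site N → ℝ) → ℝ) → (Site N → ℝ) → ℝ} {K : Set (Site N → ℝ)}
  {J σ : ℕ → (Site N → ℝ) → ℝ} {B : ℝ}

theorem nonneg (h : IsDiffusion L K J σ B) : 0 ≤ B :=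
  le_trans (by positivity) h.card_le

theorem abs_sqGrad_le (h : IsDiffusion L K J σ B) (x : ℕ) (z : Site N → ℝ) :
    |sqGrad x z| ≤ B * √(sqSize z) :=
  (TwoPoint.abs_sqGrad_le x z).trans (by gcongr; exact h.card_le)

theorem abs_sqHess_le (h : IsDiffusion L K J σ B) (x : ℕ) : |sqHess N x| ≤ B :=
  (TwoPoint.abs_sqHess_le x).trans h.card_le

theorem mem_smoothCompact {f : (Site N → ℝ) → ℝ}
    (hf : ContDiff ℝ (⊤ : ℕ∞) f) {ψ : ℝ → ℝ} (hψ : IsProfile ψ 0) {a : ℝ} (ha : 0 < a) :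
    (fun z => f z * ψ (sqSize z / a)) ∈ smoothCompact N := by
  refine ⟨hf.mul (hψ.smooth.comp (contDiff_sqSize.div_const a)), ?_⟩
  refine HasCompactSupport.intro (isCompact_closedBall (0 : Site N → ℝ) √(2 * a)) fun z hz => ?_
  have : 2 * a < sqSize z := not_le.1 fun h' => hz <| by
    rw [mem_closedBall_zero_iff, pi_norm_le_iff_of_nonneg (Real.sqrt_nonneg _)]
    exact fun x => Real.abs_le_sqrt ((sq_le_sqSize z x).trans h')
  rw [hψ.const _ ((le_div_iff₀ ha).2 this.le), mul_zero]

/-- The untruncated action times the truncation, plus terms with T' or T''. Agreement near z is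
enough, which also covers the case where the truncation is locally inactive. -/
theorem gen_eq (h : IsDiffusion L K J σ B) {f : (Site N → ℝ) → ℝ} {z : Site N → ℝ}
    (u v : Aff N) {T T' T'' : ℝ → ℝ}
    (hT : ∀ s, HasDerivAt T (T' s) s) (hT' : ∀ s, HasDerivAt T' (T'' s) s)
    (hf : f =ᶠ[𝓝 z] fun z => u.eval z * v.eval z * T (sqSize z)) :
    L f z = quadGen J (fun x ξ => 2 * σ x ξ) u v z * T (sqSize z)
      + ∑ x ∈ Finset.range N, (u.eval z * v.eval z * (J x z * sqGrad x z * T' (sqSize z)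
          + σ x z * sqGrad x z ^ 2 * T'' (sqSize z) + σ x z * sqHess N x * T' (sqSize z))
        + 2 * (u.eval z * v.grad x + v.eval z * u.grad x) * (σ x z * sqGrad x z * T' (sqSize z))) := by
  rw [h.gen f, diffGen_congr hf, diffGen, quadGen, Finset.sum_mul, ← Finset.sum_add_distrib]
  refine Finset.sum_congr rfl fun x hx => ?_
  have hx := Finset.mem_range.1 hx
  obtain ⟨h1, h2⟩ := dirDeriv_prod hx u v (hasDirDeriv_sqSize x) (hasDirDeriv_sqGrad x) hT hT' z
  rw [h1, h2]
  ring

/-- Here t₁ and t₂ stand for T' and T'' at the size V of z. As they are of orders 1/V and 1/V², they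
offset the quadratic growth of the coefficients. -/
theorem abs_terms_le (h : IsDiffusion L K J σ B) {z : Site N → ℝ} (hz : z ∈ K) (x : ℕ)
    {t₁ t₂ M : ℝ} (h1 : |t₁| * sqSize z ≤ M) (h2 : |t₂| * sqSize z ^ 2 ≤ M) :
    |J x z * sqGrad x z * t₁ + σ x z * sqGrad x z ^ 2 * t₂ + σ x z * sqHess N x * t₁| ≤ (2 * B ^ 2 + B ^ 3) * M ∧
      |σ x z * sqGrad x z * t₁| ≤ B ^ 2 * M * √(sqSize z) := by
  have hB := h.nonneg
  have hV : √(sqSize z) ^ 2 = sqSize z := Real.sq_sqrt (sqSize_nonneg z)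
  have hV0 := sqSize_nonneg z
  have e1 : |J x z * sqGrad x z * t₁| ≤ B ^ 2 * M := by
    rw [abs_mul, abs_mul]
    calc _ ≤ B * √(sqSize z) * (B * √(sqSize z)) * |t₁| := by
          gcongr
          · exact h.le_J z hz x
          · exact h.abs_sqGrad_le x z
      _ = B ^ 2 * (|t₁| * √(sqSize z) ^ 2) := by ring
      _ ≤ _ := by rw [hV]; gcongr
  have e2 : |σ x z * sqGrad x z ^ 2 * t₂| ≤ B ^ 3 * M := by
    rw [abs_mul, abs_mul, abs_pow]
    calc _ ≤ B * sqSize z * (B * √(sqSize z)) ^ 2 * |t₂| := by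
          gcongr
          · exact h.le_σ z hz x
          · exact h.abs_sqGrad_le x z
      _ = B ^ 3 * (|t₂| * (sqSize z * √(sqSize z) ^ 2)) := by ring
      _ ≤ _ := by rw [hV, ← sq]; gcongr
  have e3 : |σ x z * sqHess N x * t₁| ≤ B ^ 2 * M := by
    rw [abs_mul, abs_mul]
    calc _ ≤ B * sqSize z * B * |t₁| := by
          gcongr
          · exact h.le_σ z hz x
          · exact h.abs_sqHess_le x
      _ = B ^ 2 * (|t₁| * sqSize z) := by ring
      _ ≤ _ := by gcongr
  refine ⟨?_, ?_⟩
  · refine ((abs_add_le _ _).trans (add_le_add_left (abs_add_le _ _) _)).trans ?_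
    linarith
  · rw [abs_mul, abs_mul]
    calc _ ≤ B * sqSize z * (B * √(sqSize z)) * |t₁| := by
          gcongr
          · exact h.le_σ z hz x
          · exact h.abs_sqGrad_le x z
      _ = B ^ 2 * (|t₁| * sqSize z) * √(sqSize z) := by ring
      _ ≤ _ := by gcongr

/-- Scaled profiles have first and second derivatives of orders `1 / V` and `1 / V²`. -/
theorem profile_bound {ψ : ℝ → ℝ} {C : ℝ}
    (hC : ∀ s, 0 ≤ s → |ψ s| ≤ C ∧ |deriv ψ s| * s ≤ C * softMin s ∧
      |deriv (deriv ψ) s| * s ^ 2 ≤ C * softMin s) {a b s : ℝ} (ha : 0 < a) (hb : 0 ≤ b)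
    (hs : 0 ≤ s) :
    |b * (deriv ψ (s / a) / a)| * s ≤ b * (C * softMin (s / a)) ∧
      |b * (deriv (deriv ψ) (s / a) / a / a)| * s ^ 2 ≤ b * (C * softMin (s / a)) := by
  obtain ⟨-, h1, h2⟩ := hC (s / a) (by positivity)
  constructor
  · rw [abs_mul, abs_div, abs_of_nonneg hb, abs_of_pos ha]
    calc _ = b * (|deriv ψ (s / a)| * (s / a)) := by ring
      _ ≤ _ := by gcongr
  · rw [abs_mul, abs_div, abs_div, abs_of_nonneg hb, abs_of_pos ha]
    calc _ = b * (|deriv (deriv ψ) (s / a)| * (s / a) ^ 2) := by ring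
      _ ≤ _ := by gcongr

theorem continuous_gen (h : IsDiffusion L K J σ B) {f : (Site N → ℝ) → ℝ}
    (hf : f ∈ smoothCompact N) : Continuous (L f) := by
  rw [h.gen f]
  exact continuous_diffGen h.cont_J h.cont_σ hf.1

theorem eventually_div_natCast_lt_one {x : ℝ} : ∀ᶠ n : ℕ in atTop, x / (n + 1) < 1 := by
  filter_upwards [eventually_gt_atTop ⌈|x|⌉₊] with n hn
  rw [div_lt_one (by positivity)]
  have h1 := Nat.le_ceil |x|
  have h2 : (⌈|x|⌉₊ : ℝ) < n := by exact_mod_cast hn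
  linarith [le_abs_self x]

/-- The truncation is (n+1) softMin(V/(n+1)), with plateau value 2(n+1). Taking u = v = 1 leaves
only the derivative terms, which `profile_bound` controls by the truncation itself. -/
theorem isLyapunov (h : IsDiffusion L K J σ B) :
    ∃ W a A C, IsLyapunov (smoothCompact N) L K sqSize W a A C := by
  obtain ⟨C, hC0, hC⟩ := isProfile_softMin.exists_bound
  have hB := h.nonneg
  let a : ℕ → ℝ := fun n => 2 * (n + 1)
  let F : ℕ → (Site N → ℝ) → ℝ := fun n z =>
    (n + 1) * (softMin (sqSize z / (n + 1)) - 2)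
  have hp : IsProfile (fun s => softMin s - 2) 0 :=
    ⟨isProfile_softMin.smooth.sub contDiff_const, fun s hs => by
      rw [isProfile_softMin.const s hs, sub_self]⟩
  have hF : ∀ n, F n ∈ smoothCompact N := fun n =>
    mem_smoothCompact (f := fun _ => (n + 1 : ℝ)) contDiff_const hp (by positivity)
  have hW : ∀ n, (fun z => (a n + F n z) - a n) = F n := fun n => funext fun z =>
    add_sub_cancel_left _ _
  have hWK : ∀ n, ∀ z ∈ K, a n + F n z = (n + 1) * softMin (sqSize z / (n + 1)) := fun n z hz => by
    simp only [a, F]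
    ring
  have hV0 := sqSize_nonneg (N := N)
  have hs : ∀ n : ℕ, ∀ z, 0 ≤ sqSize z / (n + 1) := fun n z => div_nonneg (hV0 z) (by positivity)
  have hgen : ∀ n, ∀ z ∈ K, |L (F n) z|
      ≤ (N * ((2 * B ^ 2 + B ^ 3) * C) + 1) * (a n + F n z) := by
    intro n z hz
    have hn : (0 : ℝ) < n + 1 := by positivity
    have hd := fun s => isProfile_softMin.hasDerivAt (n + 1) (n + 1) s
    have hb := profile_bound hC hn hn.le (hV0 z)
    have hloc : F n =ᶠ[𝓝 z] fun z => (Aff.one N).eval z * (Aff.one N).eval z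
        * ((n + 1) * softMin (sqSize z / (n + 1)) - a n) := by
      refine Eventually.of_forall fun w => ?_
      simp only [F, a, Aff.one_eval]
      ring
    rw [h.gen_eq (Aff.one N) (Aff.one N) (fun s => (hd s).1.sub_const (a n)) (fun s => (hd s).2)
      hloc, hWK n z hz]
    simp only [quadGen, Aff.one_eval, Aff.one_grad, mul_zero, add_zero, zero_mul,
      Finset.sum_const_zero, zero_add, one_mul]
    refine (Finset.abs_sum_le_sum_abs _ _).trans ((Finset.sum_le_sum fun x hx =>
      (h.abs_terms_le hz x hb.1 hb.2).1).trans ?_)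
    have := (softMin_le (hs n z)).2.2
    have h2 : 0 ≤ (n + 1) * softMin (sqSize z / (n + 1)) := by positivity
    rw [Finset.sum_const, Finset.card_range, nsmul_eq_mul]
    linarith
  have hle : ∀ n, ∀ z ∈ K, 0 ≤ a n + F n z ∧ a n + F n z ≤ a n ∧ a n + F n z ≤ 2 * sqSize z := by
    intro n z hz
    have hn : (0 : ℝ) < n + 1 := by positivity
    obtain ⟨h1, h2, h3⟩ := softMin_le (hs n z)
    rw [hWK n z hz]
    refine ⟨by positivity, ?_, ?_⟩
    · simp only [a]
      nlinarith
    · calc _ ≤ (n + 1) * (2 * (sqSize z / (n + 1))) := by gcongr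
        _ = _ := by field_simp
  refine ⟨fun n z => a n + F n z, a, 2, N * ((2 * B ^ 2 + B ^ 3) * C) + 1, by positivity,
    fun n => by rw [hW]; exact hF n,
    fun n => (continuous_const.add (hF n).1.continuous).measurable,
    fun n => by rw [hW]; exact (h.continuous_gen (hF n)).measurable,
    fun n => ⟨a n, fun z hz => abs_le.2 ⟨?_, (hle n z hz).2.1⟩⟩,
    fun n => ⟨(N * ((2 * B ^ 2 + B ^ 3) * C) + 1) * a n, fun z hz => ?_⟩,
    fun n z hz => ?_, fun n z hz => (hle n z hz).1, fun n z hz => (hle n z hz).2.2,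
    fun z hz => ?_⟩
  · have : 0 ≤ a n := by positivity
    linarith [(hle n z hz).1]
  · rw [hW]
    exact (hgen n z hz).trans (by gcongr; exact (hle n z hz).2.1)
  · rw [hW]
    exact (le_abs_self _).trans (hgen n z hz)
  · refine tendsto_const_nhds.congr' ?_
    filter_upwards [eventually_div_natCast_lt_one (x := sqSize z)] with n hn
    rw [hWK n z hz, softMin_of_le hn.le]
    field_simp

/-- The quadratic functional is multiplied by a smooth cutoff in V/(n+1). Near any fixed point the
cutoff is eventually 1, so pointwise convergence is trivial and only the domination by V requires
estimates. -/
theorem isApproximable (h : IsDiffusion L K J σ B) (u v : Aff N) :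
    IsApproximable (smoothCompact N) L K sqSize (fun z => u.eval z * v.eval z)
      (fun z => quadGen J (fun x ξ => 2 * σ x ξ) u v z) := by
  obtain ⟨C, hC0, hC⟩ := isProfile_cutoff.exists_bound
  have hB := h.nonneg
  obtain ⟨A, hA, hAe, hAg⟩ : ∃ A, 0 < A ∧
      (∀ z ∈ K, |u.eval z| ≤ A * √(sqSize z) ∧ |v.eval z| ≤ A * √(sqSize z)) ∧
      ∀ x < N, |u.grad x| ≤ A ∧ |v.grad x| ≤ A := by
    obtain ⟨A₁, h1, h1e, h1g⟩ := u.exists_bound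
    obtain ⟨A₂, h2, h2e, h2g⟩ := v.exists_bound
    have hc : (0 : ℝ) ≤ Fintype.card (Site N) := Nat.cast_nonneg _
    have hK : ∀ z ∈ K, 1 + ∑ x, |z x| ≤ (1 + Fintype.card (Site N)) * √(sqSize z) := by
      intro z hz
      have e1 : 1 ≤ √(sqSize z) := Real.one_le_sqrt.2 (one_le_sqSize z)
      have e2 : ∑ x, |z x| ≤ ∑ _x : Site N, √(sqSize z) :=
        Finset.sum_le_sum fun x _ => Real.abs_le_sqrt (sq_le_sqSize z x)
      rw [Finset.sum_const, Finset.card_univ, nsmul_eq_mul] at e2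
      linarith
    refine ⟨(A₁ + A₂) * (1 + Fintype.card (Site N)), by positivity, fun z hz => ?_, fun x hx => ?_⟩
    · have := hK z hz
      constructor
      · refine (h1e z).trans ?_
        rw [mul_assoc]
        gcongr
        linarith
      · refine (h2e z).trans ?_
        rw [mul_assoc]
        gcongr
        linarith
    · have e1 := h1g x (x + 1) hx.le hx
      have e2 := h2g x (x + 1) hx.le hx
      constructor
      · exact e1.trans (by nlinarith)
      · exact e2.trans (by nlinarith)
  let ψ : ℝ → ℝ := fun s => Real.smoothTransition (2 - s)
  let F : ℕ → (Site N → ℝ) → ℝ := fun n z => u.eval z * v.eval z * ψ (sqSize z / (n + 1))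
  have hF : ∀ n, F n ∈ smoothCompact N := fun n =>
    mem_smoothCompact (u.contDiff.mul v.contDiff) isProfile_cutoff (by positivity)
  have hV0 := sqSize_nonneg (N := N)
  have hs : ∀ n : ℕ, ∀ z, 0 ≤ sqSize z / (n + 1) := fun n z => div_nonneg (hV0 z) (by positivity)
  have huv : ∀ z ∈ K, |u.eval z * v.eval z| ≤ A ^ 2 * sqSize z := by
    intro z hz
    rw [abs_mul]
    calc _ ≤ A * √(sqSize z) * (A * √(sqSize z)) := by
          gcongr
          · exact (hAe z hz).1
          · exact (hAe z hz).2
      _ = A ^ 2 * √(sqSize z) ^ 2 := by ring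
      _ = _ := by rw [Real.sq_sqrt (hV0 z)]
  have hg : ∀ z ∈ K, ∀ x < N, |u.eval z * v.grad x + v.eval z * u.grad x|
      ≤ 2 * A ^ 2 * √(sqSize z) := by
    intro z hz x hx
    refine (abs_add_le _ _).trans ?_
    rw [abs_mul, abs_mul]
    calc _ ≤ A * √(sqSize z) * A + A * √(sqSize z) * A := by
          gcongr
          · exact (hAe z hz).1
          · exact (hAg x hx).2
          · exact (hAe z hz).2
          · exact (hAg x hx).1
      _ = _ := by ring
  have hquad : ∀ z ∈ K, |quadGen J (fun x ξ => 2 * σ x ξ) u v z| ≤ N * (4 * A ^ 2 * B) * sqSize z := by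
    intro z hz
    refine (Finset.abs_sum_le_sum_abs _ _).trans ((Finset.sum_le_sum (g := fun _ =>
      4 * A ^ 2 * B * sqSize z) fun x hx => ?_).trans_eq ?_)
    · have hx := Finset.mem_range.1 hx
      refine (abs_add_le _ _).trans ?_
      rw [abs_mul _ (J x z), abs_mul _ (2 * σ x z), abs_mul (u.grad x), abs_mul 2 (σ x z)]
      calc _ ≤ 2 * A ^ 2 * √(sqSize z) * (B * √(sqSize z)) + A * A * (2 * (B * sqSize z)) := by
            rw [abs_two]
            gcongr
            · exact hg z hz x hx
            · exact h.le_J z hz x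
            · exact (hAg x hx).1
            · exact (hAg x hx).2
            · exact h.le_σ z hz x
        _ = 2 * A ^ 2 * B * √(sqSize z) ^ 2 + 2 * A ^ 2 * B * sqSize z := by ring
        _ = _ := by rw [Real.sq_sqrt (hV0 z)]; ring
    · rw [Finset.sum_const, Finset.card_range, nsmul_eq_mul]
      ring
  have hgen : ∀ n, ∀ z ∈ K, |L (F n) z| ≤ (N * (4 * A ^ 2 * B) * C
      + N * (A ^ 2 * ((2 * B ^ 2 + B ^ 3) * (C * 2)) + 4 * A ^ 2 * (B ^ 2 * (C * 2)))) * sqSize z := by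
    intro n z hz
    have hn : (0 : ℝ) < n + 1 := by positivity
    have hd := fun s => isProfile_cutoff.hasDerivAt 1 (n + 1) s
    have hb := profile_bound hC hn zero_le_one (hV0 z)
    have hsm := (softMin_le (hs n z)).2.1
    have hb' : 1 * (C * softMin (sqSize z / (n + 1))) ≤ C * 2 := by
      rw [one_mul]
      gcongr
    have hloc : F n =ᶠ[𝓝 z] fun z => u.eval z * v.eval z * (1 * ψ (sqSize z / (n + 1))) := by
      refine Eventually.of_forall fun w => ?_
      simp only [F, one_mul]
    rw [h.gen_eq u v (fun s => (hd s).1) (fun s => (hd s).2) hloc, add_mul]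
    refine (abs_add_le _ _).trans (add_le_add ?_ ?_)
    · rw [abs_mul, one_mul]
      have := hV0 z
      calc _ ≤ N * (4 * A ^ 2 * B) * sqSize z * C := by
            gcongr
            · exact hquad z hz
            · exact (hC _ (hs n z)).1
        _ = _ := by ring
    · refine (Finset.abs_sum_le_sum_abs _ _).trans ((Finset.sum_le_sum (g := fun _ =>
        (A ^ 2 * ((2 * B ^ 2 + B ^ 3) * (C * 2)) + 4 * A ^ 2 * (B ^ 2 * (C * 2))) * sqSize z)
        fun x hx => ?_).trans_eq ?_)
      · have hx := Finset.mem_range.1 hx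
        obtain ⟨e1, e2⟩ := h.abs_terms_le hz x (hb.1.trans hb') (hb.2.trans hb')
        refine (abs_add_le _ _).trans ?_
        rw [abs_mul (u.eval z * v.eval z), abs_mul (2 * _), abs_mul 2, abs_two]
        have := hV0 z
        calc _ ≤ A ^ 2 * sqSize z * ((2 * B ^ 2 + B ^ 3) * (C * 2))
              + 2 * (2 * A ^ 2 * √(sqSize z)) * (B ^ 2 * (C * 2) * √(sqSize z)) := by
              gcongr
              · exact huv z hz
              · exact hg z hz x hx
          _ = A ^ 2 * sqSize z * ((2 * B ^ 2 + B ^ 3) * (C * 2))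
              + 4 * A ^ 2 * (B ^ 2 * (C * 2)) * √(sqSize z) ^ 2 := by ring
          _ = _ := by rw [Real.sq_sqrt (hV0 z)]; ring
      · rw [Finset.sum_const, Finset.card_range, nsmul_eq_mul]
        ring
  set M := N * (4 * A ^ 2 * B) * C
      + N * (A ^ 2 * ((2 * B ^ 2 + B ^ 3) * (C * 2)) + 4 * A ^ 2 * (B ^ 2 * (C * 2))) with hM
  have hM0 : 0 ≤ M := by positivity
  have hlim : ∀ z ∈ K, ∀ᶠ n : ℕ in atTop, F n =ᶠ[𝓝 z] fun z => u.eval z * v.eval z * 1 := by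
    intro z hz
    filter_upwards [eventually_div_natCast_lt_one (x := sqSize z)] with n hn
    have hc : Continuous fun w : Site N → ℝ => sqSize w / ((n : ℝ) + 1) := contDiff_sqSize.continuous.div_const _
    filter_upwards [(isOpen_lt hc continuous_const).mem_nhds hn] with w hw'
    have hw' : sqSize w / ((n : ℝ) + 1) < 1 := hw'
    simp only [F, ψ]
    rw [Real.smoothTransition.one_of_one_le (by linarith), mul_one]
  refine ⟨F, A ^ 2 + M, by positivity, fun n => ⟨hF n, (hF n).1.continuous.measurable,
    (h.continuous_gen (hF n)).measurable⟩, fun n z hz => ⟨?_, ?_⟩, fun z hz => ⟨?_, ?_⟩⟩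
  · simp only [F]
    rw [abs_mul]
    have := hV0 z
    calc _ ≤ A ^ 2 * sqSize z * 1 := by
          gcongr
          · exact huv z hz
          · simp only [ψ]
            rw [abs_of_nonneg (Real.smoothTransition.nonneg _)]
            exact Real.smoothTransition.le_one _
      _ ≤ _ := by rw [mul_one]; gcongr; linarith
  · refine (hgen n z hz).trans ?_
    have := hV0 z
    gcongr
    nlinarith
  · refine tendsto_const_nhds.congr' ?_
    filter_upwards [hlim z hz] with n hn
    rw [hn.eq_of_nhds, mul_one]
  · refine tendsto_const_nhds.congr' ?_
    filter_upwards [hlim z hz] with n hn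
    rw [h.gen_eq u v (T := fun _ => 1) (T' := fun _ => 0) (T'' := fun _ => 0)
      (fun s => hasDerivAt_const s 1) (fun s => hasDerivAt_const s 0) hn]
    simp

theorem isQuadraticModel (h : IsDiffusion L K J σ B) :
    IsQuadraticModel (smoothCompact N) L K (fun z => z) sqSize J (fun x ξ => 2 * σ x ξ) where
  lyapunov := h.isLyapunov
  approx := h.isApproximable
  meas_V := contDiff_sqSize.continuous.measurable
  meas_ι := measurable_id
  sq_le z _ := sq_le_sqSize z
  le_sq := ⟨1, fun _ _ => (one_mul _).ge⟩
  nonneg z _ := sqSize_nonneg z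

end IsDiffusion

end DiffusionModel

/-! ### Ginzburg–Landau dynamics and Brownian energy process -/

section DiffusionExamples

variable {N : ℕ}

theorem unitVec_eq_zero {x : ℕ} (hx : x ∉ Finset.Ioo 0 N) : unitVec N x = 0 :=
  funext fun z => if_neg fun h => hx (by rw [← h]; exact z.2)

theorem bondVec_zero : bondVec N 0 = unitVec N 1 := by
  rw [bondVec, unitVec_eq_zero (x := 0) (by simp), sub_zero]

/-- On the last bond only the bulk end moves, with a minus sign: first derivatives change sign and
second derivatives do not. -/
theorem bondVec_last (hN : 2 ≤ N) : bondVec N (N - 1) = -unitVec N (N - 1) := by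
  rw [bondVec, unitVec_eq_zero (x := N - 1 + 1) (by simp; omega), zero_sub]

theorem dirDeriv_neg (v : Site N → ℝ) (f : (Site N → ℝ) → ℝ) (z : Site N → ℝ) :
    dirDeriv (-v) f z = -dirDeriv v f z := by
  simp [dirDeriv]

theorem dirDeriv_dirDeriv_neg (v : Site N → ℝ) (f : (Site N → ℝ) → ℝ) (z : Site N → ℝ) :
    dirDeriv (-v) (dirDeriv (-v) f) z = dirDeriv v (dirDeriv v f) z := by
  have h : dirDeriv (-v) f = -dirDeriv v f := funext fun w => dirDeriv_neg v f w
  rw [dirDeriv_neg, h, dirDeriv, dirDeriv, fderiv_neg]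
  simp

theorem bondWeight_of_pos (l r : ℝ) {x : ℕ} (hx : 0 < x) (hxN : x + 1 ≠ N) :
    bondWeight N l r x = 1 := by
  rw [bondWeight, if_neg hx.ne', if_neg hxN]

theorem bondWeight_last (hN : 2 ≤ N) (l r : ℝ) : bondWeight N l r (N - 1) = r := by
  rw [bondWeight, if_neg (by omega), if_pos (by omega)]

theorem bondWeight_one (x : ℕ) : bondWeight N 1 1 x = 1 := by
  simp [bondWeight]

theorem abs_bondWeight_le (l r : ℝ) (x : ℕ) : |bondWeight N l r x| ≤ |l| + |r| + 1 := by
  have h1 := abs_nonneg l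
  have h2 := abs_nonneg r
  unfold bondWeight
  split_ifs
  · linarith
  · linarith
  · rw [abs_one]
    linarith

theorem abs_prof_le (a b : ℝ) (x : ℕ) (z : Site N → ℝ) :
    |(Aff.prof N a b x).eval z| ≤ (|a| + |b| + 1) * √(sqSize z) := by
  have h1 := abs_nonneg a
  have h2 := abs_nonneg b
  have h3 : 1 ≤ √(sqSize z) := Real.one_le_sqrt.2 (one_le_sqSize z)
  rw [Aff.prof_eval]
  split_ifs
  · nlinarith
  · nlinarith
  · have : |val z x| ≤ √(sqSize z) := by
      unfold val
      split_ifs with h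
      · exact Real.abs_le_sqrt (sq_le_sqSize z _)
      · rw [abs_zero]
        positivity
    nlinarith

theorem abs_fick_le (c l r a b : ℝ) (x : ℕ) (z : Site N → ℝ) :
    |fick N c l r a b x z| ≤ 2 * (|c| * (|l| + |r| + 1) * (|a| + |b| + 1)) * √(sqSize z) := by
  rw [fick, abs_mul, abs_mul]
  calc _ ≤ |c| * (|l| + |r| + 1) * ((|a| + |b| + 1) * √(sqSize z)
        + (|a| + |b| + 1) * √(sqSize z)) := by
        gcongr
        · exact abs_bondWeight_le l r x
        · exact (abs_sub _ _).trans (add_le_add (abs_prof_le a b x z) (abs_prof_le a b (x + 1) z))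
    _ = _ := by ring

theorem continuous_fick (c l r a b : ℝ) (x : ℕ) : Continuous (fick N c l r a b x) :=
  continuous_const.mul ((Aff.contDiff _).continuous.sub (Aff.contDiff _).continuous)

/-- Dissipation of the Brownian energy process. -/
def bepDiffusivity (N : ℕ) (l r a b : ℝ) (x : ℕ) (z : Site N → ℝ) : ℝ :=
  bondWeight N l r x * ((Aff.prof N a b x).eval z * (Aff.prof N a b (x + 1)).eval z)

theorem abs_bepDiffusivity_le (l r a b : ℝ) (x : ℕ) (z : Site N → ℝ) :
    |bepDiffusivity N l r a b x z| ≤ (|l| + |r| + 1) * (|a| + |b| + 1) ^ 2 * sqSize z := by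
  rw [bepDiffusivity, abs_mul, abs_mul]
  calc _ ≤ (|l| + |r| + 1) * (((|a| + |b| + 1) * √(sqSize z))
        * ((|a| + |b| + 1) * √(sqSize z))) := by
        gcongr
        · exact abs_bondWeight_le l r x
        · exact abs_prof_le a b x z
        · exact abs_prof_le a b (x + 1) z
    _ = (|l| + |r| + 1) * (|a| + |b| + 1) ^ 2 * √(sqSize z) ^ 2 := by ring
    _ = _ := by rw [Real.sq_sqrt (sqSize_nonneg z)]

theorem fick_zero (hN : 2 ≤ N) (c l r a b : ℝ) (z : Site N → ℝ) :
    fick N c l r a b 0 z = c * l * (a - val z 1) := by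
  simp [fick, Aff.prof_eval, bondWeight, show 1 ≠ N by omega]

theorem fick_last (hN : 2 ≤ N) (c l r a b : ℝ) (z : Site N → ℝ) :
    fick N c l r a b (N - 1) z = c * r * (val z (N - 1) - b) := by
  simp [fick, Aff.prof_eval, bondWeight_last hN, show N - 1 ≠ 0 by omega,
    show N - 1 ≠ N by omega, show N - 1 + 1 = N by omega, show N ≠ 0 by omega]

theorem fick_bulk (c l r a b : ℝ) {x : ℕ} (hx : 0 < x) (hxN : x + 1 < N) (z : Site N → ℝ) :
    fick N c l r a b x z = c * (val z x - val z (x + 1)) := by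
  simp [fick, Aff.prof_eval, bondWeight_of_pos l r hx hxN.ne, hx.ne', hxN.ne,
    show x ≠ N by omega]

theorem glGen_eq (hN : 2 ≤ N) (a b : ℝ) (f : (Site N → ℝ) → ℝ) :
    glGen N a b f = diffGen (fick N 1 1 1 a b) (fun _ _ => 1) f := by
  ext z
  rw [diffGen, sum_range_eq_boundary_add hN, glGen, bondVec_zero, bondVec_last hN, dirDeriv_neg,
    dirDeriv_dirDeriv_neg, fick_zero hN, fick_last hN]
  refine congrArg₂ _ (congrArg₂ _ (Finset.sum_congr rfl fun x hx => ?_) (by ring)) (by ring)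
  obtain ⟨h1, h2⟩ := Finset.mem_Icc.1 hx
  rw [fick_bulk 1 1 1 a b h1 (by omega), bondVec]
  ring

/-- The drift Tα - z/2 is α · (1/(2α)) · (2αT - z) and the diffusivity Tz is (1/(2α)) · 2αT · z. A
bath is thus a frozen site of density 2αT coupled with strength 1/(2α). -/
theorem bepGen_eq (hN : 2 ≤ N) {α : ℝ} (hα : 0 < α) (Tm Tp : ℝ) (f : (Site N → ℝ) → ℝ) :
    bepGen N α Tm Tp f = diffGen
      (fick N α (1 / (2 * α)) (1 / (2 * α)) (2 * α * Tm) (2 * α * Tp))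
      (bepDiffusivity N (1 / (2 * α)) (1 / (2 * α)) (2 * α * Tm) (2 * α * Tp)) f := by
  ext z
  rw [diffGen, sum_range_eq_boundary_add hN, bepGen, bepReservoir, bepReservoir, bondVec_zero,
    bondVec_last hN, dirDeriv_neg, dirDeriv_dirDeriv_neg, fick_zero hN, fick_last hN,
    bepDiffusivity, bepDiffusivity, bondWeight_last hN]
  simp only [Aff.prof_eval, if_true, zero_add, one_ne_zero, if_false, show 1 ≠ N by omega,
    show N - 1 ≠ 0 by omega, show N - 1 ≠ N by omega, show N - 1 + 1 = N by omega,
    show N ≠ 0 by omega, bondWeight]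
  refine congrArg₂ _ (congrArg₂ _ (Finset.sum_congr rfl fun x hx => ?_) ?_) ?_
  · obtain ⟨h1, h2⟩ := Finset.mem_Icc.1 hx
    rw [fick_bulk _ _ _ _ _ h1 (by omega), bepDiffusivity, bondWeight_of_pos _ _ h1 (by omega),
      ← val_eq_prof h1 (by omega), ← val_eq_prof (Nat.succ_pos x) (by omega),
      show unitVec N x - unitVec N (x + 1) = -bondVec N x by rw [bondVec, neg_sub],
      dirDeriv_dirDeriv_neg, dirDeriv_neg]
    ring
  · field_simp
  · field_simp
    ring

theorem isDiffusion_glGen (hN : 2 ≤ N) (a b : ℝ) :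
    ∃ B, IsDiffusion (glGen N a b) univ (fick N 1 1 1 a b) (fun _ _ => 1) B := by
  refine ⟨2 * Fintype.card (Site N) + 2 * (|1| * (|1| + |1| + 1) * (|a| + |b| + 1)) + 1,
    glGen_eq hN a b, continuous_fick 1 1 1 a b, fun _ => continuous_const, ?_, fun z _ x => ?_,
    fun z _ x => ?_⟩
  · have : (0 : ℝ) ≤ 2 * (|1| * (|1| + |1| + 1) * (|a| + |b| + 1)) := by positivity
    linarith
  · refine (abs_fick_le 1 1 1 a b x z).trans ?_
    gcongr
    have : (0 : ℝ) ≤ 2 * Fintype.card (Site N) := by positivity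
    linarith
  · rw [abs_one]
    refine one_le_mul_of_one_le_of_one_le (le_add_of_nonneg_left (by positivity)) (one_le_sqSize z)

theorem isDiffusion_bepGen (hN : 2 ≤ N) {α : ℝ} (hα : 0 < α) (Tm Tp : ℝ) :
    ∃ B, IsDiffusion (bepGen N α Tm Tp) {ξ | ∀ x, 0 ≤ ξ x}
      (fick N α (1 / (2 * α)) (1 / (2 * α)) (2 * α * Tm) (2 * α * Tp))
      (bepDiffusivity N (1 / (2 * α)) (1 / (2 * α)) (2 * α * Tm) (2 * α * Tp)) B := by
  set l := 1 / (2 * α)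
  set a := 2 * α * Tm
  set b := 2 * α * Tp
  have h1 : (0 : ℝ) ≤ 2 * Fintype.card (Site N) := by positivity
  have h2 : 0 ≤ 2 * (|α| * (|l| + |l| + 1) * (|a| + |b| + 1)) := by positivity
  have h3 : 0 ≤ (|l| + |l| + 1) * (|a| + |b| + 1) ^ 2 := by positivity
  refine ⟨2 * Fintype.card (Site N) + 2 * (|α| * (|l| + |l| + 1) * (|a| + |b| + 1))
    + (|l| + |l| + 1) * (|a| + |b| + 1) ^ 2,
    bepGen_eq hN hα Tm Tp, continuous_fick α l l a b, fun x => continuous_const.mul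
      ((Aff.contDiff _).continuous.mul (Aff.contDiff _).continuous), by linarith, fun z _ x => ?_,
    fun z _ x => ?_⟩
  · refine (abs_fick_le α l l a b x z).trans ?_
    gcongr
    linarith
  · refine (abs_bepDiffusivity_le l l a b x z).trans ?_
    have := sqSize_nonneg z
    gcongr
    linarith

end DiffusionExamples

/-- The mobility is the constant p₀ = 2. The conditions γ = 2 + 2k₃ and γ' = -2 - 2k₃ give the
sources for k₃ = 0, and both vanish for k₃ = -1. -/
theorem gl_closedEquation {N : ℕ} (hN : 2 ≤ N) {Ω : Type*} [mΩ : MeasurableSpace Ω]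
    (P : Measure Ω) [IsProbabilityMeasure P] (ℱ : Filtration ℝ≥0 mΩ) (a b : ℝ)
    (μ : Measure (Site N → ℝ)) (z : ℝ≥0 → Ω → Site N → ℝ)
    (hμ : ∀ x, MemLp (fun ξ : Site N → ℝ => ξ x) 2 μ)
    (hz : IsProcess P ℱ (smoothCompact N) (glGen N a b) univ μ z) :
    (∀ t x, MemLp (fun ω => z t ω x) 2 P) ∧
    ClosedEquation N (triangle N) (corr P N (field z) fun u r => u ^ 2 - r ^ 2)
      (lap2D N 1 0 1 1)
      (fun _ p => (if p.2 = p.1 + 1 then -2 * (N : ℝ) ^ 2 else 0)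
        + (if p.2 = p.1 then 4 * (N : ℝ) ^ 2 else 0)) ∧
    ClosedEquation N (triangle N) (corr P N (field z) fun u r => u ^ 2 - r ^ 2 - 1)
      (lap2D N 1 0 1 1) (fun _ _ => 0) := by
  obtain ⟨B, hB⟩ := isDiffusion_glGen hN a b
  have hM := hB.isQuadraticModel
  have hQ : ∀ x < N, (fun _ : Site N → ℝ => 2 * (1 : ℝ)) ∈ quadSpan N := fun x _ => by
    have h := Submodule.smul_mem _ (2 : ℝ) (mul_mem_quadSpan (Aff.one N) (Aff.one N))
    convert h using 1
    ext
    simp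
  have hS := fun (F : ℝ → ℝ → ℝ) (k₃ : ℝ) (hF : ∀ u ρ, F u ρ = 1 * u ^ 2 + 0 * u - ρ ^ 2 + k₃) =>
    hM.isMomentSystem hN hz hμ hQ (Y := field z) (fun _ _ _ => rfl) hF
  have h1 := (hS (fun u r => u ^ 2 - r ^ 2) 0 fun u ρ => by ring).closedEquation_lap2D (p₀ := 2)
    (q₀ := 0) (d := 0) (γ := 2) (γ' := -2) (S := triangle N) one_pos (by norm_num) zero_le_one
    zero_le_one (fun t x _ => by simp [bondWeight_one]) subset_rfl (fun _ _ => by norm_num)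
    (fun _ _ _ _ => by ring) (by norm_num)
  have h2 := (hS (fun u r => u ^ 2 - r ^ 2 - 1) (-1) fun u ρ => by ring).closedEquation_lap2D
    (p₀ := 2) (q₀ := 0) (d := 0) (γ := 0) (γ' := 0) (S := triangle N) one_pos (by norm_num)
    zero_le_one zero_le_one (fun t x _ => by simp [bondWeight_one]) subset_rfl
    (fun _ _ => by norm_num) (fun _ _ _ _ => by ring) (by norm_num)
  refine ⟨hM.memLp hz hμ, ?_, ?_⟩
  · convert! h1 using 1
    ext t p
    simp only [bondWeight_one]
    split_ifs <;> ring
  · convert! h2 using 1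
    ext t p
    simp

/-- The mobility is twice a product of neighbouring values, the case p₀ = q₀ = 0, d = 1, so k₁(α+1)
= α is the only nontrivial condition. -/
theorem bep_closedEquation {N : ℕ} (hN : 2 ≤ N) {Ω : Type*} [mΩ : MeasurableSpace Ω]
    (P : Measure Ω) [IsProbabilityMeasure P] (ℱ : Filtration ℝ≥0 mΩ) {α : ℝ} (hα : 0 < α)
    (Tm Tp : ℝ) (μ : Measure (Site N → ℝ)) (z : ℝ≥0 → Ω → Site N → ℝ)
    (hμ : ∀ x, MemLp (fun ξ : Site N → ℝ => ξ x) 2 μ)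
    (hz : IsProcess P ℱ (smoothCompact N) (bepGen N α Tm Tp) {ξ | ∀ x, 0 ≤ ξ x} μ z) :
    (∀ t x, MemLp (fun ω => z t ω x) 2 P) ∧
    ClosedEquation N (triangle N) (corr P N (field z) fun u r => α / (α + 1) * u ^ 2 - r ^ 2)
      (lap2D N α 1 (1 / (2 * α)) (1 / (2 * α)))
      (fun t p => if p.2 = p.1 + 1 then
        (N : ℝ) ^ 2 * (density P N (field z) (2 * α * Tm) (2 * α * Tp) t (p.1 + 1)
          - density P N (field z) (2 * α * Tm) (2 * α * Tp) t p.1) ^ 2 else 0) := by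
  obtain ⟨B, hB⟩ := isDiffusion_bepGen hN hα Tm Tp
  have hM := hB.isQuadraticModel
  have hQ : ∀ x < N, (fun ξ => 2 * bepDiffusivity N (1 / (2 * α)) (1 / (2 * α)) (2 * α * Tm)
      (2 * α * Tp) x ξ) ∈ quadSpan N := fun x _ => by
    have h := Submodule.smul_mem _ (2 * bondWeight N (1 / (2 * α)) (1 / (2 * α)) x)
      (mul_mem_quadSpan (Aff.prof N (2 * α * Tm) (2 * α * Tp) x)
        (Aff.prof N (2 * α * Tm) (2 * α * Tp) (x + 1)))
    convert h using 1
    ext ξ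
    simp [bepDiffusivity, mul_assoc]
  have hS := hM.isMomentSystem hN hz hμ hQ (Y := field z) (fun _ _ _ => rfl)
    (F := fun u r => α / (α + 1) * u ^ 2 - r ^ 2) (k₁ := α / (α + 1)) (k₂ := 0) (k₃ := 0)
    (fun u ρ => by ring)
  have hl : 0 ≤ 1 / (2 * α) := by positivity
  have hC := hS.closedEquation_lap2D (p₀ := 0) (q₀ := 0) (d := 1) (γ := 0) (γ' := 0)
    (S := triangle N) hα (by positivity) hl hl
    (fun t x _ => by
      simp only [bepDiffusivity]
      rw [integral_const_mul, integral_const_mul]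
      ring) subset_rfl
    (fun _ _ => ⟨by field_simp, by ring, by ring⟩)
    (fun _ _ _ _ => by field_simp; ring) (by ring)
  refine ⟨hM.memLp hz hμ, ?_⟩
  convert! hC using 3 with t p
  simp

end TwoPoint

end

/-! ### The four models together. -/

theorem theorem1p1 (N : ℕ) (hN : 2 ≤ N) {Ω : Type*} [mΩ : MeasurableSpace Ω]
    (P : Measure Ω) [IsProbabilityMeasure P] (ℱ : Filtration ℝ≥0 mΩ) :
    -- Interacting particles: exclusion, inclusion, independent walks
    (∀ (c d lm lp rm rp : ℝ), 0 < c → (d < 0 → ∃ κ : ℕ, c = -d * κ) →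
      lm ∈ Ioc (0 : ℝ) 1 → lp ∈ Ioc (0 : ℝ) 1 → 0 < rm → 0 < rp →
      (d < 0 → rm < -c / d ∧ rp < -c / d) →
      ∀ (μ : Measure (TwoPoint.Site N → ℕ)) (η : ℝ≥0 → Ω → TwoPoint.Site N → ℕ),
        (∀ x, MemLp (fun ξ : TwoPoint.Site N → ℕ => (ξ x : ℝ)) 2 μ) →
        TwoPoint.IsProcess P ℱ (TwoPoint.finSupp (TwoPoint.Site N → ℕ))
          (TwoPoint.particleGen N c d lm lp rm rp) (TwoPoint.particleStates N c d) μ η →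
        (∀ t x, MemLp (fun ω => (η t ω x : ℝ)) 2 P) ∧
        TwoPoint.ClosedEquation N
          {p | p ∈ TwoPoint.triangle N ∧ (p.1 = p.2 → c + d ≠ 0)}
          (TwoPoint.corr P N (TwoPoint.occ η) fun u r => c / (c + d) * (u * (u - 1)) - r ^ 2)
          (TwoPoint.lap2D N c d lm lp)
          (fun t p => if p.2 = p.1 + 1 then
            d * (N : ℝ) ^ 2 * (TwoPoint.density P N (TwoPoint.occ η) rm rp t (p.1 + 1)
              - TwoPoint.density P N (TwoPoint.occ η) rm rp t p.1) ^ 2 else 0)) ∧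
    -- Ginzburg–Landau dynamics
    (∀ (a b : ℝ) (μ : Measure (TwoPoint.Site N → ℝ)) (z : ℝ≥0 → Ω → TwoPoint.Site N → ℝ),
        (∀ x, MemLp (fun ξ : TwoPoint.Site N → ℝ => ξ x) 2 μ) →
        TwoPoint.IsProcess P ℱ (TwoPoint.smoothCompact N) (TwoPoint.glGen N a b) univ μ z →
        (∀ t x, MemLp (fun ω => z t ω x) 2 P) ∧
        TwoPoint.ClosedEquation N (TwoPoint.triangle N)
          (TwoPoint.corr P N (TwoPoint.field z) fun u r => u ^ 2 - r ^ 2)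
          (TwoPoint.lap2D N 1 0 1 1)
          (fun _ p => (if p.2 = p.1 + 1 then -2 * (N : ℝ) ^ 2 else 0)
            + (if p.2 = p.1 then 4 * (N : ℝ) ^ 2 else 0)) ∧
        TwoPoint.ClosedEquation N (TwoPoint.triangle N)
          (TwoPoint.corr P N (TwoPoint.field z) fun u r => u ^ 2 - r ^ 2 - 1)
          (TwoPoint.lap2D N 1 0 1 1)
          (fun _ _ => 0)) ∧
    -- Brownian energy process
    (∀ (α Tm Tp : ℝ), 0 < α → 0 < Tm → 0 < Tp →
      ∀ (μ : Measure (TwoPoint.Site N → ℝ)) (z : ℝ≥0 → Ω → TwoPoint.Site N → ℝ),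
        (∀ x, MemLp (fun ξ : TwoPoint.Site N → ℝ => ξ x) 2 μ) →
        TwoPoint.IsProcess P ℱ (TwoPoint.smoothCompact N) (TwoPoint.bepGen N α Tm Tp)
          {ξ | ∀ x, 0 ≤ ξ x} μ z →
        (∀ t x, MemLp (fun ω => z t ω x) 2 P) ∧
        TwoPoint.ClosedEquation N (TwoPoint.triangle N)
          (TwoPoint.corr P N (TwoPoint.field z) fun u r => α / (α + 1) * u ^ 2 - r ^ 2)
          (TwoPoint.lap2D N α 1 (1 / (2 * α)) (1 / (2 * α)))
          (fun t p => if p.2 = p.1 + 1 then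
            (N : ℝ) ^ 2 *
              (TwoPoint.density P N (TwoPoint.field z) (2 * α * Tm) (2 * α * Tp) t (p.1 + 1)
                - TwoPoint.density P N (TwoPoint.field z) (2 * α * Tm) (2 * α * Tp) t p.1) ^ 2
            else 0)) ∧
    -- Open harmonic model (interacting piles)
    (∀ (α : ℕ) (bm bp : ℝ), 1 ≤ α → bm ∈ Ioo (0 : ℝ) 1 → bp ∈ Ioo (0 : ℝ) 1 →
      ∀ (μ : Measure (TwoPoint.Site N → ℕ)) (η : ℝ≥0 → Ω → TwoPoint.Site N → ℕ),
        (∀ x, MemLp (fun ξ : TwoPoint.Site N → ℕ => (ξ x : ℝ)) 2 μ) →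
        TwoPoint.IsProcess P ℱ (TwoPoint.finSupp (TwoPoint.Site N → ℕ))
          (TwoPoint.pileGen N α bm bp) univ μ η →
        (∀ t x, MemLp (fun ω => (η t ω x : ℝ)) 2 P) ∧
        TwoPoint.ClosedEquation N (TwoPoint.triangle N)
          (TwoPoint.corr P N (TwoPoint.occ η)
            fun u r => (α : ℝ) / (α + 1) * (u * (u - 1)) - r ^ 2)
          (TwoPoint.pileLap2D N α)
          (fun t p => if p.2 = p.1 then
            (N : ℝ) ^ 2 / ((α : ℝ) * (α + 1)) *
              ((TwoPoint.density P N (TwoPoint.occ η) (α * bm / (1 - bm)) (α * bp / (1 - bp))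
                    t (p.1 + 1)
                  - TwoPoint.density P N (TwoPoint.occ η) (α * bm / (1 - bm))
                    (α * bp / (1 - bp)) t p.1) ^ 2
                + (TwoPoint.density P N (TwoPoint.occ η) (α * bm / (1 - bm))
                    (α * bp / (1 - bp)) t (p.1 - 1)
                  - TwoPoint.density P N (TwoPoint.occ η) (α * bm / (1 - bm))
                    (α * bp / (1 - bp)) t p.1) ^ 2)
            else 0)) :=
  ⟨fun c d lm lp rm rp hc hκ hlm hlp hrm hrp hd μ η hμ hη =>
      TwoPoint.particle_closedEquation hN P ℱ c d lm lp rm rp hc hκ hlm hlp hrm hrp hd μ η hμ hη,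
    fun a b μ z hμ hz => TwoPoint.gl_closedEquation hN P ℱ a b μ z hμ hz,
    fun _ Tm Tp hα _ _ μ z hμ hz => TwoPoint.bep_closedEquation hN P ℱ hα Tm Tp μ z hμ hz,
    fun α bm bp hα hbm hbp μ η hμ hη =>
      TwoPoint.pile_closedEquation hN P ℱ α bm bp hα hbm hbp μ η hμ hη⟩
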